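/- Let $d\ge 1$, $\alpha\in[\tfrac12,1)$ and $q\in[1,\infty]$ be such that either $q<\infty$ and $q(1-\alpha)>d$, or $q=\infty$. Then there is a constant $C>0$, depending only on $d,\alpha,q$, with the following property. Let $L>0$ and let $\mathbb T^d$ be the $d$-dimensional torus of side length $L$ with Lebesgue measure. Let $U\in L^\infty(\mathbb R^+;W^{1,q}(\mathbb T^d;\mathbb R^d))$ with $\operatorname{div}U=0$, and let $u_0\in L^2(\mathbb T^d;\mathbb R^d)$ be divergence free with mean zero. Write $\hat f_k=L^{-d}\int_{\mathbb T^d}f(x)e^{-2\pi i k\cdot x/L}\,dx$ for $k\in\mathbb Z^d$, and set $$\|f\|_{H^{-\alpha}}=\Big(\tfrac{2\pi}{L}\Big)^{-\alpha}\Big\|\sum_{k\neq0}|k|^{-\alpha}\hat f_k e^{2\pi i k\cdot x/L}\Big\|_{L^2},\qquad P_Nf=\sum_{|k|_\infty\le N}\hat f_k e^{2\pi i k\cdot x/L},$$ $$\mathbf P_Nf=\sum_{|k|_\infty\le N}\Big(\hat f_k-\frac{\hat f_k\cdot k}{|k|^2}k\Big)e^{2\pi i k\cdot x/L}$$ (the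 term $k=0$ of the last sum being $\hat f_0$). Let $U_N=P_NU$, and let $u_N(t,x)=\sum_{|k|_\infty\le N}\hat u^N_k(t)e^{2\pi i k\cdot x/L}$ be the solution of $$\partial_tu_N+\mathbf P_N\big((U_N\cdot\nabla)u_N\big)=0,\qquad u_N(0)=\mathbf P_Nu_0,$$ the equation being understood as integrated in time. Write $[y]_+=\max(y,0)$. Then: 1. For all $N\in\mathbb N$ and $t\ge0$, $$\|u_N(t)\|_{H^{-\alpha}}\ge\Big[\|u_N(0)\|_{H^{-\alpha}}^{\frac{1-\alpha}{\alpha}}-t\,\tfrac{1-\alpha}{\alpha}\,C\,\|u_N(0)\|_{L^2}^{\frac{1-\alpha}{\alpha}}\|U_N\|_{L^\infty_tW^{1,q}_x}\Big]_+^{\frac{\alpha}{1-\alpha}}.$$ 2. Let $u$ be any limit of a subsequence of $(u_N)$, weakly-$*$ in $L^\infty_{\mathrm{loc}}(\mathbb R^+;L^2(\mathbb T^d))$. Then, after modification on a null set of times, $u(t)\in L^2$ for every $t\ge 0$, $u\in C([0,\infty);H^{-\alpha}(\mathbb T^d))$, $u(0)=u_0$, and for all $t\ge0$, $$\|u(t)\|_{H^{-\alpha}}\ge\Big[\|u_0\|_{H^{-\alpha}}^{\frac{1-\alpha}{\alpha}}-t\,\tfrac{1-\alpha}{\alpha}\,C\,\|u_0\|_{L^2}^{\frac{1-\alpha}{\alpha}}\|U\|_{L^\infty_tW^{1,q}_x}\Big]_+^{\frac{\alpha}{1-\alpha}}.$$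 3. Consequently $u$ cannot be perfectly mixed before the time $$t_{\min}=\frac{\alpha\,\|u_0\|_{H^{-\alpha}}^{\frac{1-\alpha}{\alpha}}}{(1-\alpha)\,C\,\|u_0\|_{L^2}^{\frac{1-\alpha}{\alpha}}\|U\|_{L^\infty_tW^{1,q}_x}},$$ that is, $\inf\{t\ge0:\|u(t)\|_{H^{-\alpha}}=0\}\ge t_{\min}$ (with $t_{\min}=\infty$ if $U=0$ and $u_0\ne0$, $t_{\min}=0$ if $u_0=0$, and $\inf\emptyset=\infty$). -/

import Mathlib

open MeasureTheory Filter Topology Set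
open scoped ENNReal ContDiff

noncomputable section

namespace VectorMixing

/-- The torus `𝕋^d` of side length `L`. Its `volume` is Lebesgue measure, of total mass `L ^ d`. -/
abbrev Torus (d : ℕ) (L : ℝ) : Type := Fin d → AddCircle L

/-- Values of vector fields: `ℝ^d` with the Euclidean norm. -/
abbrev Vec (d : ℕ) : Type := EuclideanSpace ℝ (Fin d)

section Calculus

variable {d : ℕ} {L : ℝ} {F : Type*} [NormedAddCommGroup F] [NormedSpace ℝ F]

/-- The partial derivative `∂_j f (x)` on the torus. -/
def partialDeriv (j : Fin d) (f : Torus d L → F) (x : Torus d L) : F :=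
  deriv (fun s : ℝ => f (x + Pi.single j (s : AddCircle L))) 0

/-- `f` is `C^∞` on the torus: its periodic lift to `ℝ^d` is `C^∞`. -/
def IsSmooth (f : Torus d L → F) : Prop :=
  ContDiff ℝ ∞ (fun y : Fin d → ℝ => f (fun i => (y i : AddCircle L)))

/-- The transport term `((V · ∇) w)(x) = ∑_j V_j(x) ∂_j w(x)`. -/
def transport (V w : Torus d L → Vec d) (x : Torus d L) : Vec d :=
  ∑ j, V x j • partialDeriv j w x

end Calculus

section Fields

variable {d : ℕ} {L : ℝ} [Fact (0 < L)]

/-- The `G j` are the weak partial derivatives `∂_j V` of the vector field `V`. -/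
def IsWeakGradient (V : Torus d L → Vec d) (G : Fin d → Torus d L → Vec d) : Prop :=
  Integrable V ∧ ∀ j, Integrable (G j) ∧
    ∀ ψ : Torus d L → ℝ, IsSmooth ψ →
      ∫ x, partialDeriv j ψ x • V x = - ∫ x, ψ x • G j x

/-- The norm `‖V‖_{W^{1,q}} = ‖V‖_{L^q} + ∑_j ‖∂_j V‖_{L^q}`, with value `∞` if `V ∉ W^{1,q}`.
The weak gradient is unique up to null sets, so the infimum only selects it. -/
def sobolevNorm (q : ℝ≥0∞) (V : Torus d L → Vec d) : ℝ≥0∞ :=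
  ⨅ (G : Fin d → Torus d L → Vec d) (_ : IsWeakGradient V G),
    eLpNorm V q volume + ∑ j, eLpNorm (G j) q volume

/-- The norm of `L^∞(ℝ⁺; W^{1,q}(𝕋^d))`. -/
def supSobolevNorm (q : ℝ≥0∞) (V : ℝ → Torus d L → Vec d) : ℝ≥0∞ :=
  essSup (fun t => sobolevNorm q (V t)) (volume.restrict (Ioi (0 : ℝ)))

/-- `div V = 0` in the sense of distributions. -/
def IsDivFree (V : Torus d L → Vec d) : Prop :=
  ∀ ψ : Torus d L → ℝ, IsSmooth ψ → ∫ x, ∑ j, V x j * partialDeriv j ψ x = 0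

/-- The character `x ↦ exp (2 π i k · x / L)`. -/
def character (k : Fin d → ℤ) (x : Torus d L) : ℂ :=
  ∏ i, fourier (k i) (x i)

/-- The `i`-th component of the Fourier coefficient
`f̂_k = L^{-d} ∫ f(x) exp (- 2 π i k · x / L) dx`. -/
def coeff (f : Torus d L → Vec d) (k : Fin d → ℤ) (i : Fin d) : ℂ :=
  ((L : ℂ) ^ d)⁻¹ * ∫ x, ((f x i : ℝ) : ℂ) * character (-k) x

/-- The Euclidean length `|k|` of a frequency. -/
def freqNorm (k : Fin d → ℤ) : ℝ :=
  √(∑ i, (k i : ℝ) ^ 2)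

/-- The frequencies with `|k|_∞ ≤ N`. -/
def freqBox (d N : ℕ) : Finset (Fin d → ℤ) :=
  Fintype.piFinset fun _ => Finset.Icc (-(N : ℤ)) (N : ℤ)

/-- The trigonometric polynomial `∑_{|k|_∞ ≤ N} c_k exp (2 π i k · x / L)`. The real part is only a
change of type: for `c_{-k} = conj c_k`, as for coefficients of real fields, the sum is real. -/
def trigPoly (N : ℕ) (c : (Fin d → ℤ) → Fin d → ℂ) (x : Torus d L) : Vec d :=
  WithLp.toLp 2 fun i => (∑ k ∈ freqBox d N, c k i * character k x).re

/-- The Fourier truncation `P_N`. -/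
def truncate (N : ℕ) (f : Torus d L → Vec d) : Torus d L → Vec d :=
  trigPoly N (coeff f)

/-- The projection `𝐏_N` onto divergence-free fields with frequencies `|k|_∞ ≤ N`:
`𝐏_N f = ∑_{|k|_∞ ≤ N} (f̂_k - (f̂_k · k / |k|²) k) exp (2 π i k · x / L)`.
The mode `k = 0` is kept unchanged. -/
def lerayTruncate (N : ℕ) (f : Torus d L → Vec d) : Torus d L → Vec d :=
  trigPoly N fun k i =>
    coeff f k i - (∑ j, coeff f k j * (k j : ℂ)) / ((freqNorm k : ℂ) ^ 2) * (k i : ℂ)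

/-- The `L²` norm. -/
def l2Norm (f : Torus d L → Vec d) : ℝ :=
  (eLpNorm f 2 volume).toReal

/-- The homogeneous norm `‖f‖_{H^{-α}} = (2π/L)^{-α} ‖∑_{k ≠ 0} |k|^{-α} f̂_k e_k‖_{L²}` for `α > 0`,
with the `L²` norm written out by Parseval (`e_k` has `L²` norm squared `L ^ d`). The term `k = 0`
of the sum vanishes since `0 ^ (-2 α) = 0` for the real power. -/
def negSobolevNorm (α : ℝ) (f : Torus d L → Vec d) : ℝ :=
  (2 * Real.pi / L) ^ (-α) *
    √(L ^ d * ∑' k : Fin d → ℤ, freqNorm k ^ (-2 * α) * ∑ i, ‖coeff f k i‖ ^ 2)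

/-- `w` solves the spectral scheme `∂_t w + 𝐏_N ((U_N · ∇) w) = 0`, `w(0) = 𝐏_N u₀`, `U_N = P_N U`:
at each time `w` is a trigonometric polynomial with frequencies `|k|_∞ ≤ N`, and the system of
ordinary differential equations for its coefficients holds in integrated form, since `U` is only
measurable in time. -/
structure IsSpectralSolution (N : ℕ) (U : ℝ → Torus d L → Vec d) (u₀ : Torus d L → Vec d)
    (w : ℝ → Torus d L → Vec d) : Prop where
  bandLimited : ∀ t, 0 ≤ t → truncate N (w t) = w t
  continuous : ∀ x, ContinuousOn (fun t => w t x) (Ici 0)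
  integrable : ∀ t, 0 ≤ t → ∀ x,
    IntervalIntegrable (fun s => lerayTruncate N (transport (truncate N (U s)) (w s)) x) volume 0 t
  equation : ∀ t, 0 ≤ t → ∀ x, w t x = lerayTruncate N u₀ x
    - ∫ s in (0 : ℝ)..t, lerayTruncate N (transport (truncate N (U s)) (w s)) x

/-- `v j → u` weakly-* in `L^∞_loc(ℝ⁺; L²(𝕋^d))`: `u` is in this space, and for every `T > 0`
the pairings with every `ψ ∈ L¹(0,T; L²(𝕋^d))` converge. -/
structure IsWeakStarLimit (v : ℕ → ℝ → Torus d L → Vec d) (u : ℝ → Torus d L → Vec d) :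
    Prop where
  measurable : AEStronglyMeasurable (Function.uncurry u)
    ((volume.restrict (Ioi (0 : ℝ))).prod volume)
  bounded : ∀ T : ℝ, 0 < T →
    essSup (fun t => eLpNorm (u t) 2 volume) (volume.restrict (Ioo 0 T)) < ⊤
  tendsto : ∀ T : ℝ, 0 < T → ∀ ψ : ℝ → Torus d L → Vec d,
    AEStronglyMeasurable (Function.uncurry ψ) ((volume.restrict (Ioo 0 T)).prod volume) →
    ∫⁻ t in Ioo 0 T, eLpNorm (ψ t) 2 volume < ⊤ →
    Tendsto (fun j => ∫ t in Ioo 0 T, ∫ x, inner ℝ (v j t x) (ψ t x)) atTop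
      (𝓝 (∫ t in Ioo 0 T, ∫ x, inner ℝ (u t x) (ψ t x)))

/-- `v` is a representative of `u` (the same `L²` function at almost every time) that takes values
in `L²` at every time and belongs to `C([0,∞); H^{-α}(𝕋^d))`. -/
structure IsContinuousRepresentative (α : ℝ) (u v : ℝ → Torus d L → Vec d) : Prop where
  ae_eq : ∀ᵐ t ∂(volume.restrict (Ioi (0 : ℝ))), v t =ᵐ[volume] u t
  memLp : ∀ t, 0 ≤ t → MemLp (v t) 2 volume
  continuous : ∀ t, 0 ≤ t →
    Tendsto (fun s => negSobolevNorm α (v s - v t)) (𝓝[Ici 0] t) (𝓝 0)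

/-- The mixing time of `u`: the infimum of the times `t ≥ 0` with `‖u(t)‖_{H^{-α}} = 0`
(`∞` if there are none). -/
def mixingTime (α : ℝ) (u : ℝ → Torus d L → Vec d) : ℝ≥0∞ :=
  ⨅ (t : ℝ) (_ : 0 ≤ t) (_ : negSobolevNorm α (u t) = 0), ENNReal.ofReal t

end Fields

/-- `[a^{(1-α)/α} - t ((1-α)/α) C b^{(1-α)/α} M]_+^{α/(1-α)}`, where `[·]_+` is the positive part. -/
def lowerBound (α C a b M t : ℝ) : ℝ :=
  (max (a ^ ((1 - α) / α) - t * ((1 - α) / α) * C * b ^ ((1 - α) / α) * M) 0) ^ (α / (1 - α))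

/-- `t_min = α a^{(1-α)/α} / ((1-α) C b^{(1-α)/α} M)` in `[0,∞]`
(`∞` if only the denominator vanishes, `0` if the numerator vanishes). -/
def minMixingTime (α C a b M : ℝ) : ℝ≥0∞ :=
  ENNReal.ofReal (α * a ^ ((1 - α) / α)) /
    ENNReal.ofReal ((1 - α) * C * b ^ ((1 - α) / α) * M)

end VectorMixing

end

/-! Write Λ = √(-Δ) and let f be a solution at a fixed time. The pressure part of the equation is
parallel to k in Fourier space, while f̂_k ⊥ k, so it drops out of every energy identity with a
scalar Fourier weight (`sum_lerayCoeff_mul_conj`). What remains acts on the components of f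
separately. Since U is real and divergence free, U·∇ is skew-adjoint: the `L²` norm of u_N is
conserved, and for E = ‖f‖²_{H^{-α}} and φ = Λ^{-2α} f E' = 2 Re ∫ (U·∇φ) · conj (Λ^{2α} φ).

The heart of the proof is a commutator estimate, `abs_re_sum_transportMatrix_le`: this form is at
most C M ‖φ‖²_{H^{(1+α)/2}}, where M is the Hölder constant of exponent α of U. Up to a constant,
the symbol of Λ^{2α} is the integral over shifts h of |h|^{-d-2α} |e^{iξ·h} - 1|²
(`integral_symbol`). Skew-adjointness then converts the form, for each h, into ∫ (δ_h U·∇φ) conj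
(δ_h φ), with δ_h the increment by h (`re_incrementForm`). Now δ_h U gains |h|^α. The functions φ
are cut into dyadic blocks a, b; the derivative is placed on the lower of the two frequencies, and
δ_h φ contributes min(2^b |h|, 1). The integral over h converges because 0 < α < 1, and the blocks
are summed by Schur's test.

In terms of f the bound is ‖f‖²_{H^{-(3α-1)/2}}, which interpolates between `L²` and H^{-α}
(`sum_rpow_mul_le`). With σ = (1-α)/(2α) this gives E' ≥ -2K E^{1-σ}, where K = C M
‖u_N(0)‖_{L²}^{2σ}, hence E^σ decreases at most linearly (`rpow_sub_mul_le_of_integral_le`), which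
is the claimed bound. The Hölder constant comes from Morrey's inequality
`HasSobolevBound.ae_norm_translate_sub_le`, whose constant must not depend on L.

The bound for the limit u features ‖U‖, whereas the first one features ‖U_N‖, and cubic Fourier
truncation admits no uniform bound at q = ∞. So the first bound is not passed to the limit; the
energy argument is repeated for u. Weak-* convergence of u_N, together with the strong `L²`
convergence of U_N, shows that the Fourier coefficients converge at every time to those prescribed
by the integrated limit equation (`IsSpectralLimit.tendsto_coeff`). These are continuous in time and
square summable, and so define the representative v. Its energy is computed on a box of frequencies:
since α ≥ 1/2, Λ^{-2α} v has a square-integrable gradient, so the flux of the high frequencies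
contributes at most a multiple of the square root of the tail energy
(`norm_flux_sub_transportForm_le`), which vanishes as the box grows. The bound on the mixing time
only expresses that the lower bound is positive before t_min. -/

noncomputable section

namespace VectorMixing

open scoped ComplexConjugate

/-! ### Characters of the torus and Stone–Weierstrass -/

section Characters

variable {d : ℕ} {L : ℝ}

lemma character_zero (x : Torus d L) : character 0 x = 1 := by
  simp [character]

lemma character_freq_add (k l : Fin d → ℤ) (x : Torus d L) :
    character (k + l) x = character k x * character l x := by
  simp [character, ← Finset.prod_mul_distrib]

lemma character_freq_neg (k : Fin d → ℤ) (x : Torus d L) :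
    character (-k) x = conj (character k x) := by
  simp only [character, Pi.neg_apply, fourier_neg, map_prod]

lemma character_add (k : Fin d → ℤ) (x y : Torus d L) :
    character k (x + y) = character k x * character k y := by
  simp [character, ← Finset.prod_mul_distrib, fourier_apply, AddCircle.toCircle_add]

lemma norm_character (k : Fin d → ℤ) (x : Torus d L) : ‖character k x‖ = 1 := by
  simp only [character, fourier_apply, norm_prod]
  exact Finset.prod_eq_one fun i _ => Circle.norm_coe _

lemma character_mul_conj (k : Fin d → ℤ) (x : Torus d L) :
    character k x * conj (character k x) = 1 := by
  rw [Complex.mul_conj, Complex.normSq_eq_norm_sq, norm_character]; simp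

@[fun_prop]
lemma continuous_character (k : Fin d → ℤ) : Continuous (character k : Torus d L → ℂ) := by
  unfold character; fun_prop

/-- The character as a continuous map. -/
def characterMap (k : Fin d → ℤ) : C(Torus d L, ℂ) := ⟨character k, continuous_character k⟩

lemma characterMap_apply (k : Fin d → ℤ) (x : Torus d L) : characterMap k x = character k x := rfl

lemma character_single (i : Fin d) (x : Torus d L) :
    character (Pi.single i 1) x = (AddCircle.toCircle (x i) : ℂ) := by
  unfold character
  rw [Finset.prod_eq_single i]
  · rw [Pi.single_eq_same, fourier_one]
  · intro j _ hj
    rw [Pi.single_eq_of_ne hj, fourier_zero]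
  · simp

/-- The star subalgebra of continuous functions generated by the characters. -/
def characterSubalgebra (d : ℕ) (L : ℝ) : StarSubalgebra ℂ C(Torus d L, ℂ) where
  toSubalgebra := Algebra.adjoin ℂ (range characterMap)
  star_mem' := by
    change Algebra.adjoin ℂ (range characterMap) ≤ star (Algebra.adjoin ℂ (range characterMap))
    refine Algebra.adjoin_le ?_
    rintro _ ⟨n, rfl⟩
    refine Algebra.subset_adjoin ⟨-n, ?_⟩
    ext1 x
    simp [characterMap_apply, character_freq_neg]

lemma characterSubalgebra_coe :
    (characterSubalgebra d L).toSubalgebra.toSubmodule =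
      Submodule.span ℂ (range (characterMap (d := d) (L := L))) := by
  apply Algebra.adjoin_eq_span_of_subset
  refine .trans (fun x ↦ Submonoid.closure_induction (fun _ ↦ id) ⟨0, ?_⟩ ?_)
    Submodule.subset_span
  · ext z
    simp [characterMap_apply, character_zero]
  · rintro _ _ _ _ ⟨m, rfl⟩ ⟨n, rfl⟩
    refine ⟨m + n, ?_⟩
    ext z
    simp [characterMap_apply, character_freq_add]

lemma characterSubalgebra_separatesPoints (hL : L ≠ 0) :
    (characterSubalgebra d L).SeparatesPoints := by
  intro x y hxy
  obtain ⟨i, hi⟩ := Function.ne_iff.1 hxy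
  refine ⟨characterMap (Pi.single i 1),
    ⟨characterMap (Pi.single i 1), Algebra.subset_adjoin ⟨Pi.single i 1, rfl⟩, rfl⟩, ?_⟩
  rw [characterMap_apply, characterMap_apply, character_single, character_single]
  intro h
  exact hi (AddCircle.injective_toCircle hL (Subtype.coe_injective h))

/-- Stone–Weierstrass. Products and conjugates of characters are characters, so their linear span is
already a star subalgebra, and the unit frequencies separate points. -/
lemma span_characterMap_closure_eq_top (hL : 0 < L) :
    (Submodule.span ℂ (range (characterMap (d := d) (L := L)))).topologicalClosure = ⊤ := by
  have : Fact (0 < L) := ⟨hL⟩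
  rw [← characterSubalgebra_coe]
  exact congr_arg (Subalgebra.toSubmodule <| StarSubalgebra.toSubalgebra ·)
    (ContinuousMap.starSubalgebra_topologicalClosure_eq_top_of_separatesPoints _
      (characterSubalgebra_separatesPoints hL.ne'))

end Characters

/-! ### Fourier coefficients of complex-valued functions -/

section Coefficients

variable {d : ℕ} {L : ℝ} [hL : Fact (0 < L)]

instance : IsFiniteMeasure (volume : Measure (Torus d L)) :=
  inferInstanceAs (IsFiniteMeasure (Measure.pi fun _ => volume))

lemma volume_torus : (volume : Measure (Torus d L)) univ = ENNReal.ofReal L ^ d := by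
  rw [volume_pi, Measure.pi_univ]
  simp [AddCircle.measure_univ]

lemma volume_real_torus : (volume : Measure (Torus d L)).real univ = L ^ d := by
  rw [Measure.real, volume_torus, ENNReal.toReal_pow, ENNReal.toReal_ofReal hL.out.le]

lemma side_pow_pos : (0 : ℝ) < L ^ d := pow_pos hL.out d

lemma side_pow_ne_zero : ((L : ℂ) ^ d) ≠ 0 := by
  exact_mod_cast (side_pow_pos (d := d) (L := L)).ne'

lemma integral_character (k : Fin d → ℤ) :
    ∫ x : Torus d L, character k x = if k = 0 then (L : ℂ) ^ d else 0 := by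
  split_ifs with h
  · simp [h, character_zero, volume_real_torus]
  · obtain ⟨i, hi⟩ := Function.ne_iff.mp h
    -- translation by a point at which the character is not `1`
    obtain ⟨y, hy⟩ : ∃ y : Torus d L, character k y ≠ 1 := by
      -- Half a wavelength in direction `i`, where the character equals -1.
      refine ⟨Pi.single i ((L / 2 / k i : ℝ) : AddCircle L), ?_⟩
      unfold character
      rw [Finset.prod_eq_single i]
      · have := fourier_add_half_inv_index (T := L) (n := k i) hi hL.out 0
        rw [zero_add] at this
        rw [Pi.single_eq_same, this]
        simp only [fourier_eval_zero]; norm_num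
      · intro j _ hj
        rw [Pi.single_eq_of_ne hj, fourier_eval_zero]
      · simp
    have h1 : ∫ x : Torus d L, character k (x + y) = ∫ x : Torus d L, character k x :=
      integral_add_right_eq_self _ y
    simp_rw [character_add] at h1
    rw [integral_mul_const] at h1
    have h2 : (∫ x : Torus d L, character k x) * (character k y - 1) = 0 := by
      rw [mul_sub, h1, mul_one, sub_self]
    exact (mul_eq_zero.1 h2).resolve_right (sub_ne_zero.2 hy)

/-- Fourier coefficients of complex-valued functions. -/
def cCoeff (f : Torus d L → ℂ) (k : Fin d → ℤ) : ℂ :=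
  ((L : ℂ) ^ d)⁻¹ * ∫ x, f x * character (-k) x

lemma coeff_eq_cCoeff (f : Torus d L → Vec d) (k : Fin d → ℤ) (i : Fin d) :
    coeff f k i = cCoeff (fun x => ((f x i : ℝ) : ℂ)) k := rfl

lemma cCoeff_congr_ae {f g : Torus d L → ℂ} (h : f =ᵐ[volume] g) (k : Fin d → ℤ) :
    cCoeff f k = cCoeff g k := by
  unfold cCoeff
  congr 1
  exact integral_congr_ae (h.mono fun x hx => by simp only [hx])

lemma integrable_mul_character {f : Torus d L → ℂ} (hf : Integrable f) (k : Fin d → ℤ) :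
    Integrable fun x => f x * character k x :=
  hf.mul_bdd (c := 1) (continuous_character k).aestronglyMeasurable
    (ae_of_all _ fun x => (norm_character k x).le)

lemma integrable_character (k : Fin d → ℤ) : Integrable (character k : Torus d L → ℂ) := by
  simpa using integrable_mul_character (integrable_const (1 : ℂ)) k

lemma integral_mul_conj_character (f : Torus d L → ℂ) (k : Fin d → ℤ) :
    ∫ x, f x * conj (character k x) = (L : ℂ) ^ d * cCoeff f k := by
  simp only [cCoeff, character_freq_neg]
  rw [mul_inv_cancel_left₀ side_pow_ne_zero]

lemma cCoeff_add {f g : Torus d L → ℂ} (hf : Integrable f) (hg : Integrable g) (k : Fin d → ℤ) :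
    cCoeff (fun x => f x + g x) k = cCoeff f k + cCoeff g k := by
  simp only [cCoeff, add_mul]
  rw [integral_add (integrable_mul_character hf _) (integrable_mul_character hg _), mul_add]

lemma cCoeff_sub {f g : Torus d L → ℂ} (hf : Integrable f) (hg : Integrable g) (k : Fin d → ℤ) :
    cCoeff (fun x => f x - g x) k = cCoeff f k - cCoeff g k := by
  simp only [cCoeff, sub_mul]
  rw [integral_sub (integrable_mul_character hf _) (integrable_mul_character hg _), mul_sub]

lemma cCoeff_const_mul (c : ℂ) (f : Torus d L → ℂ) (k : Fin d → ℤ) :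
    cCoeff (fun x => c * f x) k = c * cCoeff f k := by
  simp only [cCoeff, mul_assoc, integral_const_mul]
  ring

lemma cCoeff_sum {ι : Type*} (s : Finset ι) {f : ι → Torus d L → ℂ}
    (hf : ∀ i ∈ s, Integrable (f i)) (k : Fin d → ℤ) :
    cCoeff (fun x => ∑ i ∈ s, f i x) k = ∑ i ∈ s, cCoeff (f i) k := by
  simp only [cCoeff, Finset.sum_mul]
  rw [integral_finsetSum _ fun i hi => integrable_mul_character (hf i hi) _, Finset.mul_sum]

lemma cCoeff_character (k l : Fin d → ℤ) :
    cCoeff (character k : Torus d L → ℂ) l = if k = l then 1 else 0 := by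
  simp only [cCoeff, ← character_freq_add, integral_character, add_neg_eq_zero]
  split_ifs
  · exact inv_mul_cancel₀ side_pow_ne_zero
  · simp

lemma cCoeff_mul_character (f : Torus d L → ℂ) (k l : Fin d → ℤ) :
    cCoeff (fun x => f x * character k x) l = cCoeff f (l - k) := by
  simp only [cCoeff, mul_assoc, ← character_freq_add]
  congr 3
  ext x
  congr 2
  abel

lemma cCoeff_conj (f : Torus d L → ℂ) (k : Fin d → ℤ) :
    cCoeff (fun x => conj (f x)) k = conj (cCoeff f (-k)) := by
  simp only [cCoeff, map_mul, map_inv₀, map_pow, Complex.conj_ofReal, neg_neg]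
  rw [← integral_conj]
  simp only [map_mul, character_freq_neg]

lemma cCoeff_ofReal_neg (f : Torus d L → ℝ) (k : Fin d → ℤ) :
    cCoeff (fun x => (f x : ℂ)) (-k) = conj (cCoeff (fun x => (f x : ℂ)) k) := by
  have := cCoeff_conj (fun x => (f x : ℂ)) (-k)
  simpa using this

lemma cCoeff_translate (f : Torus d L → ℂ) (y : Torus d L) (k : Fin d → ℤ) :
    cCoeff (fun x => f (x + y)) k = character k y * cCoeff f k := by
  unfold cCoeff
  rw [← integral_add_right_eq_self (fun x => f x * character (-k) x) y]
  simp_rw [character_add]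
  have : ∀ x, f (x + y) * character (-k) x
      = character k y * (f (x + y) * (character (-k) x * character (-k) y)) := by
    intro x
    rw [character_freq_neg k y]
    linear_combination (-(f (x + y) * character (-k) x)) * character_mul_conj k y
  simp_rw [this]
  rw [integral_const_mul]
  ring

lemma norm_cCoeff_le (f : Torus d L → ℂ) (k : Fin d → ℤ) :
    ‖cCoeff f k‖ ≤ (L ^ d)⁻¹ * ∫ x, ‖f x‖ := by
  unfold cCoeff
  rw [norm_mul, norm_inv, norm_pow, Complex.norm_real, Real.norm_of_nonneg hL.out.le]
  gcongr
  · exact inv_nonneg.2 side_pow_pos.le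
  · refine (norm_integral_le_integral_norm _).trans_eq ?_
    simp [norm_character]

end Coefficients

/-! ### Parseval and Riesz–Fischer -/

section L2Theory

variable {d : ℕ} {L : ℝ} [hL : Fact (0 < L)]

/-- The normalised character as an element of `L²`. -/
def characterLp (k : Fin d → ℤ) : Lp ℂ 2 (volume : Measure (Torus d L)) :=
  (((L ^ d) ^ (-(1 / 2) : ℝ) : ℝ) : ℂ) • ContinuousMap.toLp (E := ℂ) 2 volume ℂ (characterMap k)

lemma side_rpow_sq : ((L ^ d) ^ (-(1 / 2) : ℝ) : ℝ) * (L ^ d) ^ (-(1 / 2) : ℝ) = (L ^ d)⁻¹ := by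
  rw [← Real.rpow_add side_pow_pos, ← Real.rpow_neg_one]; norm_num

lemma inner_toLp_character (k l : Fin d → ℤ) :
    inner ℂ (ContinuousMap.toLp (E := ℂ) 2 (volume : Measure (Torus d L)) ℂ (characterMap k))
      (ContinuousMap.toLp (E := ℂ) 2 volume ℂ (characterMap l))
      = if k = l then (L : ℂ) ^ d else 0 := by
  rw [ContinuousMap.inner_toLp]
  simp only [characterMap_apply, ← character_freq_neg, ← character_freq_add]
  rw [integral_character]
  congr 1
  simp only [eq_iff_iff]
  constructor
  · intro h; exact (add_neg_eq_zero.1 h).symm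
  · rintro rfl; simp

lemma orthonormal_characterLp : Orthonormal ℂ (characterLp (d := d) (L := L)) := by
  rw [orthonormal_iff_ite]
  intro k l
  simp only [characterLp, inner_smul_left, inner_smul_right, inner_toLp_character]
  split_ifs with h
  · rw [Complex.conj_ofReal, ← mul_assoc, ← Complex.ofReal_mul, side_rpow_sq]
    push_cast
    exact inv_mul_cancel₀ side_pow_ne_zero
  · simp

lemma span_characterLp_closure_eq_top :
    (Submodule.span ℂ (range (characterLp (d := d) (L := L)))).topologicalClosure = ⊤ := by
  have h1 : Submodule.span ℂ (range (characterLp (d := d) (L := L))) =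
      Submodule.span ℂ (range fun k : Fin d → ℤ =>
        ContinuousMap.toLp (E := ℂ) 2 (volume : Measure (Torus d L)) ℂ (characterMap k)) := by
    have hne : (((L ^ d) ^ (-(1 / 2) : ℝ) : ℝ) : ℂ) ≠ 0 := by
      exact_mod_cast (Real.rpow_pos_of_pos side_pow_pos _).ne'
    apply le_antisymm
    · rw [Submodule.span_le]
      rintro _ ⟨k, rfl⟩
      exact Submodule.smul_mem _ _ (Submodule.subset_span ⟨k, rfl⟩)
    · rw [Submodule.span_le]
      rintro _ ⟨k, rfl⟩
      have := Submodule.smul_mem _ ((((L ^ d) ^ (-(1 / 2) : ℝ) : ℝ) : ℂ)⁻¹)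
        (Submodule.subset_span (R := ℂ) (s := range (characterLp (d := d) (L := L))) ⟨k, rfl⟩)
      rwa [characterLp, smul_smul, inv_mul_cancel₀ hne, one_smul] at this
  rw [h1]
  simpa only [Submodule.map_span, ContinuousLinearMap.coe_coe, ← range_comp, Function.comp_def]
    using (ContinuousMap.toLp_denseRange (p := 2) ℂ volume ℂ
      (by simp)).topologicalClosure_map_submodule (span_characterMap_closure_eq_top hL.out)

/-- The Hilbert basis of `L²` given by the normalised characters. -/
def characterBasis : HilbertBasis (Fin d → ℤ) ℂ (Lp ℂ 2 (volume : Measure (Torus d L))) :=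
  HilbertBasis.mk orthonormal_characterLp span_characterLp_closure_eq_top.ge

lemma characterBasis_repr (f : Lp ℂ 2 (volume : Measure (Torus d L))) (k : Fin d → ℤ) :
    characterBasis.repr f k = (((L ^ d) ^ (1 / 2 : ℝ) : ℝ) : ℂ) * cCoeff f k := by
  rw [HilbertBasis.repr_apply_apply, characterBasis, HilbertBasis.coe_mk, characterLp,
    inner_smul_left, Complex.conj_ofReal]
  have h1 : inner ℂ (ContinuousMap.toLp (E := ℂ) 2 (volume : Measure (Torus d L)) ℂ
      (characterMap k)) f = (L : ℂ) ^ d * cCoeff f k := by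
    rw [L2.inner_def, ← integral_mul_conj_character]
    refine integral_congr_ae ?_
    filter_upwards [ContinuousMap.coeFn_toLp (p := 2) (𝕜 := ℂ) (volume : Measure (Torus d L))
      (characterMap k)] with x hx
    rw [hx, RCLike.inner_apply, characterMap_apply]
  rw [h1, ← mul_assoc]
  congr 1
  have : ((L : ℂ) ^ d) = ((L ^ d : ℝ) : ℂ) := by push_cast; rfl
  rw [this, ← Complex.ofReal_mul]
  congr 1
  have h2 := side_pow_pos (d := d) (L := L)
  nth_rewrite 2 [← Real.rpow_one (L ^ d)]
  rw [← Real.rpow_add h2]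
  norm_num

lemma norm_sq_side_rpow_mul (z : ℂ) :
    ‖(((L ^ d) ^ (1 / 2 : ℝ) : ℝ) : ℂ) * z‖ ^ 2 = L ^ d * ‖z‖ ^ 2 := by
  rw [norm_mul, mul_pow, Complex.norm_real,
    Real.norm_of_nonneg (Real.rpow_nonneg side_pow_pos.le _), ← Real.sqrt_eq_rpow,
    Real.sq_sqrt side_pow_pos.le]

/-- **Parseval's identity**. -/
lemma hasSum_norm_sq_cCoeff {f : Torus d L → ℂ} (hf : MemLp f 2) :
    HasSum (fun k => L ^ d * ‖cCoeff f k‖ ^ 2) (∫ x, ‖f x‖ ^ 2) := by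
  have h1 := (characterBasis (d := d) (L := L)).hasSum_inner_mul_inner (hf.toLp f) (hf.toLp f)
  have h2 := RCLike.hasSum_re ℂ h1
  have h3 : RCLike.re (inner ℂ (hf.toLp f) (hf.toLp f)) = ∫ x, ‖f x‖ ^ 2 := by
    rw [L2.inner_def, ← integral_re (L2.integrable_inner _ _)]
    refine integral_congr_ae ?_
    filter_upwards [hf.coeFn_toLp] with x hx
    rw [hx, inner_self_eq_norm_sq]
  rw [h3] at h2
  refine h2.congr_fun fun k => ?_
  rw [← inner_conj_symm, ← HilbertBasis.repr_apply_apply, characterBasis_repr,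
    cCoeff_congr_ae hf.coeFn_toLp, ← norm_sq_side_rpow_mul, ← Complex.normSq_eq_norm_sq, ← Complex.ofReal_re (Complex.normSq _),
    Complex.normSq_eq_conj_mul_self]
  rfl

lemma integral_norm_sq_eq_tsum {f : Torus d L → ℂ} (hf : MemLp f 2) :
    ∫ x, ‖f x‖ ^ 2 = L ^ d * ∑' k, ‖cCoeff f k‖ ^ 2 := by
  rw [← tsum_mul_left, (hasSum_norm_sq_cCoeff hf).tsum_eq]

lemma ae_eq_of_cCoeff_eq {f g : Torus d L → ℂ} (hf : MemLp f 2) (hg : MemLp g 2)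
    (h : ∀ k, cCoeff f k = cCoeff g k) : f =ᵐ[volume] g := by
  rw [← MemLp.toLp_eq_toLp_iff hf hg]
  apply (characterBasis (d := d) (L := L)).repr.injective
  ext k
  rw [characterBasis_repr, characterBasis_repr, cCoeff_congr_ae hf.coeFn_toLp,
    cCoeff_congr_ae hg.coeFn_toLp, h k]

/-- **Riesz–Fischer**: square-summable families are the coefficients of `L²` functions. -/
lemma exists_memLp_cCoeff_eq {c : (Fin d → ℤ) → ℂ} (hc : Summable fun k => ‖c k‖ ^ 2) :
    ∃ f : Torus d L → ℂ, MemLp f 2 ∧ ∀ k, cCoeff f k = c k := by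
  have hmem : Memℓp (fun k => (((L ^ d) ^ (1 / 2 : ℝ) : ℝ) : ℂ) * c k) 2 := by
    refine memℓp_gen ?_
    simp only [ENNReal.toReal_ofNat, Real.rpow_two, norm_sq_side_rpow_mul]
    exact hc.mul_left _
  refine ⟨(characterBasis (d := d) (L := L)).repr.symm ⟨_, hmem⟩, Lp.memLp _, fun k => ?_⟩
  have := characterBasis_repr ((characterBasis (d := d) (L := L)).repr.symm ⟨_, hmem⟩) k
  rw [LinearIsometryEquiv.apply_symm_apply] at this
  have hne : (((L ^ d) ^ (1 / 2 : ℝ) : ℝ) : ℂ) ≠ 0 := by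
    exact_mod_cast (Real.rpow_pos_of_pos side_pow_pos _).ne'
  exact (mul_left_cancel₀ hne this).symm

end L2Theory

end VectorMixing

end

noncomputable section

namespace VectorMixing

open scoped ComplexConjugate

/-! ### The covering of the torus by Euclidean space -/

section Lift

variable {d : ℕ} {L : ℝ}

/-- The covering map `ℝ^d → 𝕋^d`. -/
def toTorus (L : ℝ) (z : Fin d → ℝ) : Torus d L := fun i => (z i : AddCircle L)

/-- The wave vector `2 π k / L` of a frequency. -/
def wave (L : ℝ) (k : Fin d → ℤ) (j : Fin d) : ℝ := 2 * Real.pi / L * k j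

lemma toTorus_add (y z : Fin d → ℝ) : toTorus L (y + z) = toTorus L y + toTorus L z := by
  ext i; simp [toTorus]

lemma toTorus_zero : toTorus L (0 : Fin d → ℝ) = 0 := by
  ext i; simp [toTorus]

@[fun_prop]
lemma continuous_toTorus : Continuous (toTorus L : (Fin d → ℝ) → Torus d L) := by
  refine continuous_pi fun i => ?_
  exact (AddCircle.continuous_mk' L).comp (continuous_apply i)

@[fun_prop]
lemma measurable_toTorus : Measurable (toTorus L : (Fin d → ℝ) → Torus d L) :=
  continuous_toTorus.measurable

lemma character_toTorus (k : Fin d → ℤ) (z : Fin d → ℝ) :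
    character k (toTorus L z) = Complex.exp (Complex.I * ((∑ j, wave L k j * z j : ℝ) : ℂ)) := by
  simp only [character, toTorus, fourier_coe_apply, ← Complex.exp_sum]
  congr 1
  push_cast [wave]
  rw [Finset.mul_sum]
  refine Finset.sum_congr rfl fun j _ => ?_
  ring

lemma wave_zero (j : Fin d) : wave L 0 j = 0 := by simp [wave]

lemma wave_neg (k : Fin d → ℤ) (j : Fin d) : wave L (-k) j = -wave L k j := by simp [wave]

lemma wave_sub (k l : Fin d → ℤ) (j : Fin d) : wave L (k - l) j = wave L k j - wave L l j := by
  simp [wave, mul_sub]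

end Lift

/-! ### Averages of translates and integrals over small cubes -/

section Averages

variable {d : ℕ} {L : ℝ} [hL : Fact (0 < L)]

/-- By translation invariance the integral of |g(x + τ p)| over the torus does not depend on `p`, so
integrability of `g` alone justifies Fubini. -/
lemma integrable_translate_prod {P : Type*} [MeasurableSpace P] {μ : Measure P} [IsFiniteMeasure μ]
    {τ : P → Torus d L} (hτ : Measurable τ) {w : P → ℂ} (hw : Measurable w) {B : ℝ}
    (hB : ∀ᵐ p ∂μ, ‖w p‖ ≤ B) {g : Torus d L → ℂ} (hg : Measurable g) (hgi : Integrable g) :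
    Integrable (fun z : Torus d L × P => w z.2 * g (z.1 + τ z.2)) (volume.prod μ) := by
  have hm : Measurable fun z : Torus d L × P => w z.2 * g (z.1 + τ z.2) := by fun_prop
  rw [integrable_prod_iff' hm.aestronglyMeasurable]
  refine ⟨ae_of_all _ fun p => (hgi.comp_add_right (τ p)).const_mul (w p), ?_⟩
  simp only [norm_mul, integral_const_mul]
  have : ∀ p, ∫ x, ‖g (x + τ p)‖ = ∫ x, ‖g x‖ := fun p =>
    integral_add_right_eq_self (fun x => ‖g x‖) (τ p)
  simp only [this]
  exact (Integrable.of_bound hw.norm.aestronglyMeasurable B (by simpa using hB)).mul_const _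

/-- A weighted average of translates is a convolution, hence a Fourier multiplier. Identities
between averages of a function and of its gradient thus reduce to identities between symbols,
without approximation by smooth functions. -/
lemma cCoeff_integral_translate {P : Type*} [MeasurableSpace P] {μ : Measure P}
    [IsFiniteMeasure μ]
    {τ : P → Torus d L} (hτ : Measurable τ) {w : P → ℂ} (hw : Measurable w) {B : ℝ}
    (hB : ∀ᵐ p ∂μ, ‖w p‖ ≤ B) {g : Torus d L → ℂ} (hg : Measurable g) (hgi : Integrable g)
    (k : Fin d → ℤ) :
    cCoeff (fun x => ∫ p, w p * g (x + τ p) ∂μ) k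
      = cCoeff g k * ∫ p, w p * character k (τ p) ∂μ := by
  have h1 : ∫ x, (∫ p, w p * g (x + τ p) ∂μ) * character (-k) x
      = ∫ p, (∫ x, w p * g (x + τ p) * character (-k) x) ∂μ := by
    simp_rw [← integral_mul_const]
    refine integral_integral_swap ?_
    refine (integrable_translate_prod hτ hw hB hg hgi).mul_bdd (c := 1) ?_ ?_
    · exact ((continuous_character (-k)).measurable.comp measurable_fst).aestronglyMeasurable
    · exact ae_of_all _ fun z => (norm_character _ _).le
  have h2 : ∀ p, ∫ x, w p * g (x + τ p) * character (-k) x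
      = w p * character k (τ p) * ∫ x, g x * character (-k) x := by
    intro p
    have := cCoeff_translate g (τ p) k
    unfold cCoeff at this
    rw [mul_left_comm] at this
    have := mul_left_cancel₀ (inv_ne_zero side_pow_ne_zero) this
    simp_rw [mul_assoc]
    rw [integral_const_mul, this]
  unfold cCoeff
  rw [h1]
  simp_rw [h2]
  rw [integral_mul_const]
  ring

lemma measurable_integral_translate {P : Type*} [MeasurableSpace P] {μ : Measure P}
    [IsFiniteMeasure μ]
    {τ : P → Torus d L} (hτ : Measurable τ) {w : P → ℂ} (hw : Measurable w)
    {g : Torus d L → ℂ} (hg : Measurable g) :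
    Measurable (fun x => ∫ p, w p * g (x + τ p) ∂μ) := by
  have hm : Measurable fun z : Torus d L × P => w z.2 * g (z.1 + τ z.2) := by fun_prop
  exact hm.stronglyMeasurable.integral_prod_right'.measurable

/-- The half-open cube with corner `b` and side `ρ`. -/
def cube (b : Fin d → ℝ) (ρ : ℝ) : Set (Fin d → ℝ) := Set.pi univ fun i => Ioc (b i) (b i + ρ)

lemma measurableSet_cube (b : Fin d → ℝ) (ρ : ℝ) : MeasurableSet (cube b ρ) :=
  MeasurableSet.univ_pi fun _ => measurableSet_Ioc

lemma volume_cube (b : Fin d → ℝ) (ρ : ℝ) : volume (cube b ρ) = ENNReal.ofReal ρ ^ d := by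
  simp [cube, volume_pi_pi]

lemma measurePreserving_toTorus (b : Fin d → ℝ) :
    MeasurePreserving (toTorus L) (volume.restrict (cube b L)) (volume : Measure (Torus d L)) := by
  have := measurePreserving_pi _ _ (fun i => AddCircle.measurePreserving_mk L (b i))
  rw [← Measure.restrict_pi_pi] at this
  exact this

/-- A cube of side at most one period lies in a fundamental domain, so it covers no point of the
torus twice. -/
lemma eLpNorm_cube_le {g : Torus d L → ℂ} (hg : Measurable g) (q : ℝ≥0∞) (x : Torus d L)
    (b : Fin d → ℝ) {ρ : ℝ} (hρ : ρ ≤ L) :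
    eLpNorm (fun y => g (x + toTorus L y)) q (volume.restrict (cube b ρ)) ≤ eLpNorm g q := by
  have hsub : cube b ρ ⊆ cube b L := Set.pi_mono fun i _ =>
    Ioc_subset_Ioc_right (by linarith)
  refine (eLpNorm_mono_measure _ (Measure.restrict_mono hsub le_rfl)).trans ?_
  have h1 := eLpNorm_comp_measurePreserving (p := q) (g := fun y => g (x + y))
    (hg.comp (measurable_const_add x)).aestronglyMeasurable (measurePreserving_toTorus (L := L) b)
  have h2 := eLpNorm_comp_measurePreserving (p := q) (g := g)
    hg.aestronglyMeasurable (measurePreserving_add_left volume x)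
  exact (h1.trans h2).le

/-- Hölder's inequality gives the power ρ^{d - d/q}, which ρ ≤ 1 and d/q ≤ 1 - α turn into
ρ^{d-1+α}. For q = ∞ the quotient `d / q.toReal` is `d / 0 = 0`, which is the right value of d/q. -/
lemma lintegral_cube_le {g : Torus d L → ℂ} (hg : Measurable g) {q : ℝ≥0∞} (hq1 : 1 ≤ q) {α : ℝ}
    (hq : d / q.toReal ≤ 1 - α) (x : Torus d L)
    (b : Fin d → ℝ) {ρ : ℝ} (hρ0 : 0 < ρ) (hρ1 : ρ ≤ 1) (hρ : ρ ≤ L) :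
    ∫⁻ y in cube b ρ, ‖g (x + toTorus L y)‖ₑ
      ≤ eLpNorm g q * ENNReal.ofReal (ρ ^ (d - 1 + α)) := by
  have h1 := eLpNorm_le_eLpNorm_mul_rpow_measure_univ (μ := volume.restrict (cube b ρ)) hq1
    (f := fun y => g (x + toTorus L y))
    (by exact (hg.comp ((measurable_const_add x).comp measurable_toTorus)).aestronglyMeasurable)
  rw [eLpNorm_one_eq_lintegral_enorm] at h1
  refine h1.trans ?_
  refine mul_le_mul' (eLpNorm_cube_le hg q x b hρ) ?_
  rw [Measure.restrict_apply_univ, volume_cube, ← ENNReal.ofReal_pow hρ0.le,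
    ENNReal.ofReal_rpow_of_pos (by positivity), ← Real.rpow_natCast, ← Real.rpow_mul hρ0.le]
  apply ENNReal.ofReal_le_ofReal
  apply Real.rpow_le_rpow_of_exponent_ge hρ0 hρ1
  simp only [ENNReal.toReal_one]
  have : (d : ℝ) * (1 / 1 - 1 / q.toReal) = d - d / q.toReal := by ring
  rw [this]; linarith

lemma lintegral_cube_smul (F : (Fin d → ℝ) → ℝ≥0∞) (hF : Measurable F) (a : Fin d → ℝ) (r : ℝ)
    {t : ℝ} (ht : 0 < t) :
    ∫⁻ z in cube a r, F (t • z)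
      = ENNReal.ofReal (t ^ (-(d : ℝ))) * ∫⁻ y in cube (t • a) (t * r), F y := by
  have h1 : ∀ z, (cube a r).indicator (fun z => F (t • z)) z
      = (cube (t • a) (t * r)).indicator F (t • z) := by
    intro z
    have : z ∈ cube a r ↔ t • z ∈ cube (t • a) (t * r) := by
      simp only [cube, Set.mem_pi, mem_univ, true_imp_iff, mem_Ioc, Pi.smul_apply, smul_eq_mul,
        ← mul_add, mul_lt_mul_iff_right₀ ht, mul_le_mul_iff_right₀ ht]
    by_cases hz : z ∈ cube a r
    · rw [indicator_of_mem hz, indicator_of_mem (this.1 hz)]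
    · rw [indicator_of_notMem hz, indicator_of_notMem (fun h => hz (this.2 h))]
  rw [← lintegral_indicator (measurableSet_cube _ _), ← lintegral_indicator (measurableSet_cube _ _)]
  simp_rw [h1]
  rw [← lintegral_map (f := (cube (t • a) (t * r)).indicator F) (g := fun z => t • z)
    (hF.indicator (measurableSet_cube _ _)) (measurable_const_smul t),
    Measure.map_addHaar_smul volume ht.ne', lintegral_smul_measure]
  simp only [Module.finrank_fintype_fun_eq_card, Fintype.card_fin, smul_eq_mul]
  rw [abs_of_pos (by positivity), Real.rpow_neg ht.le, Real.rpow_natCast]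

end Averages

end VectorMixing

end

noncomputable section

namespace VectorMixing

open scoped ComplexConjugate

/-! ### Morrey's inequality with constants independent of the side length -/

section Morrey

variable {d : ℕ} {L : ℝ} [hL : Fact (0 < L)]

lemma lintegral_Ioc_rpow_sub_one {α : ℝ} (hα : 0 < α) :
    ∫⁻ t in Ioc (0 : ℝ) 1, ENNReal.ofReal (t ^ (α - 1)) = ENNReal.ofReal (1 / α) := by
  have h1 : IntervalIntegrable (fun t : ℝ => t ^ (α - 1)) volume 0 1 :=
    intervalIntegral.intervalIntegrable_rpow' (by linarith)
  rw [← ofReal_integral_eq_lintegral_ofReal]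
  · rw [← intervalIntegral.integral_of_le zero_le_one, integral_rpow (Or.inl (by linarith))]
    congr 1
    simp [Real.zero_rpow hα.ne']
  · exact (intervalIntegrable_iff_integrableOn_Ioc_of_le zero_le_one).1 h1
  · refine (ae_restrict_iff' measurableSet_Ioc).2 (ae_of_all _ fun t ht => ?_)
    exact Real.rpow_nonneg ht.1.le _

/-- Bound on `∫₀¹ ∫_{z ∈ Q} |g (x + t z)|` by the growth of the integrals of `|g|` over cubes. -/
lemma lintegral_ray_cube_le {α : ℝ} (hα : 0 < α) {g : Torus d L → ℂ} (hg : Measurable g)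
    {r A : ℝ} (hr : 0 < r) (hA : 0 ≤ A) (a : Fin d → ℝ) (x : Torus d L)
    (h : ∀ (b : Fin d → ℝ) (ρ : ℝ), 0 < ρ → ρ ≤ r →
      ∫⁻ y in cube b ρ, ‖g (x + toTorus L y)‖ₑ ≤ ENNReal.ofReal (A * ρ ^ (d - 1 + α))) :
    ∫⁻ p, ‖g (x + toTorus L (p.2 • p.1))‖ₑ
        ∂((volume.restrict (cube a r)).prod (volume.restrict (Ioc (0 : ℝ) 1)))
      ≤ ENNReal.ofReal (A * r ^ (d - 1 + α) / α) := by
  have hF : Measurable fun y : Fin d → ℝ => ‖g (x + toTorus L y)‖ₑ := by fun_prop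
  rw [lintegral_prod_symm _ (by fun_prop)]
  calc ∫⁻ t in Ioc (0 : ℝ) 1, ∫⁻ z in cube a r, ‖g (x + toTorus L (t • z))‖ₑ
      ≤ ∫⁻ t in Ioc (0 : ℝ) 1, ENNReal.ofReal (A * r ^ (d - 1 + α)) *
          ENNReal.ofReal (t ^ (α - 1)) := by
        refine setLIntegral_mono' measurableSet_Ioc fun t ht => ?_
        -- The Jacobian t^{-d} and the growth (t r)^{d-1+α} leave t^{α-1}, which is integrable at 0
        -- because α > 0.
        rw [lintegral_cube_smul _ hF a r ht.1]
        refine (mul_le_mul_right (h (t • a) (t * r) (mul_pos ht.1 hr)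
          (mul_le_of_le_one_left hr.le ht.2)) _).trans_eq ?_
        rw [← ENNReal.ofReal_mul (Real.rpow_nonneg ht.1.le _), ← ENNReal.ofReal_mul (by positivity)]
        congr 1
        rw [Real.mul_rpow ht.1.le hr.le]
        have : t ^ (α - 1) = t ^ (-(d : ℝ)) * t ^ (d - 1 + α) := by
          rw [← Real.rpow_add ht.1]; congr 1; ring
        rw [this]; ring
    _ = ENNReal.ofReal (A * r ^ (d - 1 + α) / α) := by
        rw [lintegral_const_mul' _ _ ENNReal.ofReal_ne_top, lintegral_Ioc_rpow_sub_one hα,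
          ← ENNReal.ofReal_mul (by positivity)]
        congr 1
        ring

/-- The condition on the corner `a` says that the closed cube contains the origin, from which the
rays below start. -/
lemma abs_le_of_mem_cube {a z : Fin d → ℝ} {r : ℝ} (ha : ∀ i, a i ∈ Icc (-r) 0)
    (hz : z ∈ cube a r) (i : Fin d) : |z i| ≤ r := by
  have h1 := hz i (mem_univ i)
  have h2 := ha i
  simp only [mem_Ioc, mem_Icc] at h1 h2
  rw [abs_le]; constructor <;> linarith

/-- The ray formula, integrated over a cube, at the level of characters. -/
lemma integral_cube_ray_character (k : Fin d → ℤ) {a : Fin d → ℝ} {r : ℝ}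
    (ha : ∀ i, a i ∈ Icc (-r) 0) :
    ∑ j, Complex.I * wave L k j *
      ∫ p : (Fin d → ℝ) × ℝ, ((p.1 j : ℝ) : ℂ) * character k (toTorus L (p.2 • p.1))
        ∂((volume.restrict (cube a r)).prod (volume.restrict (Ioc (0 : ℝ) 1)))
      = (∫ z in cube a r, character k (toTorus L z)) - (volume.real (cube a r) : ℂ) := by
  have hfin : IsFiniteMeasure (volume.restrict (cube a r)) :=
    ⟨by rw [Measure.restrict_apply_univ, volume_cube]; exact ENNReal.pow_lt_top ENNReal.ofReal_lt_top⟩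
  have hint : ∀ j, Integrable (fun p : (Fin d → ℝ) × ℝ =>
      ((p.1 j : ℝ) : ℂ) * character k (toTorus L (p.2 • p.1)))
      ((volume.restrict (cube a r)).prod (volume.restrict (Ioc (0 : ℝ) 1))) := by
    intro j
    refine Integrable.of_bound (C := r) (Continuous.aestronglyMeasurable (by fun_prop)) ?_
    have : ∀ᵐ p ∂((volume.restrict (cube a r)).prod (volume.restrict (Ioc (0 : ℝ) 1))),
        p.1 ∈ cube a r := by
      rw [Measure.prod_restrict]
      filter_upwards [ae_restrict_mem ((measurableSet_cube a r).prod measurableSet_Ioc)] with p hp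
      exact hp.1
    filter_upwards [this] with p hp
    rw [norm_mul, norm_character, mul_one, Complex.norm_real]
    exact abs_le_of_mem_cube ha hp j
  -- The fundamental theorem of calculus for the character along the segment from `0` to `z`.
  have hray : ∀ z : Fin d → ℝ, ∫ t in Ioc (0 : ℝ) 1, ∑ j, Complex.I * wave L k j *
      (((z j : ℝ) : ℂ) * character k (toTorus L (t • z))) = character k (toTorus L z) - 1 := by
    intro z
    set w : ℂ := Complex.I * ((∑ j, wave L k j * z j : ℝ) : ℂ) with hw
    have hc : ∀ t : ℝ, character k (toTorus L (t • z)) = Complex.exp (t * w) := by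
      intro t
      rw [character_toTorus, hw]
      congr 1
      push_cast
      simp only [Pi.smul_apply, smul_eq_mul]
      rw [mul_left_comm, Finset.mul_sum, Finset.mul_sum, Finset.mul_sum]
      refine Finset.sum_congr rfl fun j _ => ?_
      push_cast; ring
    have hs : ∀ t : ℝ, ∑ j, Complex.I * wave L k j *
        (((z j : ℝ) : ℂ) * character k (toTorus L (t • z))) = w * Complex.exp (t * w) := by
      intro t
      rw [hc, hw]
      push_cast
      rw [Finset.mul_sum, Finset.sum_mul]
      refine Finset.sum_congr rfl fun j _ => ?_
      ring
    simp_rw [hs]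
    rw [← intervalIntegral.integral_of_le zero_le_one]
    have hder : ∀ t ∈ uIcc (0 : ℝ) 1, HasDerivAt (fun t : ℝ => Complex.exp (t * w))
        (w * Complex.exp (t * w)) t := by
      intro t _
      have h1 : HasDerivAt (fun t : ℝ => (t : ℂ) * w) w t := by
        simpa using (Complex.ofRealCLM.hasDerivAt (x := t)).mul_const w
      simpa [mul_comm] using h1.cexp
    rw [intervalIntegral.integral_eq_sub_of_hasDerivAt hder
      (Continuous.intervalIntegrable (by fun_prop) _ _)]
    have h1 := hc 1
    rw [one_smul] at h1
    rw [h1]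
    simp
  simp_rw [← integral_const_mul]
  rw [← integral_finsetSum _ fun j _ => (hint j).const_mul _,
    integral_prod _ (integrable_finsetSum _ fun j _ => (hint j).const_mul _)]
  simp_rw [hray]
  rw [integral_sub]
  · simp
  · exact Integrable.of_bound (C := 1) (Continuous.aestronglyMeasurable (by fun_prop))
      (ae_of_all _ fun z => (norm_character _ _).le)
  · exact integrable_const _

/-- Deviation of a function from its average over a cube, in terms of the growth of the integrals
of its gradient over small cubes. -/
lemma ae_norm_sub_average_le {α : ℝ} (hα : 0 < α) {f : Torus d L → ℂ} {g : Fin d → Torus d L → ℂ}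
    (hf : Measurable f) (hf2 : MemLp f 2) (hg : ∀ j, Measurable (g j))
    (hgi : ∀ j, Integrable (g j))
    (hfg : ∀ j k, cCoeff (g j) k = Complex.I * wave L k j * cCoeff f k)
    {r : ℝ} (hr : 0 < r) (hrL : r ≤ L) {A : Fin d → ℝ} (hA : ∀ j, 0 ≤ A j)
    (h : ∀ (j : Fin d) (x : Torus d L) (b : Fin d → ℝ) (ρ : ℝ), 0 < ρ → ρ ≤ r →
      ∫⁻ y in cube b ρ, ‖g j (x + toTorus L y)‖ₑ ≤ ENNReal.ofReal (A j * ρ ^ (d - 1 + α)))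
    {a : Fin d → ℝ} (ha : ∀ i, a i ∈ Icc (-r) 0) :
    ∀ᵐ x, ‖(r : ℂ) ^ d * f x - ∫ z in cube a r, f (x + toTorus L z)‖
      ≤ r ^ d * (r ^ α / α * ∑ j, A j) := by
  have hfin : IsFiniteMeasure (volume.restrict (cube a r)) :=
    ⟨by rw [Measure.restrict_apply_univ, volume_cube]; exact ENNReal.pow_lt_top ENNReal.ofReal_lt_top⟩
  set μ := (volume.restrict (cube a r)).prod (volume.restrict (Ioc (0 : ℝ) 1)) with hμ
  have hmem : ∀ᵐ p ∂μ, p.1 ∈ cube a r := by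
    rw [hμ, Measure.prod_restrict]
    filter_upwards [ae_restrict_mem ((measurableSet_cube a r).prod measurableSet_Ioc)] with p hp
    exact hp.1
  have hw : ∀ j, ∀ᵐ p ∂μ, ‖((p.1 j : ℝ) : ℂ)‖ ≤ r := by
    intro j
    filter_upwards [hmem] with p hp
    rw [Complex.norm_real]
    exact abs_le_of_mem_cube ha hp j
  -- `H j` averages the j-th derivative along rays from `x` into the cube, and `F` integrates `f`
  -- over the cube attached to `x`. The ray formula predicts r^d f = F - ∑ H j. Both sides are `L²`
  -- functions, so it is enough to compare their Fourier coefficients, where it becomes the identity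
  -- for characters.
  let H : Fin d → Torus d L → ℂ := fun j x =>
    ∫ p, ((p.1 j : ℝ) : ℂ) * g j (x + toTorus L (p.2 • p.1)) ∂μ
  let F : Torus d L → ℂ := fun x => ∫ z in cube a r, 1 * f (x + toTorus L z)
  have hτ : Measurable fun p : (Fin d → ℝ) × ℝ => toTorus L (p.2 • p.1) := by fun_prop
  have hw' : ∀ j, Measurable fun p : (Fin d → ℝ) × ℝ => ((p.1 j : ℝ) : ℂ) := by
    intro j; fun_prop
  have hHb : ∀ j x, ‖H j x‖ ≤ r * (A j * r ^ (d - 1 + α) / α) := by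
    intro j x
    have h1 : ‖H j x‖ₑ ≤ ENNReal.ofReal (r * (A j * r ^ (d - 1 + α) / α)) := by
      refine (enorm_integral_le_lintegral_enorm _).trans ?_
      calc ∫⁻ p, ‖((p.1 j : ℝ) : ℂ) * g j (x + toTorus L (p.2 • p.1))‖ₑ ∂μ
          ≤ ∫⁻ p, ENNReal.ofReal r * ‖g j (x + toTorus L (p.2 • p.1))‖ₑ ∂μ := by
            refine lintegral_mono_ae ?_
            filter_upwards [hw j] with p hp
            rw [enorm_mul]
            gcongr
            rw [← ofReal_norm]
            exact ENNReal.ofReal_le_ofReal hp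
        _ ≤ _ := by
            rw [lintegral_const_mul' _ _ ENNReal.ofReal_ne_top, ENNReal.ofReal_mul hr.le]
            exact mul_le_mul_right (lintegral_ray_cube_le hα (hg j) hr (hA j) a x (h j x)) _
    have hnn : 0 ≤ r * (A j * r ^ (d - 1 + α) / α) := by
      have := hA j; positivity
    rw [← ofReal_norm] at h1
    exact (ENNReal.ofReal_le_ofReal_iff hnn).1 h1
  have hHm : ∀ j, Measurable (H j) := fun j => measurable_integral_translate hτ (hw' j) (hg j)
  have hH2 : ∀ j, MemLp (H j) 2 := fun j =>
    MemLp.of_bound (hHm j).aestronglyMeasurable _ (ae_of_all _ (hHb j))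
  have hfi : Integrable f := hf2.integrable (by norm_num)
  have hFm : Measurable F := measurable_integral_translate measurable_toTorus measurable_const hf
  have hF2 : MemLp F 2 := by
    refine MemLp.of_bound hFm.aestronglyMeasurable (∫ x, ‖f x‖) (ae_of_all _ fun x => ?_)
    have h1 : ‖F x‖ₑ ≤ ∫⁻ x, ‖f x‖ₑ := by
      refine (enorm_integral_le_lintegral_enorm _).trans ?_
      simp only [one_mul]
      have := eLpNorm_cube_le hf 1 x a hrL
      simpa only [eLpNorm_one_eq_lintegral_enorm] using this
    have h2 := ENNReal.toReal_mono hfi.2.ne h1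
    rwa [← integral_norm_eq_lintegral_enorm hf.aestronglyMeasurable, toReal_enorm] at h2
  have hcoef : ∀ k, cCoeff (fun x => (r : ℂ) ^ d * f x) k
      = cCoeff (fun x => F x - ∑ j, H j x) k := by
    intro k
    have hHi : ∀ j, Integrable (H j) := fun j => (hH2 j).integrable (by norm_num)
    rw [cCoeff_const_mul, cCoeff_sub (hF2.integrable (by norm_num))
      (integrable_finsetSum _ fun j _ => hHi j), cCoeff_sum _ fun j _ => hHi j]
    have e1 : cCoeff F k = cCoeff f k * ∫ z in cube a r, character k (toTorus L z) := by
      have := cCoeff_integral_translate (μ := volume.restrict (cube a r)) (measurable_toTorus (L := L))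
        (w := fun _ => 1) measurable_const (B := 1) (ae_of_all _ fun _ => by simp) hf hfi k
      simp only [one_mul] at this
      simpa only [F, one_mul] using this
    have e2 : ∀ j, cCoeff (H j) k = cCoeff f k * (Complex.I * wave L k j *
        ∫ p, ((p.1 j : ℝ) : ℂ) * character k (toTorus L (p.2 • p.1)) ∂μ) := by
      intro j
      rw [cCoeff_integral_translate hτ (hw' j) (hw j) (hg j) (hgi j) k, hfg]
      ring
    simp_rw [e2]
    rw [← Finset.mul_sum, integral_cube_ray_character k ha, e1]
    have : (volume.real (cube a r) : ℂ) = (r : ℂ) ^ d := by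
      rw [Measure.real, volume_cube, ENNReal.toReal_pow, ENNReal.toReal_ofReal hr.le]
      push_cast; rfl
    rw [this]; ring
  have hae := ae_eq_of_cCoeff_eq (hf2.const_mul ((r : ℂ) ^ d))
    (hF2.sub (memLp_finsetSum _ fun j _ => hH2 j)) hcoef
  filter_upwards [hae] with x hx
  have hx' : (r : ℂ) ^ d * f x = F x - ∑ j, H j x := by simpa using hx
  rw [hx']
  have : (∫ z in cube a r, f (x + toTorus L z)) = F x := by simp [F]
  rw [this]
  rw [sub_sub_cancel_left, norm_neg]
  refine (norm_sum_le _ _).trans ?_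
  refine (Finset.sum_le_sum fun j _ => hHb j x).trans_eq ?_
  rw [Finset.mul_sum, Finset.mul_sum]
  refine Finset.sum_congr rfl fun j _ => ?_
  have e : r * r ^ (d - 1 + α) = r ^ d * r ^ α := by
    rw [← Real.rpow_natCast, ← Real.rpow_add hr, ← Real.rpow_one_add' hr.le]
    · congr 1; ring
    · have : 0 < (d : ℝ) + α := by positivity
      linarith
  calc r * (A j * r ^ (d - 1 + α) / α) = (r * r ^ (d - 1 + α)) * A j / α := by ring
    _ = _ := by rw [e]; ring

lemma ae_translate {P : Torus d L → Prop} (h : ∀ᵐ x, P x) (y : Torus d L) : ∀ᵐ x, P (x + y) :=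
  (measurePreserving_add_right volume y).quasiMeasurePreserving.ae h

/-- Allows `x` and `x + h` to be compared with the average over one and the same cube. -/
lemma setIntegral_cube_translate (f : Torus d L → ℂ) (x : Torus d L) (a h : Fin d → ℝ) (r : ℝ) :
    ∫ z in cube (a - h) r, f (x + toTorus L h + toTorus L z)
      = ∫ z in cube a r, f (x + toTorus L z) := by
  have hpre : cube (a - h) r = (fun z => z + h) ⁻¹' cube a r := by
    ext z
    simp only [cube, Set.mem_pi, mem_univ, true_imp_iff, mem_Ioc, mem_preimage, Pi.add_apply,
      Pi.sub_apply]
    refine forall_congr' fun i => ?_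
    constructor <;> rintro ⟨h1, h2⟩ <;> constructor <;> linarith
  rw [hpre, ← (measurePreserving_add_right volume h).setIntegral_preimage_emb
    (measurableEmbedding_addRight h) (fun z => f (x + toTorus L z)) (cube a r)]
  refine integral_congr_ae (ae_of_all _ fun z => ?_)
  simp only [toTorus_add]
  congr 1
  abel

/-- Data for the Morrey estimates: the `g j` are the partial derivatives of `f` in the sense of
Fourier coefficients, and the `W^{1,q}` norm of `f` is at most `A`. -/
structure HasSobolevBound (q : ℝ≥0∞) (A : ℝ) (f : Torus d L → ℂ) (g : Fin d → Torus d L → ℂ) :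
    Prop where
  measurable : Measurable f
  measurable_grad : ∀ j, Measurable (g j)
  cCoeff_grad : ∀ j k, cCoeff (g j) k = Complex.I * wave L k j * cCoeff f k
  nonneg : 0 ≤ A
  norm_le : eLpNorm f q + ∑ j, eLpNorm (g j) q ≤ ENNReal.ofReal A

namespace HasSobolevBound

variable {q : ℝ≥0∞} {A : ℝ} {f : Torus d L → ℂ} {g : Fin d → Torus d L → ℂ}

lemma eLpNorm_le (H : HasSobolevBound q A f g) : eLpNorm f q ≤ ENNReal.ofReal A :=
  le_self_add.trans H.norm_le

lemma eLpNorm_grad_ne_top (H : HasSobolevBound q A f g) (j : Fin d) : eLpNorm (g j) q ≠ ⊤ := by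
  have h1 := ne_top_of_le_ne_top ENNReal.ofReal_ne_top H.norm_le
  exact ENNReal.sum_ne_top.1 (ENNReal.add_ne_top.1 h1).2 j (Finset.mem_univ j)

lemma sum_toReal_le (H : HasSobolevBound q A f g) : ∑ j, (eLpNorm (g j) q).toReal ≤ A := by
  rw [← ENNReal.toReal_sum fun j _ => H.eLpNorm_grad_ne_top j]
  exact ENNReal.toReal_le_of_le_ofReal H.nonneg (le_add_self.trans H.norm_le)

lemma memLp (H : HasSobolevBound q A f g) (hq2 : 2 ≤ q) : MemLp f 2 :=
  MemLp.mono_exponent ⟨H.measurable.aestronglyMeasurable, H.eLpNorm_le.trans_lt ENNReal.ofReal_lt_top⟩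
    hq2

lemma ae_norm_sub_average_le (H : HasSobolevBound q A f g) (hq2 : 2 ≤ q) {α : ℝ} (hα : 0 < α)
    (hq : d / q.toReal ≤ 1 - α) {r : ℝ} (hr : 0 < r) (hr1 : r ≤ 1) (hrL : r ≤ L)
    {a : Fin d → ℝ} (ha : ∀ i, a i ∈ Icc (-r) 0) :
    ∀ᵐ x, ‖(r : ℂ) ^ d * f x - ∫ z in cube a r, f (x + toTorus L z)‖
      ≤ r ^ d * (r ^ α / α * A) := by
  have hq1 : 1 ≤ q := le_trans (by norm_num) hq2
  have key := VectorMixing.ae_norm_sub_average_le hα H.measurable (H.memLp hq2) H.measurable_grad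
    (fun j => MemLp.integrable hq1 ⟨(H.measurable_grad j).aestronglyMeasurable,
      (H.eLpNorm_grad_ne_top j).lt_top⟩) H.cCoeff_grad hr hrL
    (A := fun j => (eLpNorm (g j) q).toReal) (fun j => ENNReal.toReal_nonneg) (by
      intro j x b ρ h0 h1
      refine (lintegral_cube_le (H.measurable_grad j) hq1 hq x b h0 (h1.trans hr1)
        (h1.trans hrL)).trans_eq ?_
      rw [ENNReal.ofReal_mul ENNReal.toReal_nonneg, ENNReal.ofReal_toReal (H.eLpNorm_grad_ne_top j)])
    ha
  filter_upwards [key] with x hx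
  refine hx.trans ?_
  gcongr
  exact H.sum_toReal_le

/-- `f` is its average over a cube of side `r` plus a deviation. The average is bounded by Hölder's
inequality for `f` itself, the deviation by the ray formula. The bound depends on `L` only through
the constraint r ≤ L. -/
lemma ae_norm_le (H : HasSobolevBound q A f g) (hq2 : 2 ≤ q) {α : ℝ} (hα : 0 < α)
    (hq : d / q.toReal ≤ 1 - α) {r : ℝ} (hr : 0 < r) (hr1 : r ≤ 1) (hrL : r ≤ L) :
    ∀ᵐ x, ‖f x‖ ≤ (r ^ α / α + r ^ (α - 1)) * A := by
  have hq1 : 1 ≤ q := le_trans (by norm_num) hq2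
  filter_upwards [H.ae_norm_sub_average_le hq2 hα hq hr hr1 hrL (a := 0)
    (by intro i; simp [hr.le])] with x hx
  have h1 : ‖∫ z in cube 0 r, f (x + toTorus L z)‖ ≤ A * r ^ (d - 1 + α) := by
    have hb : ‖∫ z in cube 0 r, f (x + toTorus L z)‖ₑ ≤ ENNReal.ofReal (A * r ^ (d - 1 + α)) := by
      refine (enorm_integral_le_lintegral_enorm _).trans ?_
      refine (lintegral_cube_le H.measurable hq1 hq x 0 hr hr1 hrL).trans ?_
      rw [ENNReal.ofReal_mul H.nonneg]
      gcongr
      exact H.eLpNorm_le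
    rw [← ofReal_norm] at hb
    exact (ENNReal.ofReal_le_ofReal_iff (mul_nonneg H.nonneg (Real.rpow_nonneg hr.le _))).1 hb
  have h2 : ‖(r : ℂ) ^ d * f x‖ ≤ r ^ d * (r ^ α / α * A) + A * r ^ (d - 1 + α) := by
    have := norm_add_le ((r : ℂ) ^ d * f x - ∫ z in cube 0 r, f (x + toTorus L z))
      (∫ z in cube 0 r, f (x + toTorus L z))
    rw [sub_add_cancel] at this
    linarith
  rw [norm_mul, norm_pow, Complex.norm_real, Real.norm_of_nonneg hr.le] at h2
  have h3 : r ^ (d - 1 + α) = r ^ d * r ^ (α - 1) := by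
    rw [← Real.rpow_natCast, ← Real.rpow_add hr]; congr 1; ring
  rw [h3] at h2
  have h4 : r ^ d * ‖f x‖ ≤ r ^ d * ((r ^ α / α + r ^ (α - 1)) * A) := by linarith
  exact le_of_mul_le_mul_left h4 (pow_pos hr d)

lemma ae_norm_translate_sub_le_of_small (H : HasSobolevBound q A f g) (hq2 : 2 ≤ q) {α : ℝ}
    (hα : 0 < α) (hq : d / q.toReal ≤ 1 - α) {h : Fin d → ℝ} (h1 : ‖h‖ ≤ 1) (hL : ‖h‖ ≤ L) :
    ∀ᵐ x, ‖f (x + toTorus L h) - f x‖ ≤ 2 / α * A * ‖h‖ ^ α := by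
  rcases eq_or_ne h 0 with rfl | h0
  · simp [toTorus_zero, Real.zero_rpow hα.ne']
  have hr : 0 < ‖h‖ := norm_pos_iff.2 h0
  set r := ‖h‖ with hrdef
  have hi : ∀ i, |h i| ≤ r := fun i => norm_le_pi_norm h i
  -- With this corner the closed cube of side |h|_∞ attached to `x` contains both `x` and `x + h`,
  -- so each value differs from the common average by at most r^α / α · A.
  let a : Fin d → ℝ := fun i => min 0 (h i)
  have ha : ∀ i, a i ∈ Icc (-r) 0 := fun i =>
    ⟨le_min (by linarith) (abs_le.1 (hi i)).1, min_le_left _ _⟩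
  have ha' : ∀ i, (a - h) i ∈ Icc (-r) 0 := fun i => by
    have := abs_le.1 (hi i)
    simp only [a, Pi.sub_apply, mem_Icc]
    constructor
    · rcases min_cases 0 (h i) with h | h <;> linarith
    · linarith [min_le_right 0 (h i)]
  filter_upwards [H.ae_norm_sub_average_le hq2 hα hq hr h1 hL ha,
    ae_translate (H.ae_norm_sub_average_le hq2 hα hq hr h1 hL ha') (toTorus L h)] with x hx hx'
  rw [setIntegral_cube_translate] at hx'
  have h2 := norm_sub_le ((r : ℂ) ^ d * f (x + toTorus L h) - ∫ z in cube a r, f (x + toTorus L z))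
    ((r : ℂ) ^ d * f x - ∫ z in cube a r, f (x + toTorus L z))
  rw [sub_sub_sub_cancel_right, ← mul_sub, norm_mul, norm_pow, Complex.norm_real,
    Real.norm_of_nonneg hr.le] at h2
  have h4 : r ^ d * ‖f (x + toTorus L h) - f x‖ ≤ r ^ d * (2 / α * A * r ^ α) := by
    refine h2.trans ((add_le_add hx' hx).trans_eq ?_)
    ring
  exact le_of_mul_le_mul_left h4 (pow_pos hr d)

/-- Each coordinate is reduced modulo `L` by subtracting the nearest multiple. The result is at most
L/2 in absolute value, and no coordinate grows because 0 is also a multiple of `L`. -/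
lemma exists_small_representative (h : Fin d → ℝ) :
    ∃ h' : Fin d → ℝ, toTorus L h' = toTorus L h ∧ ‖h'‖ ≤ ‖h‖ ∧ ‖h'‖ ≤ L := by
  have key : ∀ i, |h i - L * round (h i / L)| = L * |h i / L - round (h i / L)| := by
    intro i
    rw [← abs_of_pos hL.out, ← abs_mul, mul_sub, abs_of_pos hL.out, mul_div_cancel₀ _ hL.out.ne']
  refine ⟨fun i => h i - L * round (h i / L), ?_, ?_, ?_⟩
  · ext i
    simp only [toTorus]
    rw [QuotientAddGroup.eq]
    refine ⟨round (h i / L), ?_⟩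
    simp only [zsmul_eq_mul]
    ring
  · rw [pi_norm_le_iff_of_nonneg (norm_nonneg _)]
    intro i
    refine le_trans ?_ (norm_le_pi_norm h i)
    rw [Real.norm_eq_abs, Real.norm_eq_abs, key]
    have := round_le (h i / L) 0
    calc L * |h i / L - round (h i / L)| ≤ L * |h i / L| := by
          refine mul_le_mul_of_nonneg_left ?_ hL.out.le
          simpa using this
      _ = |h i| := by rw [abs_div, abs_of_pos hL.out, mul_div_cancel₀ _ hL.out.ne']
  · rw [pi_norm_le_iff_of_nonneg hL.out.le]
    intro i
    rw [Real.norm_eq_abs, key]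
    have := abs_sub_round (h i / L)
    nlinarith [hL.out]

/-- **Morrey's inequality** on the torus, with a constant independent of the side length. -/
theorem ae_norm_translate_sub_le (H : HasSobolevBound q A f g) (hq2 : 2 ≤ q) {α : ℝ}
    (hα : 0 < α) (hq : d / q.toReal ≤ 1 - α) (h : Fin d → ℝ) :
    ∀ᵐ x, ‖f (x + toTorus L h) - f x‖ ≤ (2 / α + 2) * A * ‖h‖ ^ α := by
  obtain ⟨h', e, hh, hhL⟩ := exists_small_representative (L := L) h
  have hA := H.nonneg
  rw [← e]
  have hmono : ‖h'‖ ^ α ≤ ‖h‖ ^ α := Real.rpow_le_rpow (norm_nonneg _) hh hα.le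
  -- A representative longer than 1 exists only if L > 1. Then the sup bound on unit cubes suffices,
  -- as ‖h‖^α ≥ 1. This is how the constant stays free of `L`.
  rcases le_or_gt ‖h'‖ 1 with h1 | h1
  · filter_upwards [H.ae_norm_translate_sub_le_of_small hq2 hα hq h1 hhL] with x hx
    refine hx.trans ?_
    gcongr
    linarith
  · have hb := H.ae_norm_le hq2 hα hq one_pos le_rfl (h1.le.trans hhL)
    filter_upwards [hb, ae_translate hb (toTorus L h')] with x hx hx'
    simp only [Real.one_rpow] at hx hx'
    have h2 : 1 ≤ ‖h‖ ^ α := Real.one_le_rpow (h1.le.trans hh) hα.le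
    calc ‖f (x + toTorus L h') - f x‖ ≤ ‖f (x + toTorus L h')‖ + ‖f x‖ := norm_sub_le _ _
      _ ≤ (2 / α + 2) * A * 1 := by
          refine (add_le_add hx' hx).trans_eq ?_
          ring
      _ ≤ _ := by gcongr

end HasSobolevBound

end Morrey

end VectorMixing

end

noncomputable section

namespace VectorMixing

open scoped ComplexConjugate

/-! ### Singular radial kernels and the symbol of the fractional Laplacian -/

section Kernel

variable {d : ℕ}

/-- In polar coordinates the integrand behaves like y^{-1-β+n} near 0 and like y^{-1-β} at infinity.
The case n = 2 serves the symbol of Λ^{2α}, the case n = 1 the commutator. -/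
lemma integrable_radial_kernel (hd : 1 ≤ d) {β : ℝ} (hβ : 0 < β) {n : ℕ} (hn : β < n) {lam : ℝ}
    (hlam : 0 < lam) :
    Integrable fun h : Vec d => ‖h‖ ^ (-(d : ℝ) - β) * min (lam * ‖h‖) 1 ^ n := by
  have : Nontrivial (Vec d) := by
    have : Nonempty (Fin d) := ⟨⟨0, hd⟩⟩
    infer_instance
  rw [integrable_fun_norm_addHaar volume
    (f := fun y : ℝ => y ^ (-(d : ℝ) - β) * min (lam * y) 1 ^ n)]
  have hdim : Module.finrank ℝ (Vec d) = d := by simp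
  rw [hdim]
  have hform : ∀ y ∈ Ioi (0 : ℝ), y ^ (d - 1) • (y ^ (-(d : ℝ) - β) * min (lam * y) 1 ^ n)
      = y ^ (-1 - β) * min (lam * y) 1 ^ n := by
    intro y hy
    rw [smul_eq_mul, ← mul_assoc, ← Real.rpow_natCast, ← Real.rpow_add hy, Nat.cast_sub hd]
    congr 2
    push_cast; ring
  rw [integrableOn_congr_fun hform measurableSet_Ioi, ← Ioc_union_Ioi_eq_Ioi zero_le_one]
  have hmeas : Measurable fun y : ℝ => y ^ (-1 - β) * min (lam * y) 1 ^ n := by fun_prop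
  refine IntegrableOn.union ?_ ?_
  · have h1 : IntegrableOn (fun y : ℝ => lam ^ n * y ^ (-1 - β + n)) (Ioc 0 1) := by
      refine Integrable.const_mul ?_ _
      exact (intervalIntegrable_iff_integrableOn_Ioc_of_le zero_le_one).1
        (intervalIntegral.intervalIntegrable_rpow' (by linarith))
    refine Integrable.mono' h1 hmeas.aestronglyMeasurable ?_
    refine (ae_restrict_iff' measurableSet_Ioc).2 (ae_of_all _ fun y hy => ?_)
    have hm : 0 ≤ min (lam * y) 1 := le_min (mul_nonneg hlam.le hy.1.le) zero_le_one
    rw [Real.norm_of_nonneg (mul_nonneg (Real.rpow_nonneg hy.1.le _) (pow_nonneg hm _)),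
      Real.rpow_add_natCast hy.1.ne', mul_left_comm, ← mul_pow]
    refine mul_le_mul_of_nonneg_left ?_ (Real.rpow_nonneg hy.1.le _)
    exact pow_le_pow_left₀ hm (min_le_left _ _) n
  · have h1 : IntegrableOn (fun y : ℝ => y ^ (-1 - β)) (Ioi 1) :=
      integrableOn_Ioi_rpow_of_lt (by linarith) one_pos
    refine Integrable.mono' h1 hmeas.aestronglyMeasurable ?_
    refine (ae_restrict_iff' measurableSet_Ioi).2 (ae_of_all _ fun y hy => ?_)
    have hy0 : 0 < y := one_pos.trans hy
    have hm : 0 ≤ min (lam * y) 1 := le_min (mul_nonneg hlam.le hy0.le) zero_le_one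
    rw [Real.norm_of_nonneg (mul_nonneg (Real.rpow_nonneg hy0.le _) (pow_nonneg hm _))]
    exact mul_le_of_le_one_right (Real.rpow_nonneg hy0.le _) (pow_le_one₀ hm (min_le_right _ _))

/-- The constant in `integral_radial_kernel`. -/
def radialConst (d : ℕ) (α : ℝ) : ℝ :=
  ∫ h : Vec d, ‖h‖ ^ (-(d : ℝ) - α) * min ‖h‖ 1

/-- Scaling `h` by `lam`. -/
lemma integral_radial_kernel (α : ℝ) {lam : ℝ} (hlam : 0 < lam) :
    ∫ h : Vec d, ‖h‖ ^ (-(d : ℝ) - α) * min (lam * ‖h‖) 1 = lam ^ α * radialConst d α := by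
  have h1 := Measure.integral_comp_smul (volume : Measure (Vec d))
    (fun h : Vec d => ‖h‖ ^ (-(d : ℝ) - α) * min ‖h‖ 1) lam
  simp only [norm_smul, Real.norm_of_nonneg hlam.le, finrank_euclideanSpace_fin,
    Real.mul_rpow hlam.le (norm_nonneg _), smul_eq_mul, mul_assoc, integral_const_mul] at h1
  rw [abs_of_pos (by positivity)] at h1
  have h2 : lam ^ (-(d : ℝ) - α) ≠ 0 := (Real.rpow_pos_of_pos hlam _).ne'
  apply mul_left_cancel₀ h2
  rw [h1, radialConst, ← mul_assoc, ← Real.rpow_add hlam]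
  congr 1
  rw [← Real.rpow_natCast, ← Real.rpow_neg hlam.le]
  congr 1; ring

lemma radialConst_nonneg (d : ℕ) (α : ℝ) : 0 ≤ radialConst d α := by
  refine integral_nonneg fun h => ?_
  positivity

lemma norm_exp_sub_one_le (θ : ℝ) : ‖Complex.exp (Complex.I * θ) - 1‖ ≤ 2 * min |θ| 1 := by
  have h1 : ‖Complex.exp (Complex.I * θ) - 1‖ ≤ |θ| := Real.norm_exp_I_mul_ofReal_sub_one_le
  have h2 : ‖Complex.exp (Complex.I * θ) - 1‖ ≤ 2 := by
    refine (norm_sub_le _ _).trans ?_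
    rw [mul_comm, Complex.norm_exp_ofReal_mul_I]; norm_num
  rw [mul_min_of_nonneg _ _ zero_le_two]
  refine le_min ?_ (by linarith)
  linarith [abs_nonneg θ]

/-- The symbol of the fractional Laplacian, before normalisation. -/
def symbolIntegrand (α : ℝ) (ξ h : Vec d) : ℝ :=
  ‖h‖ ^ (-(d : ℝ) - 2 * α) * ‖Complex.exp (Complex.I * (inner ℝ ξ h : ℝ)) - 1‖ ^ 2

lemma symbolIntegrand_nonneg (α : ℝ) (ξ h : Vec d) : 0 ≤ symbolIntegrand α ξ h := by
  unfold symbolIntegrand; positivity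

lemma integrable_symbolIntegrand (hd : 1 ≤ d) {α : ℝ} (hα : 0 < α) (hα1 : α < 1) (ξ : Vec d) :
    Integrable (symbolIntegrand α ξ) := by
  have h1 := (integrable_radial_kernel hd (β := 2 * α) (n := 2) (by linarith)
    (by push_cast; linarith) (lam := ‖ξ‖ + 1) (by positivity)).const_mul 4
  refine h1.mono' ?_ (ae_of_all _ fun h => ?_)
  · exact Measurable.aestronglyMeasurable (by unfold symbolIntegrand; fun_prop)
  · rw [Real.norm_of_nonneg (symbolIntegrand_nonneg _ _ _), symbolIntegrand, mul_left_comm]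
    refine mul_le_mul_of_nonneg_left ?_ (Real.rpow_nonneg (norm_nonneg _) _)
    have h2 : |inner ℝ ξ h| ≤ (‖ξ‖ + 1) * ‖h‖ :=
      (abs_real_inner_le_norm ξ h).trans (by gcongr; linarith)
    calc ‖Complex.exp (Complex.I * (inner ℝ ξ h : ℝ)) - 1‖ ^ 2
        ≤ (2 * min |inner ℝ ξ h| 1) ^ 2 := by gcongr; exact norm_exp_sub_one_le _
      _ ≤ (2 * min ((‖ξ‖ + 1) * ‖h‖) 1) ^ 2 := by gcongr
      _ = _ := by ring

/-- The first unit vector, for `1 ≤ d`. -/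
def firstVec (hd : 1 ≤ d) : Vec d := EuclideanSpace.single ⟨0, hd⟩ 1

/-- The constant in `integral_symbol`. -/
def symbolConst (hd : 1 ≤ d) (α : ℝ) : ℝ := ∫ h : Vec d, symbolIntegrand α (firstVec hd) h

lemma norm_firstVec (hd : 1 ≤ d) : ‖firstVec hd‖ = 1 := by simp [firstVec]

/-- As a function of ξ the integral is invariant under rotations and homogeneous of degree 2α. This
represents Λ^{2α} by squared differences. -/
lemma integral_symbol (hd : 1 ≤ d) {α : ℝ} (hα : 0 < α) (ξ : Vec d) :
    ∫ h, symbolIntegrand α ξ h = ‖ξ‖ ^ (2 * α) * symbolConst hd α := by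
  rcases eq_or_ne ξ 0 with rfl | hξ
  · have : (2 * α) ≠ 0 := by positivity
    simp [symbolIntegrand, Real.zero_rpow this]
  have hpos : 0 < ‖ξ‖ := norm_pos_iff.2 hξ
  -- rotation to a multiple of the first vector
  have hrot : ∫ h, symbolIntegrand α ξ h = ∫ h, symbolIntegrand α (‖ξ‖ • firstVec hd) h := by
    have hn : ‖ξ‖ = ‖‖ξ‖ • firstVec hd‖ := by simp [norm_smul, norm_firstVec]
    set R := Submodule.reflection (Submodule.span ℝ {ξ - ‖ξ‖ • firstVec hd})ᗮ with hR
    have hRξ : R ξ = ‖ξ‖ • firstVec hd := Submodule.reflection_sub hn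
    rw [← hRξ, ← R.measurePreserving.integral_comp R.toHomeomorph.measurableEmbedding
      (symbolIntegrand α (R ξ))]
    refine integral_congr_ae (ae_of_all _ fun h => ?_)
    simp only [symbolIntegrand, LinearIsometryEquiv.norm_map, LinearIsometryEquiv.inner_map_map]
  rw [hrot]
  have h1 := Measure.integral_comp_smul (volume : Measure (Vec d))
    (symbolIntegrand α (firstVec hd)) ‖ξ‖
  have h2 : ∀ h : Vec d, symbolIntegrand α (firstVec hd) (‖ξ‖ • h)
      = ‖ξ‖ ^ (-(d : ℝ) - 2 * α) * symbolIntegrand α (‖ξ‖ • firstVec hd) h := by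
    intro h
    simp only [symbolIntegrand, norm_smul, norm_norm, inner_smul_left, inner_smul_right,
      Real.mul_rpow (norm_nonneg _) (norm_nonneg _), mul_assoc]
    simp
  simp only [h2, integral_const_mul, finrank_euclideanSpace_fin, smul_eq_mul] at h1
  rw [abs_of_pos (by positivity)] at h1
  have h3 : ‖ξ‖ ^ (-(d : ℝ) - 2 * α) ≠ 0 := (Real.rpow_pos_of_pos hpos _).ne'
  apply mul_left_cancel₀ h3
  rw [h1, symbolConst, ← mul_assoc, ← Real.rpow_add hpos]
  congr 1
  rw [← Real.rpow_natCast, ← Real.rpow_neg hpos.le]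
  congr 1; ring

/-- It suffices that the integrand is nonzero on a nonempty open set. If the first coordinate of `h`
lies in (0, 1), which is contained in (0, π), then e^{i h₁} has positive imaginary part and is not
1. -/
lemma symbolConst_pos (hd : 1 ≤ d) {α : ℝ} (hα : 0 < α) (hα1 : α < 1) :
    0 < symbolConst hd α := by
  rw [symbolConst, integral_pos_iff_support_of_nonneg (symbolIntegrand_nonneg _ _)
    (integrable_symbolIntegrand hd hα hα1 _)]
  have hopen : IsOpen {h : Vec d | h ⟨0, hd⟩ ∈ Ioo (0 : ℝ) 1} :=
    isOpen_Ioo.preimage (by fun_prop)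
  have hne : {h : Vec d | h ⟨0, hd⟩ ∈ Ioo (0 : ℝ) 1}.Nonempty :=
    ⟨EuclideanSpace.single ⟨0, hd⟩ (1 / 2), by
      rw [mem_ofPred_eq, PiLp.single_apply, if_pos rfl]; norm_num⟩
  refine (hopen.measure_pos volume hne).trans_le (measure_mono fun h hh => ?_)
  rw [mem_ofPred_eq] at hh
  rw [Function.mem_support, symbolIntegrand]
  have h0 : h ≠ 0 := by rintro rfl; simp at hh
  have hin : inner ℝ (firstVec hd) h = h ⟨0, hd⟩ := by
    simp [firstVec, EuclideanSpace.inner_single_left]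
  refine mul_ne_zero (Real.rpow_pos_of_pos (norm_pos_iff.2 h0) _).ne' (pow_ne_zero 2 ?_)
  rw [norm_ne_zero_iff, sub_ne_zero, hin]
  intro he
  have him := congrArg Complex.im he
  rw [mul_comm, Complex.exp_ofReal_mul_I_im] at him
  have := Real.sin_pos_of_pos_of_lt_pi hh.1 (by linarith [Real.pi_gt_three, hh.2])
  simp at him
  linarith

end Kernel

end VectorMixing

end

noncomputable section

namespace VectorMixing

open scoped ComplexConjugate

/-! ### Trigonometric polynomials and wave vectors -/

section TrigPolynomials

variable {d : ℕ} {L : ℝ} [hL : Fact (0 < L)]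

/-- The complex trigonometric polynomial with coefficients `c` on the finite set `S`. -/
def trigSum (S : Finset (Fin d → ℤ)) (c : (Fin d → ℤ) → ℂ) (x : Torus d L) : ℂ :=
  ∑ k ∈ S, c k * character k x

@[fun_prop]
lemma continuous_trigSum (S : Finset (Fin d → ℤ)) (c : (Fin d → ℤ) → ℂ) :
    Continuous (trigSum S c : Torus d L → ℂ) := by
  unfold trigSum; fun_prop

lemma memLp_of_continuous {f : Torus d L → ℂ} (hf : Continuous f) (p : ℝ≥0∞) : MemLp f p := by
  obtain ⟨C, hC⟩ := (isCompact_range hf).isBounded.exists_norm_le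
  exact MemLp.of_bound hf.aestronglyMeasurable C (ae_of_all _ fun x => hC _ ⟨x, rfl⟩)

lemma integrable_of_continuous {f : Torus d L → ℂ} (hf : Continuous f) : Integrable f :=
  memLp_one_iff_integrable.1 (memLp_of_continuous hf 1)

lemma cCoeff_trigSum (S : Finset (Fin d → ℤ)) (c : (Fin d → ℤ) → ℂ) (k : Fin d → ℤ) :
    cCoeff (trigSum S c : Torus d L → ℂ) k = if k ∈ S then c k else 0 := by
  unfold trigSum
  rw [cCoeff_sum _ fun l _ => (integrable_character l).const_mul _]
  simp only [cCoeff_const_mul, cCoeff_character]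
  simp

lemma integral_norm_sq_trigSum (S : Finset (Fin d → ℤ)) (c : (Fin d → ℤ) → ℂ) :
    ∫ x : Torus d L, ‖trigSum S c x‖ ^ 2 = L ^ d * ∑ k ∈ S, ‖c k‖ ^ 2 := by
  rw [integral_norm_sq_eq_tsum (memLp_of_continuous (by fun_prop) 2)]
  congr 1
  rw [tsum_eq_sum (s := S)]
  · refine Finset.sum_congr rfl fun k hk => ?_
    rw [cCoeff_trigSum, if_pos hk]
  · intro k hk
    rw [cCoeff_trigSum, if_neg hk]; simp

/-- Cauchy–Schwarz with a bounded weight. -/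
lemma norm_integral_mul_mul_conj_le {w f g : Torus d L → ℂ} {m : ℝ} (hm : 0 ≤ m)
    (hwb : ∀ᵐ x, ‖w x‖ ≤ m) (hf : MemLp f 2) (hg : MemLp g 2) :
    ‖∫ x, w x * f x * conj (g x)‖ ≤ m * (√(∫ x, ‖f x‖ ^ 2) * √(∫ x, ‖g x‖ ^ 2)) := by
  have h1 : ∫ x, ‖f x‖ * ‖g x‖ ≤ √(∫ x, ‖f x‖ ^ 2) * √(∫ x, ‖g x‖ ^ 2) := by
    have hf' : MemLp f (ENNReal.ofReal 2) := by simpa using hf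
    have hg' : MemLp g (ENNReal.ofReal 2) := by simpa using hg
    have := integral_mul_norm_le_Lp_mul_Lq (μ := volume) Real.HolderConjugate.two_two hf' hg'
    simpa only [Real.sqrt_eq_rpow, Real.rpow_two] using this
  have hfg : Integrable fun x => ‖f x‖ * ‖g x‖ := hf.norm.integrable_mul hg.norm
  calc ‖∫ x, w x * f x * conj (g x)‖ ≤ ∫ x, m * (‖f x‖ * ‖g x‖) := by
        refine norm_integral_le_of_norm_le (hfg.const_mul m) ?_
        filter_upwards [hwb] with x hx
        rw [norm_mul, norm_mul, RCLike.norm_conj, mul_assoc]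
        gcongr
    _ ≤ _ := by
        rw [integral_const_mul]
        gcongr

lemma integral_mul_trigSum_mul_conj {w : Torus d L → ℂ} (hw : Integrable w)
    (S T : Finset (Fin d → ℤ)) (b c : (Fin d → ℤ) → ℂ) :
    ∫ x, w x * trigSum S b x * conj (trigSum T c x)
      = (L : ℂ) ^ d * ∑ k ∈ S, ∑ l ∈ T, b k * conj (c l) * cCoeff w (l - k) := by
  have h1 : ∀ x, w x * trigSum S b x * conj (trigSum T c x) =
      ∑ k ∈ S, ∑ l ∈ T, b k * conj (c l) * (w x * character (-(l - k)) x) := by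
    intro x
    simp only [trigSum, map_sum, Finset.mul_sum, Finset.sum_mul, map_mul]
    rw [Finset.sum_comm]
    refine Finset.sum_congr rfl fun k _ => Finset.sum_congr rfl fun l _ => ?_
    rw [neg_sub, sub_eq_add_neg, character_freq_add, character_freq_neg]
    ring
  simp_rw [h1]
  have hi : ∀ k l, Integrable fun x => b k * conj (c l) * (w x * character (-(l - k)) x) :=
    fun k l => (integrable_mul_character hw _).const_mul _
  rw [integral_finsetSum _ fun k _ => integrable_finsetSum _ fun l _ => hi k l, Finset.mul_sum]
  refine Finset.sum_congr rfl fun k _ => ?_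
  rw [integral_finsetSum _ fun l _ => hi k l, Finset.mul_sum]
  refine Finset.sum_congr rfl fun l _ => ?_
  rw [integral_const_mul, cCoeff, mul_left_comm ((L : ℂ) ^ d), mul_inv_cancel_left₀ side_pow_ne_zero]

/-- Bounded functions act boundedly on `L²`, in terms of Fourier coefficients. -/
lemma norm_sum_cCoeff_le {w : Torus d L → ℂ} (hw : Integrable w) {m : ℝ} (hm : 0 ≤ m)
    (hwb : ∀ᵐ x, ‖w x‖ ≤ m) (S T : Finset (Fin d → ℤ)) (b c : (Fin d → ℤ) → ℂ) :
    ‖(L : ℂ) ^ d * ∑ k ∈ S, ∑ l ∈ T, b k * conj (c l) * cCoeff w (l - k)‖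
      ≤ m * L ^ d * (√(∑ k ∈ S, ‖b k‖ ^ 2) * √(∑ k ∈ T, ‖c k‖ ^ 2)) := by
  rw [← integral_mul_trigSum_mul_conj hw]
  refine (norm_integral_mul_mul_conj_le hm hwb (memLp_of_continuous (by fun_prop) 2)
    (memLp_of_continuous (by fun_prop) 2)).trans_eq ?_
  rw [integral_norm_sq_trigSum, integral_norm_sq_trigSum, Real.sqrt_mul side_pow_pos.le,
    Real.sqrt_mul side_pow_pos.le]
  have := Real.mul_self_sqrt (side_pow_pos (d := d) (L := L)).le
  linear_combination (m * √(∑ k ∈ S, ‖b k‖ ^ 2) * √(∑ k ∈ T, ‖c k‖ ^ 2)) * this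

/-- The Euclidean length of the wave vector. -/
def waveNorm (L : ℝ) (k : Fin d → ℤ) : ℝ := 2 * Real.pi / L * freqNorm k

lemma two_pi_div_pos : 0 < 2 * Real.pi / L := div_pos (by positivity) hL.out

lemma freqNorm_nonneg (k : Fin d → ℤ) : 0 ≤ freqNorm k := Real.sqrt_nonneg _

lemma freqNorm_sq (k : Fin d → ℤ) : freqNorm k ^ 2 = ∑ i, (k i : ℝ) ^ 2 :=
  Real.sq_sqrt (Finset.sum_nonneg fun _ _ => sq_nonneg _)

lemma waveNorm_nonneg (k : Fin d → ℤ) : 0 ≤ waveNorm L k :=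
  mul_nonneg two_pi_div_pos.le (freqNorm_nonneg k)

lemma freqNorm_pos {k : Fin d → ℤ} (hk : k ≠ 0) : 0 < freqNorm k := by
  obtain ⟨i, hi⟩ := Function.ne_iff.1 hk
  refine Real.sqrt_pos.2 (Finset.sum_pos' (fun _ _ => sq_nonneg _) ⟨i, Finset.mem_univ i, ?_⟩)
  have : (k i : ℝ) ≠ 0 := by exact_mod_cast hi
  positivity

lemma freqNorm_zero : freqNorm (0 : Fin d → ℤ) = 0 := by simp [freqNorm]

lemma waveNorm_zero : waveNorm L (0 : Fin d → ℤ) = 0 := by simp [waveNorm, freqNorm_zero]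

lemma waveNorm_pos {k : Fin d → ℤ} (hk : k ≠ 0) : 0 < waveNorm L k :=
  mul_pos two_pi_div_pos (freqNorm_pos hk)

lemma waveNorm_sq (k : Fin d → ℤ) : waveNorm L k ^ 2 = ∑ j, wave L k j ^ 2 := by
  simp only [waveNorm, wave, mul_pow, freqNorm_sq, Finset.mul_sum]

lemma abs_wave_le (k : Fin d → ℤ) (j : Fin d) : |wave L k j| ≤ waveNorm L k := by
  apply abs_le_of_sq_le_sq _ (waveNorm_nonneg k)
  rw [waveNorm_sq]
  exact Finset.single_le_sum (f := fun j => wave L k j ^ 2) (fun _ _ => sq_nonneg _)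
    (Finset.mem_univ j)

/-- The wave vector as a Euclidean vector. -/
def waveVec (L : ℝ) (k : Fin d → ℤ) : Vec d := WithLp.toLp 2 (wave L k)

lemma norm_waveVec (k : Fin d → ℤ) : ‖waveVec L k‖ = waveNorm L k := by
  rw [EuclideanSpace.norm_eq, ← Real.sqrt_sq (waveNorm_nonneg (L := L) k), waveNorm_sq]
  simp [waveVec]

lemma character_toTorus_vec (k : Fin d → ℤ) (h : Vec d) :
    character k (toTorus L h.ofLp) = Complex.exp (Complex.I * (inner ℝ (waveVec L k) h : ℝ)) := by
  rw [character_toTorus]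
  simp [waveVec, PiLp.inner_apply, mul_comm]

end TrigPolynomials

/-! ### The transport operator as a matrix on frequencies -/

section Transport

variable {d : ℕ} {L : ℝ} [hL : Fact (0 < L)]

/-- The matrix `∫ (W · ∇ e_k) conj e_l` of the transport operator. -/
def transportMatrix (W : Fin d → Torus d L → ℂ) (k l : Fin d → ℤ) : ℂ :=
  (L : ℂ) ^ d * ∑ j, Complex.I * wave L k j * cCoeff (W j) (l - k)

/-- `div W = 0` in terms of Fourier coefficients. -/
def IsFourierDivFree (W : Fin d → Torus d L → ℂ) : Prop :=
  ∀ k, ∑ j, (wave L k j : ℂ) * cCoeff (W j) k = 0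

/-- Integration by parts in Fourier form: the coefficient of `W` at l - k is orthogonal to l - k, so
the wave vector of `k` may be replaced by that of `l`, and the derivative may fall on either factor.
-/
lemma IsFourierDivFree.transportMatrix_eq {W : Fin d → Torus d L → ℂ} (hW : IsFourierDivFree W)
    (k l : Fin d → ℤ) :
    transportMatrix W k l = (L : ℂ) ^ d * ∑ j, Complex.I * wave L l j * cCoeff (W j) (l - k) := by
  unfold transportMatrix
  congr 1
  have h := hW (l - k)
  simp only [wave_sub, Complex.ofReal_sub, sub_mul, Finset.sum_sub_distrib] at h
  simp only [mul_assoc, ← Finset.mul_sum]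
  congr 1
  exact (sub_eq_zero.1 h).symm

/-- The operator U·∇ is skew-adjoint when `U` is real and divergence free. -/
lemma IsFourierDivFree.transportMatrix_symm {U : Fin d → Torus d L → ℝ}
    (hU : IsFourierDivFree fun j x => (U j x : ℂ)) (k l : Fin d → ℤ) :
    transportMatrix (fun j x => (U j x : ℂ)) l k
      = -conj (transportMatrix (fun j x => (U j x : ℂ)) k l) := by
  rw [hU.transportMatrix_eq k l, transportMatrix]
  simp only [map_mul, map_sum, map_pow, Complex.conj_ofReal, Complex.conj_I,
    ← cCoeff_ofReal_neg, neg_sub, ← mul_neg, ← Finset.sum_neg_distrib]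
  congr 1
  refine Finset.sum_congr rfl fun j _ => ?_
  ring

/-- The derivative falls on the first factor and costs at most Λ there. Each of the `d` components
of the field then acts as multiplication by a bounded function. -/
lemma norm_sum_transportMatrix_le {W : Fin d → Torus d L → ℂ} (hW : ∀ j, Integrable (W j))
    {m : ℝ} (hm : 0 ≤ m) (hWb : ∀ j, ∀ᵐ x, ‖W j x‖ ≤ m) {S T : Finset (Fin d → ℤ)} {Λ : ℝ}
    (hΛ : 0 ≤ Λ) (hS : ∀ k ∈ S, waveNorm L k ≤ Λ) (b c : (Fin d → ℤ) → ℂ) :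
    ‖∑ k ∈ S, ∑ l ∈ T, b k * conj (c l) * transportMatrix W k l‖
      ≤ d * m * L ^ d * Λ * (√(∑ k ∈ S, ‖b k‖ ^ 2) * √(∑ k ∈ T, ‖c k‖ ^ 2)) := by
  have h1 : ∑ k ∈ S, ∑ l ∈ T, b k * conj (c l) * transportMatrix W k l
      = ∑ j, (L : ℂ) ^ d * ∑ k ∈ S, ∑ l ∈ T,
        (Complex.I * wave L k j * b k) * conj (c l) * cCoeff (W j) (l - k) := by
    simp only [transportMatrix, Finset.mul_sum]
    symm
    rw [Finset.sum_comm]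
    refine Finset.sum_congr rfl fun k _ => ?_
    rw [Finset.sum_comm]
    refine Finset.sum_congr rfl fun l _ => Finset.sum_congr rfl fun j _ => ?_
    ring
  rw [h1]
  refine (norm_sum_le _ _).trans ?_
  have h2 : ∀ j, √(∑ k ∈ S, ‖Complex.I * wave L k j * b k‖ ^ 2) ≤ Λ * √(∑ k ∈ S, ‖b k‖ ^ 2) := by
    intro j
    rw [← Real.sqrt_sq hΛ, ← Real.sqrt_mul (sq_nonneg _), Finset.mul_sum]
    refine Real.sqrt_le_sqrt (Finset.sum_le_sum fun k hk => ?_)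
    rw [norm_mul, norm_mul, Complex.norm_I, one_mul, mul_pow, Complex.norm_real]
    gcongr
    exact (abs_wave_le k j).trans (hS k hk)
  calc ∑ j, ‖(L : ℂ) ^ d * ∑ k ∈ S, ∑ l ∈ T,
        (Complex.I * wave L k j * b k) * conj (c l) * cCoeff (W j) (l - k)‖
      ≤ ∑ _j : Fin d, m * L ^ d * (Λ * √(∑ k ∈ S, ‖b k‖ ^ 2) * √(∑ k ∈ T, ‖c k‖ ^ 2)) := by
        refine Finset.sum_le_sum fun j _ => ?_
        refine (norm_sum_cCoeff_le (hW j) hm (hWb j) S T _ c).trans ?_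
        have := side_pow_pos (d := d) (L := L)
        gcongr
        exact h2 j
    _ = _ := by
        rw [Finset.sum_const, Finset.card_univ, Fintype.card_fin, nsmul_eq_mul]; ring

/-- The counterpart with the derivative on the second factor, where the divergence condition allows
it to be moved. -/
lemma norm_sum_transportMatrix_le' {W : Fin d → Torus d L → ℂ} (hW : ∀ j, Integrable (W j))
    (hdiv : IsFourierDivFree W)
    {m : ℝ} (hm : 0 ≤ m) (hWb : ∀ j, ∀ᵐ x, ‖W j x‖ ≤ m) {S T : Finset (Fin d → ℤ)} {Λ : ℝ}
    (hΛ : 0 ≤ Λ) (hT : ∀ k ∈ T, waveNorm L k ≤ Λ) (b c : (Fin d → ℤ) → ℂ) :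
    ‖∑ k ∈ S, ∑ l ∈ T, b k * conj (c l) * transportMatrix W k l‖
      ≤ d * m * L ^ d * Λ * (√(∑ k ∈ S, ‖b k‖ ^ 2) * √(∑ k ∈ T, ‖c k‖ ^ 2)) := by
  have h1 : ∑ k ∈ S, ∑ l ∈ T, b k * conj (c l) * transportMatrix W k l
      = ∑ j, (L : ℂ) ^ d * ∑ k ∈ S, ∑ l ∈ T,
        b k * conj (-Complex.I * wave L l j * c l) * cCoeff (W j) (l - k) := by
    simp only [hdiv.transportMatrix_eq, Finset.mul_sum]
    symm
    rw [Finset.sum_comm]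
    refine Finset.sum_congr rfl fun k _ => ?_
    rw [Finset.sum_comm]
    refine Finset.sum_congr rfl fun l _ => Finset.sum_congr rfl fun j _ => ?_
    simp only [map_mul, map_neg, Complex.conj_I, Complex.conj_ofReal]
    ring
  rw [h1]
  refine (norm_sum_le _ _).trans ?_
  have h2 : ∀ j, √(∑ k ∈ T, ‖-Complex.I * wave L k j * c k‖ ^ 2) ≤ Λ * √(∑ k ∈ T, ‖c k‖ ^ 2) := by
    intro j
    rw [← Real.sqrt_sq hΛ, ← Real.sqrt_mul (sq_nonneg _), Finset.mul_sum]
    refine Real.sqrt_le_sqrt (Finset.sum_le_sum fun k hk => ?_)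
    rw [norm_mul, norm_mul, norm_neg, Complex.norm_I, one_mul, mul_pow, Complex.norm_real]
    gcongr
    exact (abs_wave_le k j).trans (hT k hk)
  calc ∑ j, ‖(L : ℂ) ^ d * ∑ k ∈ S, ∑ l ∈ T,
        b k * conj (-Complex.I * wave L l j * c l) * cCoeff (W j) (l - k)‖
      ≤ ∑ _j : Fin d, m * L ^ d * (√(∑ k ∈ S, ‖b k‖ ^ 2) * (Λ * √(∑ k ∈ T, ‖c k‖ ^ 2))) := by
        refine Finset.sum_le_sum fun j _ => ?_
        refine (norm_sum_cCoeff_le (hW j) hm (hWb j) S T b _).trans ?_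
        have := side_pow_pos (d := d) (L := L)
        gcongr
        exact h2 j
    _ = _ := by
        rw [Finset.sum_const, Finset.card_univ, Fintype.card_fin, nsmul_eq_mul]; ring

end Transport

end VectorMixing

end

noncomputable section

namespace VectorMixing

open scoped ComplexConjugate

/-! ### Schur's test for dyadic sums -/

section Schur

lemma summable_two_rpow_neg_abs {ε : ℝ} (hε : 0 < ε) :
    Summable fun m : ℤ => (2 : ℝ) ^ (-ε * |(m : ℝ)|) := by
  have hr : (2 : ℝ) ^ (-ε) < 1 := Real.rpow_lt_one_of_one_lt_of_neg one_lt_two (by linarith)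
  have hg := summable_geometric_of_lt_one (Real.rpow_nonneg zero_le_two (-ε)) hr
  have he : ∀ n : ℕ, ((2 : ℝ) ^ (-ε)) ^ n = (2 : ℝ) ^ (-ε * (n : ℝ)) := by
    intro n
    rw [Real.rpow_mul zero_le_two, Real.rpow_natCast]
  refine Summable.of_nat_of_neg ?_ ?_
  · refine hg.congr fun n => ?_
    rw [he]; simp
  · refine hg.congr fun n => ?_
    rw [he]; simp

/-- The constant of the Schur test `sum_sum_two_rpow_le`. -/
def schurConst (ε : ℝ) : ℝ := ∑' m : ℤ, (2 : ℝ) ^ (-ε * |(m : ℝ)|)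

lemma schurConst_nonneg (ε : ℝ) : 0 ≤ schurConst ε :=
  tsum_nonneg fun _ => Real.rpow_nonneg zero_le_two _

lemma sum_two_rpow_le {ε : ℝ} (hε : 0 < ε) (F : Finset ℤ) (a : ℤ) :
    ∑ b ∈ F, (2 : ℝ) ^ (-ε * |(a : ℝ) - b|) ≤ schurConst ε := by
  have hs : Summable fun b : ℤ => (2 : ℝ) ^ (-ε * |(a : ℝ) - b|) := by
    have := (summable_two_rpow_neg_abs hε).comp_injective (Equiv.subLeft a).injective
    refine this.congr fun b => ?_
    simp
  refine (hs.sum_le_tsum F fun _ _ => Real.rpow_nonneg zero_le_two _).trans_eq ?_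
  rw [schurConst, ← (Equiv.subLeft a).tsum_eq]
  refine tsum_congr fun b => ?_
  simp

/-- Schur's test for a symmetric kernel: x_a x_b ≤ (x_a² + x_b²)/2, and every row sum is at most
`schurConst ε`. -/
lemma sum_sum_two_rpow_le {ε : ℝ} (hε : 0 < ε) (F : Finset ℤ) (x : ℤ → ℝ) :
    ∑ a ∈ F, ∑ b ∈ F, (2 : ℝ) ^ (-ε * |(a : ℝ) - b|) * (x a * x b)
      ≤ schurConst ε * ∑ a ∈ F, x a ^ 2 := by
  have h1 : ∑ a ∈ F, ∑ b ∈ F, (2 : ℝ) ^ (-ε * |(a : ℝ) - b|) * (x a * x b)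
      ≤ ∑ a ∈ F, ∑ b ∈ F, (2 : ℝ) ^ (-ε * |(a : ℝ) - b|) * (x a ^ 2 / 2 + x b ^ 2 / 2) := by
    refine Finset.sum_le_sum fun a _ => Finset.sum_le_sum fun b _ => ?_
    refine mul_le_mul_of_nonneg_left ?_ (Real.rpow_nonneg zero_le_two _)
    nlinarith [sq_nonneg (x a - x b)]
  have h2 : ∑ a ∈ F, ∑ b ∈ F, (2 : ℝ) ^ (-ε * |(a : ℝ) - b|) * (x a ^ 2 / 2)
      ≤ schurConst ε * ∑ a ∈ F, x a ^ 2 / 2 := by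
    rw [Finset.mul_sum]
    refine Finset.sum_le_sum fun a _ => ?_
    rw [← Finset.sum_mul]
    exact mul_le_mul_of_nonneg_right (sum_two_rpow_le hε F a) (by positivity)
  have h3 : ∑ a ∈ F, ∑ b ∈ F, (2 : ℝ) ^ (-ε * |(a : ℝ) - b|) * (x b ^ 2 / 2)
      = ∑ a ∈ F, ∑ b ∈ F, (2 : ℝ) ^ (-ε * |(a : ℝ) - b|) * (x a ^ 2 / 2) := by
    rw [Finset.sum_comm]
    refine Finset.sum_congr rfl fun a _ => Finset.sum_congr rfl fun b _ => ?_
    rw [abs_sub_comm]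
  refine h1.trans ?_
  simp only [mul_add, Finset.sum_add_distrib]
  rw [h3]
  refine (add_le_add h2 h2).trans_eq ?_
  rw [← Finset.sum_div]; ring

/-- The exponent count of two dyadic blocks. -/
lemma two_rpow_min_mul_le {α : ℝ} (hα : 0 < α) (a b : ℤ) :
    (2 : ℝ) ^ (min (a : ℝ) b) * (2 : ℝ) ^ ((b : ℝ) * α)
      ≤ (2 : ℝ) ^ (-((1 - α) / 2) * |(a : ℝ) - b|) *
        ((2 : ℝ) ^ ((a : ℝ) * ((1 + α) / 2)) * (2 : ℝ) ^ ((b : ℝ) * ((1 + α) / 2))) := by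
  rw [← Real.rpow_add two_pos, ← Real.rpow_add two_pos, ← Real.rpow_add two_pos]
  apply Real.rpow_le_rpow_of_exponent_le one_le_two
  -- For a ≤ b both sides have the exponent a + αb. For b ≤ a the right side has αa + b, which is at
  -- least the exponent b + αb on the left.
  rcases le_total (a : ℝ) b with h | h
  · rw [min_eq_left h, abs_of_nonpos (by linarith)]
    apply le_of_eq; ring
  · rw [min_eq_right h, abs_of_nonneg (by linarith)]
    nlinarith

end Schur

/-! ### Increment forms and their dyadic blocks -/

section Commutator

variable {d : ℕ} {L : ℝ} [hL : Fact (0 < L)]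

/-- The dyadic block of a frequency. -/
def dyadicIndex (L : ℝ) (k : Fin d → ℤ) : ℤ := Int.log 2 (waveNorm L k)

lemma two_rpow_dyadicIndex_le {k : Fin d → ℤ} (hk : k ≠ 0) :
    (2 : ℝ) ^ ((dyadicIndex L k : ℤ) : ℝ) ≤ waveNorm L k := by
  rw [Real.rpow_intCast]
  have := Int.zpow_log_le_self (b := 2) (r := waveNorm L k) one_lt_two (waveNorm_pos hk)
  simpa [dyadicIndex] using this

lemma waveNorm_le_two_rpow (k : Fin d → ℤ) :
    waveNorm L k ≤ (2 : ℝ) ^ (((dyadicIndex L k : ℤ) : ℝ) + 1) := by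
  have := Int.lt_zpow_succ_log_self (b := 2) one_lt_two (waveNorm L k)
  have e : (((dyadicIndex L k : ℤ) : ℝ) + 1) = ((dyadicIndex L k + 1 : ℤ) : ℝ) := by push_cast; rfl
  rw [e, Real.rpow_intCast]
  simpa [dyadicIndex] using this.le

/-- The increment of a vector field. -/
def increment (U : Fin d → Torus d L → ℝ) (h : Vec d) (j : Fin d) (x : Torus d L) : ℂ :=
  (U j (x + toTorus L h.ofLp) : ℂ) - (U j x : ℂ)

lemma cCoeff_increment {U : Fin d → Torus d L → ℝ} (hU : ∀ j, Integrable (U j)) (h : Vec d)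
    (j : Fin d) (k : Fin d → ℤ) :
    cCoeff (increment U h j) k
      = (character k (toTorus L h.ofLp) - 1) * cCoeff (fun x => (U j x : ℂ)) k := by
  have h1 : Integrable fun x => (U j x : ℂ) := (hU j).ofReal
  have e : increment U h j = fun x =>
    (fun x => (U j x : ℂ)) (x + toTorus L h.ofLp) - (fun x => (U j x : ℂ)) x := rfl
  rw [e, cCoeff_sub (h1.comp_add_right _) h1,
    cCoeff_translate (fun x => (U j x : ℂ)) (toTorus L h.ofLp) k]
  ring

lemma transportMatrix_increment {U : Fin d → Torus d L → ℝ} (hU : ∀ j, Integrable (U j))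
    (h : Vec d) (k l : Fin d → ℤ) :
    transportMatrix (increment U h) k l
      = (conj (character k (toTorus L h.ofLp)) * character l (toTorus L h.ofLp) - 1) *
        transportMatrix (fun j x => (U j x : ℂ)) k l := by
  simp only [transportMatrix, cCoeff_increment hU]
  conv_rhs => rw [mul_left_comm, Finset.mul_sum]
  congr 1
  refine Finset.sum_congr rfl fun j _ => ?_
  rw [sub_eq_add_neg l k, character_freq_add, character_freq_neg]
  ring

lemma isFourierDivFree_increment {U : Fin d → Torus d L → ℝ} (hU : ∀ j, Integrable (U j))
    (hdiv : IsFourierDivFree fun j x => (U j x : ℂ)) (h : Vec d) :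
    IsFourierDivFree (increment U h) := by
  intro k
  simp only [cCoeff_increment hU]
  have := hdiv k
  calc ∑ j, (wave L k j : ℂ) * ((character k (toTorus L h.ofLp) - 1) *
        cCoeff (fun x => (U j x : ℂ)) k)
      = (character k (toTorus L h.ofLp) - 1) *
        ∑ j, (wave L k j : ℂ) * cCoeff (fun x => (U j x : ℂ)) k := by
        rw [Finset.mul_sum]
        refine Finset.sum_congr rfl fun j _ => ?_
        ring
    _ = 0 := by rw [this, mul_zero]

lemma integrable_increment {U : Fin d → Torus d L → ℝ} (hU : ∀ j, Integrable (U j))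
    (h : Vec d) (j : Fin d) : Integrable (increment U h j) := by
  have h1 : Integrable fun x => (U j x : ℂ) := (hU j).ofReal
  exact (h1.comp_add_right (toTorus L h.ofLp)).sub h1

/-- The contribution `∫ (δ_h U · ∇φ) conj (δ_h φ)` of a shift `h`. -/
def incrementForm (U : Fin d → Torus d L → ℝ) (S T : Finset (Fin d → ℤ)) (φ : (Fin d → ℤ) → ℂ)
    (h : Vec d) : ℂ :=
  ∑ k ∈ S, ∑ l ∈ T, φ k * conj (φ l * (character l (toTorus L h.ofLp) - 1)) *
    transportMatrix (increment U h) k l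

/-- By skew-symmetry, a quadratic form of the transport matrix is purely imaginary. -/
lemma re_sum_transportMatrix_eq_zero {U : Fin d → Torus d L → ℝ}
    (hdiv : IsFourierDivFree fun j x => (U j x : ℂ)) (S : Finset (Fin d → ℤ))
    (y : (Fin d → ℤ) → ℂ) :
    (∑ k ∈ S, ∑ l ∈ S, y k * conj (y l) * transportMatrix (fun j x => (U j x : ℂ)) k l).re = 0 := by
  set A := ∑ k ∈ S, ∑ l ∈ S, y k * conj (y l) * transportMatrix (fun j x => (U j x : ℂ)) k l with hA
  have h1 : A = -conj A := by
    rw [hA]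
    conv_lhs => rw [Finset.sum_comm]
    simp only [map_sum, ← Finset.sum_neg_distrib]
    refine Finset.sum_congr rfl fun k _ => Finset.sum_congr rfl fun l _ => ?_
    rw [hdiv.transportMatrix_symm k l]
    simp only [map_mul, Complex.conj_conj]
    ring
  have h2 := congrArg Complex.re h1
  simp only [Complex.neg_re, Complex.conj_re] at h2
  linarith

/-- With θ_k the value of the k-th character at `h`, the multiplier of the increment form satisfies
(conj θ_k θ_l - 1)(conj θ_l - 1) = |θ_l - 1|² - conj(θ_k - 1)(θ_l - 1), because |θ_l| = 1. The last
term yields the transport form of the function with coefficients φ_k conj(θ_k - 1), which is purely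
imaginary by skew-adjointness. What survives is the weight |θ_l - 1|², the integrand of the symbol
of Λ^{2α}. -/
lemma re_incrementForm {U : Fin d → Torus d L → ℝ} (hU : ∀ j, Integrable (U j))
    (hdiv : IsFourierDivFree fun j x => (U j x : ℂ)) (S : Finset (Fin d → ℤ))
    (φ : (Fin d → ℤ) → ℂ) (h : Vec d) :
    (incrementForm U S S φ h).re = ∑ k ∈ S, ∑ l ∈ S,
      ‖character l (toTorus L h.ofLp) - 1‖ ^ 2 *
      (φ k * conj (φ l) * transportMatrix (fun j x => (U j x : ℂ)) k l).re := by
  set θ : (Fin d → ℤ) → ℂ := fun k => character k (toTorus L h.ofLp) with hθ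
  have hθ1 : ∀ k, θ k * conj (θ k) = 1 := fun k => character_mul_conj k _
  have h0 := re_sum_transportMatrix_eq_zero hdiv S fun k => φ k * conj (θ k - 1)
  have h1 : incrementForm U S S φ h =
      (∑ k ∈ S, ∑ l ∈ S, ((‖θ l - 1‖ ^ 2 : ℝ) : ℂ) *
        (φ k * conj (φ l) * transportMatrix (fun j x => (U j x : ℂ)) k l)) -
      ∑ k ∈ S, ∑ l ∈ S, (φ k * conj (θ k - 1)) * conj (φ l * conj (θ l - 1)) *
        transportMatrix (fun j x => (U j x : ℂ)) k l := by
    rw [incrementForm, ← Finset.sum_sub_distrib]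
    refine Finset.sum_congr rfl fun k _ => ?_
    rw [← Finset.sum_sub_distrib]
    refine Finset.sum_congr rfl fun l _ => ?_
    rw [transportMatrix_increment hU, ← Complex.normSq_eq_norm_sq, ← Complex.mul_conj]
    simp only [map_mul, map_sub, map_one, Complex.conj_conj]
    change φ k * (conj (φ l) * (conj (θ l) - 1)) * ((conj (θ k) * θ l - 1) * _) = _
    linear_combination (φ k * conj (φ l) * transportMatrix (fun j x => (U j x : ℂ)) k l *
      (conj (θ k) - 1)) * hθ1 l
  rw [h1, Complex.sub_re, h0, sub_zero, Complex.re_sum]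
  refine Finset.sum_congr rfl fun k _ => ?_
  rw [Complex.re_sum]
  refine Finset.sum_congr rfl fun l _ => ?_
  rw [Complex.re_ofReal_mul]

/-- The estimate of two dyadic blocks. -/
lemma norm_incrementForm_block_le {U : Fin d → Torus d L → ℝ} (hU : ∀ j, Integrable (U j))
    (hdiv : IsFourierDivFree fun j x => (U j x : ℂ)) {h : Vec d} {m : ℝ} (hm : 0 ≤ m)
    (hb : ∀ j, ∀ᵐ x, ‖increment U h j x‖ ≤ m) {S T : Finset (Fin d → ℤ)} {a b : ℤ}
    (hS : ∀ k ∈ S, dyadicIndex L k = a) (hT : ∀ k ∈ T, dyadicIndex L k = b)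
    (φ : (Fin d → ℤ) → ℂ) :
    ‖incrementForm U S T φ h‖ ≤ d * m * L ^ d * (2 : ℝ) ^ (min (a : ℝ) b + 1) *
      (√(∑ k ∈ S, ‖φ k‖ ^ 2) * (2 * min ((2 : ℝ) ^ ((b : ℝ) + 1) * ‖h‖) 1 *
        √(∑ k ∈ T, ‖φ k‖ ^ 2))) := by
  set c : (Fin d → ℤ) → ℂ := fun l => φ l * (character l (toTorus L h.ofLp) - 1) with hc
  have hmin : 0 ≤ min ((2 : ℝ) ^ ((b : ℝ) + 1) * ‖h‖) 1 := by positivity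
  have h1 : √(∑ k ∈ T, ‖c k‖ ^ 2) ≤ 2 * min ((2 : ℝ) ^ ((b : ℝ) + 1) * ‖h‖) 1 *
        √(∑ k ∈ T, ‖φ k‖ ^ 2) := by
    rw [← Real.sqrt_sq (mul_nonneg zero_le_two hmin), ← Real.sqrt_mul (sq_nonneg _), Finset.mul_sum]
    refine Real.sqrt_le_sqrt (Finset.sum_le_sum fun k hk => ?_)
    rw [hc]
    simp only [norm_mul]
    rw [mul_pow, mul_comm (‖φ k‖ ^ 2)]
    refine mul_le_mul_of_nonneg_right ?_ (sq_nonneg _)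
    refine pow_le_pow_left₀ (norm_nonneg _) ?_ 2
    rw [character_toTorus_vec]
    refine (norm_exp_sub_one_le _).trans ?_
    refine mul_le_mul_of_nonneg_left (min_le_min_right _ ?_) zero_le_two
    refine (abs_real_inner_le_norm _ _).trans ?_
    rw [norm_waveVec]
    refine mul_le_mul_of_nonneg_right ?_ (norm_nonneg _)
    rw [← hT k hk]
    exact waveNorm_le_two_rpow k
  have hLd := side_pow_pos (d := d) (L := L)
  have h2 : ‖incrementForm U S T φ h‖ ≤ d * m * L ^ d * (2 : ℝ) ^ (min (a : ℝ) b + 1) *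
      (√(∑ k ∈ S, ‖φ k‖ ^ 2) * √(∑ k ∈ T, ‖c k‖ ^ 2)) := by
    -- The derivative goes to the factor with the lower frequency. When that is the second factor,
    -- this uses that increments of `U` are again divergence free.
    rcases le_total (a : ℝ) b with hab | hab
    · rw [min_eq_left hab]
      refine norm_sum_transportMatrix_le (integrable_increment hU h) hm hb
        (Real.rpow_nonneg zero_le_two _) (fun k hk => ?_) φ c
      rw [← hS k hk]
      exact waveNorm_le_two_rpow k
    · rw [min_eq_right hab]
      refine norm_sum_transportMatrix_le' (integrable_increment hU h)
        (isFourierDivFree_increment hU hdiv h) hm hb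
        (Real.rpow_nonneg zero_le_two _) (fun k hk => ?_) φ c
      rw [← hT k hk]
      exact waveNorm_le_two_rpow k
  refine h2.trans ?_
  gcongr

lemma incrementForm_eq_sum_blocks (U : Fin d → Torus d L → ℝ) (S : Finset (Fin d → ℤ))
    (φ : (Fin d → ℤ) → ℂ) (h : Vec d) :
    incrementForm U S S φ h = ∑ a ∈ S.image (dyadicIndex L), ∑ b ∈ S.image (dyadicIndex L),
      incrementForm U (S.filter fun k => dyadicIndex L k = a)
        (S.filter fun k => dyadicIndex L k = b) φ h := by
  unfold incrementForm
  rw [← Finset.sum_fiberwise_of_maps_to (g := dyadicIndex L) (t := S.image (dyadicIndex L))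
    (fun k hk => Finset.mem_image_of_mem _ hk)]
  refine Finset.sum_congr rfl fun a _ => ?_
  rw [Finset.sum_comm (s := S.image (dyadicIndex L))]
  refine Finset.sum_congr rfl fun k _ => ?_
  rw [← Finset.sum_fiberwise_of_maps_to (g := dyadicIndex L) (t := S.image (dyadicIndex L))
    (fun k hk => Finset.mem_image_of_mem _ hk)]

end Commutator

end VectorMixing

end

noncomputable section

namespace VectorMixing

open scoped ComplexConjugate

/-! ### The commutator estimate -/

section CommutatorEstimate

variable {d : ℕ} {L : ℝ} [hL : Fact (0 < L)]

/-- The quadratic form of the transport matrix weighted by the fractional Laplacian is the integral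
over all shifts of the increment forms. -/
lemma integral_re_incrementForm (hd : 1 ≤ d) {α : ℝ} (hα : 0 < α) (hα1 : α < 1)
    {U : Fin d → Torus d L → ℝ} (hU : ∀ j, Integrable (U j))
    (hdiv : IsFourierDivFree fun j x => (U j x : ℂ)) (S : Finset (Fin d → ℤ))
    (φ : (Fin d → ℤ) → ℂ) :
    ∫ h : Vec d, ‖h‖ ^ (-(d : ℝ) - 2 * α) * (incrementForm U S S φ h).re
      = symbolConst hd α * ∑ k ∈ S, ∑ l ∈ S, waveNorm L l ^ (2 * α) *
        (φ k * conj (φ l) * transportMatrix (fun j x => (U j x : ℂ)) k l).re := by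
  have h1 : ∀ h : Vec d, ‖h‖ ^ (-(d : ℝ) - 2 * α) * (incrementForm U S S φ h).re =
      ∑ k ∈ S, ∑ l ∈ S, symbolIntegrand α (waveVec L l) h *
        (φ k * conj (φ l) * transportMatrix (fun j x => (U j x : ℂ)) k l).re := by
    intro h
    rw [re_incrementForm hU hdiv, Finset.mul_sum]
    refine Finset.sum_congr rfl fun k _ => ?_
    rw [Finset.mul_sum]
    refine Finset.sum_congr rfl fun l _ => ?_
    rw [symbolIntegrand, character_toTorus_vec]
    ring
  have hi : ∀ k l, Integrable fun h : Vec d => symbolIntegrand α (waveVec L l) h *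
        (φ k * conj (φ l) * transportMatrix (fun j x => (U j x : ℂ)) k l).re :=
    fun k l => (integrable_symbolIntegrand hd hα hα1 _).mul_const _
  simp_rw [h1]
  rw [integral_finsetSum _ fun k _ => integrable_finsetSum _ fun l _ => hi k l, Finset.mul_sum]
  refine Finset.sum_congr rfl fun k _ => ?_
  rw [integral_finsetSum _ fun l _ => hi k l, Finset.mul_sum]
  refine Finset.sum_congr rfl fun l _ => ?_
  rw [integral_mul_const, integral_symbol hd hα, norm_waveVec]
  ring

/-- The constant of the commutator estimate. -/
def commutatorConst (hd : 1 ≤ d) (α : ℝ) : ℝ :=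
  (symbolConst hd α)⁻¹ * (4 * d * 2 ^ α * radialConst d α * schurConst ((1 - α) / 2))

lemma commutatorConst_nonneg (hd : 1 ≤ d) {α : ℝ} (hα : 0 < α) (hα1 : α < 1) :
    0 ≤ commutatorConst hd α := by
  have h1 := (symbolConst_pos hd hα hα1).le
  have h2 := radialConst_nonneg d α
  have h3 := schurConst_nonneg ((1 - α) / 2)
  unfold commutatorConst
  positivity

/-- On block `a` the wave length is at least 2^a. The zero frequency satisfies no such bound and is
therefore excluded. -/
lemma sum_dyadic_le {α : ℝ} (hα : 0 < α) {S : Finset (Fin d → ℤ)} (hS : 0 ∉ S)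
    (φ : (Fin d → ℤ) → ℂ) :
    ∑ a ∈ S.image (dyadicIndex L), ((2 : ℝ) ^ ((a : ℝ) * ((1 + α) / 2)) *
      √(∑ k ∈ S.filter (fun k => dyadicIndex L k = a), ‖φ k‖ ^ 2)) ^ 2
      ≤ ∑ k ∈ S, waveNorm L k ^ (1 + α) * ‖φ k‖ ^ 2 := by
  rw [← Finset.sum_fiberwise_of_maps_to (s := S) (g := dyadicIndex L)
    (t := S.image (dyadicIndex L)) (fun k hk => Finset.mem_image_of_mem _ hk)]
  refine Finset.sum_le_sum fun a _ => ?_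
  rw [mul_pow, Real.sq_sqrt (Finset.sum_nonneg fun _ _ => sq_nonneg _), Finset.mul_sum]
  refine Finset.sum_le_sum fun k hk => ?_
  rw [Finset.mem_filter] at hk
  refine mul_le_mul_of_nonneg_right ?_ (sq_nonneg _)
  have hk0 : k ≠ 0 := fun h => hS (h ▸ hk.1)
  have h1 : ((2 : ℝ) ^ ((a : ℝ) * ((1 + α) / 2))) ^ 2 = ((2 : ℝ) ^ (a : ℝ)) ^ (1 + α) := by
    rw [← Real.rpow_natCast, ← Real.rpow_mul zero_le_two, ← Real.rpow_mul zero_le_two]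
    congr 1; push_cast; ring
  rw [h1]
  refine Real.rpow_le_rpow (Real.rpow_nonneg zero_le_two _) ?_ (by linarith)
  rw [← hk.2]
  exact two_rpow_dyadicIndex_le hk0

/-- The estimate of the increment forms, integrated over all shifts. -/
lemma integral_norm_incrementForm_le (hd : 1 ≤ d) {α : ℝ} (hα : 0 < α) (hα1 : α < 1)
    {U : Fin d → Torus d L → ℝ} (hU : ∀ j, Integrable (U j))
    (hdiv : IsFourierDivFree fun j x => (U j x : ℂ)) {M : ℝ} (hM : 0 ≤ M)
    (hb : ∀ (h : Vec d) j, ∀ᵐ x, ‖increment U h j x‖ ≤ M * ‖h‖ ^ α)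
    {S : Finset (Fin d → ℤ)} (hS : 0 ∉ S) (φ : (Fin d → ℤ) → ℂ) :
    |∫ h : Vec d, ‖h‖ ^ (-(d : ℝ) - 2 * α) * (incrementForm U S S φ h).re|
      ≤ 4 * d * 2 ^ α * radialConst d α * schurConst ((1 - α) / 2) * (M * L ^ d *
        ∑ k ∈ S, waveNorm L k ^ (1 + α) * ‖φ k‖ ^ 2) := by
  have hLd := side_pow_pos (d := d) (L := L)
  have hJ := radialConst_nonneg d α
  set F := S.image (dyadicIndex L) with hF
  set ν : ℤ → ℝ := fun a => √(∑ k ∈ S.filter (fun k => dyadicIndex L k = a), ‖φ k‖ ^ 2) with hν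
  have hν0 : ∀ a, 0 ≤ ν a := fun a => Real.sqrt_nonneg _
  set K : ℤ → ℤ → ℝ := fun a b => 2 * d * M * L ^ d * (2 : ℝ) ^ (min (a : ℝ) b + 1) * (ν a * ν b)
    with hK
  have hbound : ∀ h : Vec d, ‖‖h‖ ^ (-(d : ℝ) - 2 * α) * (incrementForm U S S φ h).re‖
      ≤ ∑ a ∈ F, ∑ b ∈ F, K a b *
        (‖h‖ ^ (-(d : ℝ) - α) * min ((2 : ℝ) ^ ((b : ℝ) + 1) * ‖h‖) 1) := by
    intro h
    rcases eq_or_ne h 0 with rfl | h0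
    -- At h = 0 the singular weight is `0` by the convention for real powers of `0`.
    · have : (-(d : ℝ) - 2 * α) ≠ 0 := by
        have : (0 : ℝ) ≤ d := by positivity
        intro h; linarith
      rw [norm_zero, Real.zero_rpow this, zero_mul, norm_zero]
      refine Finset.sum_nonneg fun a _ => Finset.sum_nonneg fun b _ => ?_
      have := hν0 a
      have := hν0 b
      simp only [hK]
      positivity
    have hpos : 0 < ‖h‖ := norm_pos_iff.2 h0
    rw [norm_mul, Real.norm_of_nonneg (Real.rpow_nonneg hpos.le _)]
    have h1 : ‖(incrementForm U S S φ h).re‖ ≤ ∑ a ∈ F, ∑ b ∈ F, ‖h‖ ^ α * (K a b *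
        min ((2 : ℝ) ^ ((b : ℝ) + 1) * ‖h‖) 1) := by
      refine (Complex.abs_re_le_norm _).trans ?_
      rw [incrementForm_eq_sum_blocks]
      refine (norm_sum_le _ _).trans (Finset.sum_le_sum fun a _ => ?_)
      refine (norm_sum_le _ _).trans (Finset.sum_le_sum fun b _ => ?_)
      refine (norm_incrementForm_block_le hU hdiv (by positivity) (hb h) (a := a) (b := b)
        (fun k hk => (Finset.mem_filter.1 hk).2) (fun k hk => (Finset.mem_filter.1 hk).2)
        φ).trans_eq ?_
      simp only [hK, hν]
      ring
    refine (mul_le_mul_of_nonneg_left h1 (Real.rpow_nonneg hpos.le _)).trans_eq ?_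
    rw [Finset.mul_sum]
    refine Finset.sum_congr rfl fun a _ => ?_
    rw [Finset.mul_sum]
    refine Finset.sum_congr rfl fun b _ => ?_
    have e : ‖h‖ ^ (-(d : ℝ) - 2 * α) * ‖h‖ ^ α = ‖h‖ ^ (-(d : ℝ) - α) := by
      rw [← Real.rpow_add hpos]; congr 1; ring
    rw [← e]; ring
  have hint : ∀ a b : ℤ, Integrable fun h : Vec d => K a b *
        (‖h‖ ^ (-(d : ℝ) - α) * min ((2 : ℝ) ^ ((b : ℝ) + 1) * ‖h‖) 1) := by
    intro a b
    have := integrable_radial_kernel hd hα (n := 1) (by simpa using hα1)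
      (lam := (2 : ℝ) ^ ((b : ℝ) + 1)) (by positivity)
    simp only [pow_one] at this
    exact this.const_mul _
  have h2 := norm_integral_le_of_norm_le (integrable_finsetSum F fun a _ =>
    integrable_finsetSum F fun b _ => hint a b) (ae_of_all _ hbound)
  rw [Real.norm_eq_abs] at h2
  refine h2.trans ?_
  rw [integral_finsetSum _ fun a _ => integrable_finsetSum _ fun b _ => hint a b]
  -- The constant 4 is the product of the 2 in |e^{iθ} - 1| ≤ 2 min(|θ|, 1) and the 2 in
  -- 2^{min(a,b)+1}. The factor 2^α comes from (2^{b+1})^α, the value of the integral over shifts at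
  -- the scale 2^{b+1}.
  have h3 : ∀ a ∈ F, ∫ h : Vec d, ∑ b ∈ F, K a b *
        (‖h‖ ^ (-(d : ℝ) - α) * min ((2 : ℝ) ^ ((b : ℝ) + 1) * ‖h‖) 1)
      ≤ ∑ b ∈ F, 4 * d * 2 ^ α * radialConst d α * (M * L ^ d) *
        ((2 : ℝ) ^ (-((1 - α) / 2) * |(a : ℝ) - b|) *
        (((2 : ℝ) ^ ((a : ℝ) * ((1 + α) / 2)) * ν a) * ((2 : ℝ) ^ ((b : ℝ) * ((1 + α) / 2)) * ν b))) := by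
    intro a _
    rw [integral_finsetSum _ fun b _ => hint a b]
    refine Finset.sum_le_sum fun b _ => ?_
    rw [integral_const_mul, integral_radial_kernel α (by positivity)]
    have key := two_rpow_min_mul_le hα a b
    have e1 : (2 : ℝ) ^ (min (a : ℝ) b + 1) = 2 * (2 : ℝ) ^ (min (a : ℝ) b) := by
      rw [Real.rpow_add_one two_ne_zero]; ring
    have e2 : ((2 : ℝ) ^ ((b : ℝ) + 1)) ^ α = 2 ^ α * (2 : ℝ) ^ ((b : ℝ) * α) := by
      rw [← Real.rpow_mul zero_le_two, ← Real.rpow_add two_pos]; congr 1; ring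
    simp only [hK]
    rw [e1, e2]
    have h4 := mul_le_mul_of_nonneg_left key (show 0 ≤ 4 * d * 2 ^ α * radialConst d α * (M * L ^ d) *
      (ν a * ν b) by have := hν0 a; have := hν0 b; positivity)
    calc _ = 4 * d * 2 ^ α * radialConst d α * (M * L ^ d) * (ν a * ν b) *
          (2 ^ min (a : ℝ) b * 2 ^ ((b : ℝ) * α)) := by ring
      _ ≤ _ := h4
      _ = _ := by ring
  refine (Finset.sum_le_sum h3).trans ?_
  simp only [← Finset.mul_sum]
  have h5 := sum_sum_two_rpow_le (ε := (1 - α) / 2) (by linarith) F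
    fun a => (2 : ℝ) ^ ((a : ℝ) * ((1 + α) / 2)) * ν a
  have h6 := sum_dyadic_le (L := L) hα hS φ
  have h7 := h5.trans (mul_le_mul_of_nonneg_left h6 (schurConst_nonneg _))
  simp only [Finset.mul_sum] at h7 ⊢
  have h8 := mul_le_mul_of_nonneg_left h7
    (show 0 ≤ 4 * d * 2 ^ α * radialConst d α * (M * L ^ d) by positivity)
  simp only [Finset.mul_sum] at h8
  refine h8.trans_eq (Finset.sum_congr rfl fun k _ => ?_)
  ring

/-- **Commutator estimate**: for a divergence-free field with Hölder constant `M` of exponent `α`,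
`|Re ∫ (U · ∇φ) conj (Λ^{2α} φ)| ≤ C M ‖φ‖²_{H^{(1+α)/2}}`. -/
theorem abs_re_sum_transportMatrix_le (hd : 1 ≤ d) {α : ℝ} (hα : 0 < α) (hα1 : α < 1)
    {U : Fin d → Torus d L → ℝ} (hU : ∀ j, Integrable (U j))
    (hdiv : IsFourierDivFree fun j x => (U j x : ℂ)) {M : ℝ} (hM : 0 ≤ M)
    (hb : ∀ (h : Vec d) j, ∀ᵐ x, ‖increment U h j x‖ ≤ M * ‖h‖ ^ α)
    {S : Finset (Fin d → ℤ)} (hS : 0 ∉ S) (φ : (Fin d → ℤ) → ℂ) :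
    |∑ k ∈ S, ∑ l ∈ S, waveNorm L l ^ (2 * α) *
        (φ k * conj (φ l) * transportMatrix (fun j x => (U j x : ℂ)) k l).re|
      ≤ commutatorConst hd α * (M * L ^ d * ∑ k ∈ S, waveNorm L k ^ (1 + α) * ‖φ k‖ ^ 2) := by
  have h1 := integral_norm_incrementForm_le hd hα hα1 hU hdiv hM hb hS φ
  rw [integral_re_incrementForm hd hα hα1 hU hdiv, abs_mul,
    abs_of_pos (symbolConst_pos hd hα hα1)] at h1
  rw [commutatorConst, mul_assoc, ← div_eq_inv_mul, le_div_iff₀ (symbolConst_pos hd hα hα1),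
    mul_comm]
  exact h1

/-- The form of the commutator estimate used for the energy of `H^{-α}`:
`|Re ∫ (U · ∇Λ^{-2α} f) conj f| ≤ C M ‖f‖²_{H^{-(3α-1)/2}}`. -/
theorem abs_re_sum_negative_le (hd : 1 ≤ d) {α : ℝ} (hα : 0 < α) (hα1 : α < 1)
    {U : Fin d → Torus d L → ℝ} (hU : ∀ j, Integrable (U j))
    (hdiv : IsFourierDivFree fun j x => (U j x : ℂ)) {M : ℝ} (hM : 0 ≤ M)
    (hb : ∀ (h : Vec d) j, ∀ᵐ x, ‖increment U h j x‖ ≤ M * ‖h‖ ^ α)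
    (S : Finset (Fin d → ℤ)) (c : (Fin d → ℤ) → ℂ) :
    |(∑ k ∈ S, ∑ l ∈ S, ((waveNorm L k ^ (-2 * α) : ℝ) : ℂ) *
        (c k * conj (c l) * transportMatrix (fun j x => (U j x : ℂ)) k l)).re|
      ≤ commutatorConst hd α * (M * L ^ d *
        ∑ k ∈ S.erase 0, waveNorm L k ^ (1 - 3 * α) * ‖c k‖ ^ 2) := by
  -- The estimate for φ = Λ^{-2α} f without its mean. The weight of Λ^{2α} at `l` cancels the one
  -- carried by conj φ_l.
  have h1 := abs_re_sum_transportMatrix_le hd hα hα1 hU hdiv hM hb (S := S.erase 0) (by simp)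
    fun k => ((waveNorm L k ^ (-2 * α) : ℝ) : ℂ) * c k
  have hα2 : -2 * α ≠ 0 := by linarith
  have e1 : (∑ k ∈ S, ∑ l ∈ S, ((waveNorm L k ^ (-2 * α) : ℝ) : ℂ) *
        (c k * conj (c l) * transportMatrix (fun j x => (U j x : ℂ)) k l)).re =
      ∑ k ∈ S.erase 0, ∑ l ∈ S.erase 0, waveNorm L l ^ (2 * α) *
        (((waveNorm L k ^ (-2 * α) : ℝ) : ℂ) * c k *
          conj (((waveNorm L l ^ (-2 * α) : ℝ) : ℂ) * c l) *
          transportMatrix (fun j x => (U j x : ℂ)) k l).re := by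
    rw [Complex.re_sum]
    have hk0 : ∀ k, (∑ l ∈ S, ((waveNorm L k ^ (-2 * α) : ℝ) : ℂ) *
        (c k * conj (c l) * transportMatrix (fun j x => (U j x : ℂ)) k l)).re =
        ∑ l ∈ S.erase 0, waveNorm L l ^ (2 * α) *
        (((waveNorm L k ^ (-2 * α) : ℝ) : ℂ) * c k *
          conj (((waveNorm L l ^ (-2 * α) : ℝ) : ℂ) * c l) *
          transportMatrix (fun j x => (U j x : ℂ)) k l).re := by
      intro k
      rw [Complex.re_sum]
      symm
      apply Finset.sum_subset_zero_on_sdiff (Finset.erase_subset _ _)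
      · intro l hl
        have : l = 0 := by
          simp only [Finset.mem_sdiff, Finset.mem_erase, not_and] at hl
          by_contra h
          exact hl.2 h hl.1
        subst this
        -- The column l = 0 vanishes: the derivative can be moved to the frequency 0.
        rw [hdiv.transportMatrix_eq]
        simp [wave_zero]
      · intro l hl
        have hl0 := Finset.ne_of_mem_erase hl
        have hpos := waveNorm_pos (L := L) hl0
        rw [← Complex.re_ofReal_mul]
        congr 1
        simp only [map_mul, Complex.conj_ofReal]
        have e : ((waveNorm L l ^ (2 * α) : ℝ) : ℂ) * ((waveNorm L l ^ (-2 * α) : ℝ) : ℂ) = 1 := by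
          rw [← Complex.ofReal_mul, ← Real.rpow_add hpos]
          norm_num
        linear_combination (((waveNorm L k ^ (-2 * α) : ℝ) : ℂ) * c k * conj (c l) *
          transportMatrix (fun j x => (U j x : ℂ)) k l) * e
    simp_rw [hk0]
    symm
    apply Finset.sum_subset (Finset.erase_subset _ _)
    intro k hk hk'
    have : k = 0 := by
      by_contra h
      exact hk' (Finset.mem_erase.2 ⟨h, hk⟩)
    subst this
    refine Finset.sum_eq_zero fun l _ => ?_
    -- The row k = 0 vanishes because the weight `0 ^ (-2 * α)` is `0`.
    rw [waveNorm_zero, Real.zero_rpow hα2]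
    simp
  rw [e1]
  refine h1.trans_eq ?_
  congr 2
  refine Finset.sum_congr rfl fun k hk => ?_
  have hpos := waveNorm_pos (L := L) (Finset.ne_of_mem_erase hk)
  rw [norm_mul, Complex.norm_real, Real.norm_of_nonneg (Real.rpow_nonneg hpos.le _), mul_pow,
    ← mul_assoc, ← Real.rpow_natCast (waveNorm L k ^ (-2 * α)), ← Real.rpow_mul hpos.le,
    ← Real.rpow_add hpos]
  congr 2
  -- The exponents add up: (1 + α) + 2(-2α) = 1 - 3α.
  push_cast; ring

end CommutatorEstimate

end VectorMixing

end

noncomputable section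

namespace VectorMixing

open scoped ComplexConjugate

/-! ### Characters as test functions -/

section SmoothCharacters

variable {d : ℕ} {L : ℝ}

lemma character_add_single (k : Fin d → ℤ) (x : Torus d L) (j : Fin d) (s : ℝ) :
    character k (x + Pi.single j (s : AddCircle L))
      = character k x * Complex.exp (Complex.I * wave L k j * s) := by
  have h1 : (Pi.single j (s : AddCircle L) : Torus d L) = toTorus L (Pi.single j s) := by
    ext i
    rcases eq_or_ne i j with rfl | h
    · simp [toTorus]
    · simp [toTorus, Pi.single_eq_of_ne h]
  rw [character_add, h1, character_toTorus]
  congr 2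
  rw [Finset.sum_eq_single j]
  · simp; ring
  · intro i _ hi
    rw [Pi.single_eq_of_ne hi, mul_zero]
  · simp

lemma hasDerivAt_character (k : Fin d → ℤ) (x : Torus d L) (j : Fin d) :
    HasDerivAt (fun s : ℝ => character k (x + Pi.single j (s : AddCircle L)))
      (Complex.I * wave L k j * character k x) 0 := by
  simp_rw [character_add_single]
  have h1 : HasDerivAt (fun s : ℝ => Complex.I * wave L k j * (s : ℂ)) (Complex.I * wave L k j) 0 := by
    simpa using (Complex.ofRealCLM.hasDerivAt (x := (0 : ℝ))).const_mul (Complex.I * wave L k j)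
  have h2 := h1.cexp.const_mul (character k x)
  refine h2.congr_deriv ?_
  simp
  ring

lemma partialDeriv_re_character (k : Fin d → ℤ) (j : Fin d) (x : Torus d L) :
    partialDeriv j (fun x => (character k x).re) x = (Complex.I * wave L k j * character k x).re :=
  (Complex.reCLM.hasFDerivAt.comp_hasDerivAt (0 : ℝ) (hasDerivAt_character k x j)).deriv

lemma partialDeriv_im_character (k : Fin d → ℤ) (j : Fin d) (x : Torus d L) :
    partialDeriv j (fun x => (character k x).im) x = (Complex.I * wave L k j * character k x).im :=
  (Complex.imCLM.hasFDerivAt.comp_hasDerivAt (0 : ℝ) (hasDerivAt_character k x j)).deriv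

lemma contDiff_character (k : Fin d → ℤ) :
    ContDiff ℝ ∞ fun y : Fin d → ℝ => character k (fun i => (y i : AddCircle L)) := by
  have : (fun y : Fin d → ℝ => character k (fun i => (y i : AddCircle L))) = fun y =>
      Complex.exp (Complex.I * ((∑ j, wave L k j * y j : ℝ) : ℂ)) :=
    funext fun y => character_toTorus k y
  rw [this]
  have h : ContDiff ℝ ∞ fun y : Fin d → ℝ => ∑ j, wave L k j * y j :=
    ContDiff.sum fun j _ => by fun_prop
  exact ContDiff.cexp (contDiff_const.mul (Complex.ofRealCLM.contDiff.comp h))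

lemma isSmooth_re_character (k : Fin d → ℤ) : IsSmooth fun x : Torus d L => (character k x).re :=
  Complex.reCLM.contDiff.comp (contDiff_character k)

lemma isSmooth_im_character (k : Fin d → ℤ) : IsSmooth fun x : Torus d L => (character k x).im :=
  Complex.imCLM.contDiff.comp (contDiff_character k)

end SmoothCharacters

/-! ### Sobolev fields: Fourier coefficients, Hölder and sup bounds -/

section SobolevFields

variable {d : ℕ} {L : ℝ} [hL : Fact (0 < L)]

lemma integrable_component {V : Torus d L → Vec d} (hV : Integrable V) (i : Fin d) :
    Integrable fun x => V x i :=
  hV.mono ((PiLp.continuous_apply 2 _ i).comp_aestronglyMeasurable hV.1)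
    (ae_of_all _ fun x => PiLp.norm_apply_le (V x) i)

lemma integral_component {V : Torus d L → Vec d} (hV : Integrable V) (i : Fin d) :
    (∫ x, V x) i = ∫ x, V x i := by
  have := (EuclideanSpace.proj (𝕜 := ℝ) (ι := Fin d) i).integral_comp_comm hV
  simpa using this.symm

lemma eLpNorm_component_le (V : Torus d L → Vec d) (i : Fin d) (q : ℝ≥0∞) :
    eLpNorm (fun x => ((V x i : ℝ) : ℂ)) q ≤ eLpNorm V q := by
  refine eLpNorm_mono fun x => ?_
  rw [Complex.norm_real]
  exact PiLp.norm_apply_le (V x) i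

lemma integrable_re_character (k : Fin d → ℤ) {f : Torus d L → ℝ} (hf : Integrable f) :
    Integrable fun x => (character k x).re * f x :=
  hf.bdd_mul (c := 1)
    (Complex.continuous_re.comp (continuous_character k)).aestronglyMeasurable
    (ae_of_all _ fun x => (Complex.abs_re_le_norm _).trans (norm_character k x).le)

lemma integrable_im_character (k : Fin d → ℤ) {f : Torus d L → ℝ} (hf : Integrable f) :
    Integrable fun x => (character k x).im * f x :=
  hf.bdd_mul (c := 1)
    (Complex.continuous_im.comp (continuous_character k)).aestronglyMeasurable
    (ae_of_all _ fun x => (Complex.abs_im_le_norm _).trans (norm_character k x).le)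

lemma integral_character_mul_ofReal (k : Fin d → ℤ) {f : Torus d L → ℝ} (hf : Integrable f) :
    ∫ x, (f x : ℂ) * character k x
      = ((∫ x, (character k x).re * f x : ℝ) : ℂ) + ((∫ x, (character k x).im * f x : ℝ) : ℂ) *
        Complex.I := by
  have hc : Integrable fun x => (f x : ℂ) := hf.ofReal
  have h := integral_re_add_im (integrable_mul_character hc k)
  rw [← h]
  simp only [RCLike.re_eq_complex_re, RCLike.im_eq_complex_im, RCLike.I_to_complex,
    Complex.re_ofReal_mul, Complex.im_ofReal_mul, Complex.coe_algebraMap, mul_comm (f _)]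

/-- The definition of the weak gradient is tested with the real and imaginary parts of the character
of frequency -k, and the two identities are recombined. -/
lemma IsWeakGradient.cCoeff_eq {V : Torus d L → Vec d} {G : Fin d → Torus d L → Vec d}
    (h : IsWeakGradient V G) (i j : Fin d) (k : Fin d → ℤ) :
    cCoeff (fun x => ((G j x i : ℝ) : ℂ)) k
      = Complex.I * wave L k j * cCoeff (fun x => ((V x i : ℝ) : ℂ)) k := by
  obtain ⟨hV, hG⟩ := h
  obtain ⟨hGj, hw⟩ := hG j
  have hVi := integrable_component hV i
  have hGi := integrable_component hGj i
  have hre := hw _ (isSmooth_re_character (-k))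
  have him := hw _ (isSmooth_im_character (-k))
  simp only [partialDeriv_re_character, partialDeriv_im_character] at hre him
  have e1 : ∀ x : Torus d L, (Complex.I * wave L (-k) j * character (-k) x).re
      = wave L k j * (character (-k) x).im := by
    intro x; simp [wave_neg]
  have e2 : ∀ x : Torus d L, (Complex.I * wave L (-k) j * character (-k) x).im
      = -wave L k j * (character (-k) x).re := by
    intro x; simp [wave_neg]
  simp only [e1, e2] at hre him
  have cre : wave L k j * ∫ x, (character (-k) x).im * V x i
      = -∫ x, (character (-k) x).re * G j x i := by
    have := congrArg (fun v : Vec d => v i) hre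
    simp only [PiLp.neg_apply] at this
    rw [integral_component, integral_component] at this
    · simp only [PiLp.smul_apply, smul_eq_mul, mul_assoc, integral_const_mul] at this
      exact this
    · exact hGj.bdd_smul 1
        (Complex.continuous_re.comp (continuous_character (-k))).aestronglyMeasurable
        (ae_of_all _ fun x => (Complex.abs_re_le_norm _).trans (norm_character (-k) x).le)
    · exact hV.bdd_smul |wave L k j|
        (continuous_const.mul
          (Complex.continuous_im.comp (continuous_character (-k)))).aestronglyMeasurable
        (ae_of_all _ fun x => by
          rw [Pi.mul_apply, norm_mul, Real.norm_eq_abs]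
          exact mul_le_of_le_one_right (abs_nonneg _)
            ((Complex.abs_im_le_norm _).trans (norm_character (-k) x).le))
  have cim : -wave L k j * ∫ x, (character (-k) x).re * V x i
      = -∫ x, (character (-k) x).im * G j x i := by
    have := congrArg (fun v : Vec d => v i) him
    simp only [PiLp.neg_apply] at this
    rw [integral_component, integral_component] at this
    · simp only [PiLp.smul_apply, smul_eq_mul, mul_assoc, integral_const_mul] at this
      exact this
    · exact hGj.bdd_smul 1
        (Complex.continuous_im.comp (continuous_character (-k))).aestronglyMeasurable
        (ae_of_all _ fun x => (Complex.abs_im_le_norm _).trans (norm_character (-k) x).le)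
    · exact hV.bdd_smul |wave L k j|
        (continuous_const.mul
          (Complex.continuous_re.comp (continuous_character (-k)))).aestronglyMeasurable
        (ae_of_all _ fun x => by
          rw [Pi.mul_apply, norm_mul, norm_neg, Real.norm_eq_abs]
          exact mul_le_of_le_one_right (abs_nonneg _)
            ((Complex.abs_re_le_norm _).trans (norm_character (-k) x).le))
  unfold cCoeff
  rw [integral_character_mul_ofReal _ hVi, integral_character_mul_ofReal _ hGi]
  have cre' := congrArg (fun r : ℝ => (r : ℂ)) cre
  have cim' := congrArg (fun r : ℝ => (r : ℂ)) cim
  push_cast at cre' cim'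
  linear_combination (((L : ℂ) ^ d)⁻¹) * (cre' + Complex.I * cim' -
    (wave L k j : ℂ) * ((∫ x, (character (-k) x).im * V x i : ℝ) : ℂ) * Complex.I_mul_I)

/-- Again tested with the real and imaginary parts of a character. -/
lemma IsDivFree.isFourierDivFree {V : Torus d L → Vec d} (h : IsDivFree V) (hV : Integrable V) :
    IsFourierDivFree fun j x => ((V x j : ℝ) : ℂ) := by
  intro k
  have hre := h _ (isSmooth_re_character (-k))
  have him := h _ (isSmooth_im_character (-k))
  simp only [partialDeriv_re_character, partialDeriv_im_character] at hre him
  have e1 : ∀ x (j : Fin d), V x j * (Complex.I * wave L (-k) j * character (-k) x).re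
      = wave L k j * ((character (-k) x).im * V x j) := by
    intro x j; simp [wave_neg]; ring
  have e2 : ∀ x (j : Fin d), V x j * (Complex.I * wave L (-k) j * character (-k) x).im
      = -wave L k j * ((character (-k) x).re * V x j) := by
    intro x j; simp [wave_neg]; ring
  simp only [e1, e2] at hre him
  rw [integral_finsetSum _ fun j _ =>
    (integrable_im_character _ (integrable_component hV j)).const_mul _] at hre
  rw [integral_finsetSum _ fun j _ =>
    (integrable_re_character _ (integrable_component hV j)).const_mul _] at him
  simp only [integral_const_mul] at hre him
  simp only [neg_mul, Finset.sum_neg_distrib, neg_eq_zero] at him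
  simp only [cCoeff, integral_character_mul_ofReal _ (integrable_component hV _)]
  have hre' := congrArg (fun r : ℝ => (r : ℂ)) hre
  have him' := congrArg (fun r : ℝ => (r : ℂ)) him
  push_cast at hre' him'
  calc ∑ j, (wave L k j : ℂ) * (((L : ℂ) ^ d)⁻¹ *
        (((∫ x, (character (-k) x).re * V x j : ℝ) : ℂ) +
        ((∫ x, (character (-k) x).im * V x j : ℝ) : ℂ) * Complex.I))
      = ((L : ℂ) ^ d)⁻¹ * ((∑ j, (wave L k j : ℂ) * ((∫ x, (character (-k) x).re * V x j : ℝ) : ℂ)) +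
        (∑ j, (wave L k j : ℂ) * ((∫ x, (character (-k) x).im * V x j : ℝ) : ℂ)) * Complex.I) := by
        rw [Finset.sum_mul, ← Finset.sum_add_distrib, Finset.mul_sum]
        refine Finset.sum_congr rfl fun j _ => ?_
        ring
    _ = 0 := by push_cast; rw [hre', him']; simp

/-- Supplies the Borel representatives that the averages along rays and over cubes require. -/
lemma exists_hasSobolevBound {V : Torus d L → Vec d} {G : Fin d → Torus d L → Vec d}
    (h : IsWeakGradient V G) {q : ℝ≥0∞} {A : ℝ} (hA : 0 ≤ A)
    (hb : eLpNorm V q + ∑ j, eLpNorm (G j) q ≤ ENNReal.ofReal A) (i : Fin d) :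
    ∃ f g, HasSobolevBound q A f g ∧ f =ᵐ[volume] fun x => ((V x i : ℝ) : ℂ) := by
  have hV : AEMeasurable fun x => ((V x i : ℝ) : ℂ) :=
    ((integrable_component h.1 i).ofReal (𝕜 := ℂ)).1.aemeasurable
  have hG : ∀ j, AEMeasurable fun x => ((G j x i : ℝ) : ℂ) := fun j =>
    ((integrable_component (h.2 j).1 i).ofReal (𝕜 := ℂ)).1.aemeasurable
  refine ⟨hV.mk _, fun j => (hG j).mk _, ⟨hV.measurable_mk, fun j => (hG j).measurable_mk, ?_, hA, ?_⟩,
    hV.ae_eq_mk.symm⟩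
  · intro j k
    rw [← cCoeff_congr_ae hV.ae_eq_mk, ← cCoeff_congr_ae (hG j).ae_eq_mk]
    exact h.cCoeff_eq i j k
  · refine le_trans ?_ hb
    rw [eLpNorm_congr_ae hV.ae_eq_mk.symm]
    refine add_le_add (eLpNorm_component_le V i q) (Finset.sum_le_sum fun j _ => ?_)
    rw [eLpNorm_congr_ae (hG j).ae_eq_mk.symm]
    exact eLpNorm_component_le (G j) i q

lemma exists_isWeakGradient_of_sobolevNorm_lt {V : Torus d L → Vec d} {q B : ℝ≥0∞}
    (h : sobolevNorm q V < B) :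
    ∃ G, IsWeakGradient V G ∧ eLpNorm V q + ∑ j, eLpNorm (G j) q < B := by
  simp only [sobolevNorm, iInf_lt_iff] at h
  obtain ⟨G, hG, hlt⟩ := h
  exact ⟨G, hG, hlt⟩

lemma integrable_of_sobolevNorm_lt_top {V : Torus d L → Vec d} {q : ℝ≥0∞}
    (h : sobolevNorm q V < ⊤) : Integrable V :=
  let ⟨_, hG, _⟩ := exists_isWeakGradient_of_sobolevNorm_lt h
  hG.1

lemma eLpNorm_le_sobolevNorm (V : Torus d L → Vec d) (q : ℝ≥0∞) :
    eLpNorm V q ≤ sobolevNorm q V :=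
  le_iInf₂ fun _ _ => le_self_add

lemma norm_ofLp_le (h : Vec d) : ‖h.ofLp‖ ≤ ‖h‖ := by
  rw [pi_norm_le_iff_of_nonneg (norm_nonneg _)]
  exact fun i => PiLp.norm_apply_le h i

/-- Hölder continuity of Sobolev fields. -/
theorem ae_norm_increment_le {V : Torus d L → Vec d} {q : ℝ≥0∞} (hq2 : 2 ≤ q) {α : ℝ} (hα : 0 < α)
    (hq : d / q.toReal ≤ 1 - α) {A : ℝ} (hA : 0 ≤ A) (hV : sobolevNorm q V ≤ ENNReal.ofReal A)
    (h : Vec d) (i : Fin d) :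
    ∀ᵐ x, ‖increment (fun j x => V x j) h i x‖ ≤ (2 / α + 2) * A * ‖h‖ ^ α := by
  -- `sobolevNorm` is an infimum, so a weak gradient is only provided with norm below A + 1/(n+1).
  -- The loss disappears as n → ∞.
  have key : ∀ n : ℕ, ∀ᵐ x, ‖increment (fun j x => V x j) h i x‖
      ≤ (2 / α + 2) * (A + 1 / (n + 1)) * ‖h‖ ^ α := by
    intro n
    have hn : (0 : ℝ) < 1 / (n + 1) := by positivity
    obtain ⟨G, hG, hlt⟩ := exists_isWeakGradient_of_sobolevNorm_lt
      (hV.trans_lt ((ENNReal.ofReal_lt_ofReal_iff (by linarith)).2 (lt_add_of_pos_right A hn)))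
    obtain ⟨f, g, H, hf⟩ := exists_hasSobolevBound hG (by linarith) hlt.le i
    filter_upwards [H.ae_norm_translate_sub_le hq2 hα hq h.ofLp, hf,
      ae_translate hf (toTorus L h.ofLp)] with x hx h1 h2
    rw [h1, h2] at hx
    refine hx.trans ?_
    gcongr
    exact norm_ofLp_le h
  rw [← ae_all_iff] at key
  filter_upwards [key] with x hx
  have hlim : Tendsto (fun n : ℕ => (2 / α + 2) * (A + 1 / ((n : ℝ) + 1)) * ‖h‖ ^ α) atTop
      (𝓝 ((2 / α + 2) * (A + 0) * ‖h‖ ^ α)) :=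
    ((tendsto_one_div_add_atTop_nhds_zero_nat.const_add A).const_mul _).mul_const _
  rw [add_zero] at hlim
  exact ge_of_tendsto' hlim hx

/-- Sobolev fields are bounded, with a bound depending on the side length. -/
theorem ae_norm_component_le {V : Torus d L → Vec d} {q : ℝ≥0∞} (hq2 : 2 ≤ q) {α : ℝ} (hα : 0 < α)
    (hq : d / q.toReal ≤ 1 - α) {A : ℝ} (hA : 0 ≤ A) (hV : sobolevNorm q V ≤ ENNReal.ofReal A)
    (i : Fin d) :
    ∀ᵐ x, ‖((V x i : ℝ) : ℂ)‖ ≤ (min 1 L ^ α / α + min 1 L ^ (α - 1)) * (A + 1) := by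
  -- Here a slack of 1 is kept: only the existence of some bound matters.
  obtain ⟨G, hG, hlt⟩ := exists_isWeakGradient_of_sobolevNorm_lt
    (hV.trans_lt ((ENNReal.ofReal_lt_ofReal_iff (by linarith)).2 (lt_add_one A)))
  obtain ⟨f, g, H, hf⟩ := exists_hasSobolevBound hG (by linarith) hlt.le i
  filter_upwards [H.ae_norm_le hq2 hα hq (lt_min one_pos hL.out) (min_le_left _ _) (min_le_right _ _),
    hf] with x hx h1
  rwa [h1] at hx

end SobolevFields

end VectorMixing

end

noncomputable section

namespace VectorMixing

open scoped ComplexConjugate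

/-! ### Interpolation, a nonlinear Gronwall inequality, absolutely continuous functions -/

section RealAnalysis

/-- Interpolation between `L²` and `H^{-α}`, in terms of coefficients. -/
lemma sum_rpow_mul_le {ι : Type*} (S : Finset ι) {α : ℝ} (hα : 1 / 2 ≤ α) (hα1 : α < 1)
    {κ a : ι → ℝ} (hκ : ∀ k ∈ S, 0 < κ k) (ha : ∀ k ∈ S, 0 ≤ a k) :
    ∑ k ∈ S, κ k ^ (1 - 3 * α) * a k ≤ (∑ k ∈ S, a k) ^ ((1 - α) / α / 2) *
      (∑ k ∈ S, κ k ^ (-2 * α) * a k) ^ (1 - (1 - α) / α / 2) := by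
  have hα0 : 0 < α := by linarith
  -- Chosen so that -2α(1 - σ) = 1 - 3α. The claim is then Hölder's inequality with exponents 1/σ
  -- and 1/(1 - σ).
  set σ := (1 - α) / α / 2 with hσ
  have hσ0 : 0 < σ := div_pos (div_pos (by linarith) hα0) two_pos
  have hσ1 : σ < 1 := by
    have : (1 - α) / α ≤ 1 := by rw [div_le_one hα0]; linarith
    linarith
  have hconj : (1 / σ).HolderConjugate (1 / (1 - σ)) := by
    rw [Real.holderConjugate_iff]
    refine ⟨by rw [lt_div_iff₀ hσ0]; linarith, ?_⟩
    simp
  have key := Real.inner_le_Lp_mul_Lq S (fun k => a k ^ σ)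
    (fun k => (κ k ^ (-2 * α) * a k) ^ (1 - σ)) hconj
  have hb : ∀ k ∈ S, 0 ≤ κ k ^ (-2 * α) * a k := fun k hk =>
    mul_nonneg (Real.rpow_nonneg (hκ k hk).le _) (ha k hk)
  have e1 : ∀ k ∈ S, |a k ^ σ| ^ (1 / σ) = a k := by
    intro k hk
    rw [abs_of_nonneg (Real.rpow_nonneg (ha k hk) _), ← Real.rpow_mul (ha k hk),
      mul_one_div_cancel hσ0.ne', Real.rpow_one]
  have e2 : ∀ k ∈ S, |(κ k ^ (-2 * α) * a k) ^ (1 - σ)| ^ (1 / (1 - σ)) = κ k ^ (-2 * α) * a k := by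
    intro k hk
    rw [abs_of_nonneg (Real.rpow_nonneg (hb k hk) _), ← Real.rpow_mul (hb k hk),
      mul_one_div_cancel (by linarith), Real.rpow_one]
  rw [Finset.sum_congr rfl e1, Finset.sum_congr rfl e2, one_div_one_div, one_div_one_div] at key
  refine le_trans (le_of_eq (Finset.sum_congr rfl fun k hk => ?_)) key
  rw [Real.mul_rpow (Real.rpow_nonneg (hκ k hk).le _) (ha k hk), ← Real.rpow_mul (hκ k hk).le,
    mul_left_comm, ← Real.rpow_add_of_nonneg (ha k hk) hσ0.le (by linarith)]
  rw [add_sub_cancel, Real.rpow_one]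
  congr 2
  rw [hσ]
  field_simp
  ring

/-- A nonlinear Gronwall inequality. -/
lemma rpow_sub_mul_le_of_integral_le {E : ℝ → ℝ} (hE : ContinuousOn E (Ici 0))
    (hE0 : ∀ t, 0 ≤ t → 0 ≤ E t) {σ K : ℝ} (hσ : 0 < σ) (hσ1 : σ < 1) (hK : 0 ≤ K)
    (h : ∀ s t, 0 ≤ s → s ≤ t → E s - E t ≤ ∫ r in s..t, 2 * K * E r ^ (1 - σ))
    {t : ℝ} (ht : 0 ≤ t) :
    E 0 ^ σ - 2 * σ * K * t ≤ E t ^ σ := by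
  have hcont : ContinuousOn (fun r => 2 * K * E r ^ (1 - σ)) (Ici 0) :=
    continuousOn_const.mul (hE.rpow_const fun x _ => Or.inr (by linarith))
  -- -E^σ is compared with a line of slope 2σK through right difference quotients, since `E` is only
  -- known to be continuous.
  have main := image_le_of_liminf_slope_right_le_deriv_boundary (a := 0) (b := t)
    (f := fun x => -(E x ^ σ)) (B := fun x => -(E 0 ^ σ) + 2 * σ * K * x)
    (B' := fun _ => 2 * σ * K)
    (((hE.rpow_const fun x _ => Or.inr hσ.le).neg).mono Icc_subset_Ici_self) (by simp)
    (by fun_prop)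
    (fun x _ => by
      have := ((hasDerivAt_id x).const_mul (2 * σ * K)).const_add (-(E 0 ^ σ))
      simpa using this.hasDerivWithinAt)
    (by
      intro x hx r hr
      have hx0 : 0 ≤ x := hx.1
      apply Eventually.frequently
      rcases (hE0 x hx0).eq_or_lt with h0 | hpos
      -- Where `E` vanishes, the function -E^σ is at its maximum 0, so its slopes to the right are
      -- not positive.
      · filter_upwards [self_mem_nhdsWithin] with z hz
        rw [slope_def_field, ← h0, Real.zero_rpow hσ.ne']
        have hz' : x < z := hz
        refine lt_of_le_of_lt ?_ (lt_of_le_of_lt (by positivity) hr)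
        apply div_nonpos_of_nonpos_of_nonneg _ (by linarith)
        have := Real.rpow_nonneg (hE0 z (hx0.trans hz'.le)) σ
        linarith
      -- `Φ` touches `E` from below at `x` and has a right derivative there. The slopes of -E^σ are
      -- therefore at most those of -Φ^σ, whose right derivative at `x` is 2σK.
      · set Φ : ℝ → ℝ := fun z => E x - ∫ r in x..z, 2 * K * E r ^ (1 - σ) with hΦ
        have hΦx : Φ x = E x := by simp [hΦ]
        have hint : HasDerivWithinAt (fun z => ∫ r in x..z, 2 * K * E r ^ (1 - σ))
            (2 * K * E x ^ (1 - σ)) (Ioi x) x := by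
          refine HasDerivWithinAt.mono (t := Ici x) ?_ Ioi_subset_Ici_self
          refine intervalIntegral.integral_hasDerivWithinAt_right (t := Ioi x) (by simp) ?_ ?_
          · refine ⟨Ioi x, self_mem_nhdsWithin, ?_⟩
            exact (hcont.mono (fun y hy => hx0.trans (le_of_lt hy))).aestronglyMeasurable measurableSet_Ioi
          · exact (hcont x hx0).mono (fun y hy => hx0.trans (le_of_lt hy))
        have hΦd : HasDerivWithinAt Φ (-(2 * K * E x ^ (1 - σ))) (Ioi x) x := by
          exact hint.const_sub (E x)
        have hder : HasDerivWithinAt (fun z => -(Φ z ^ σ)) (2 * σ * K) (Ioi x) x := by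
          have h1 := (hΦd.rpow_const (p := σ) (Or.inl (by rw [hΦx]; exact hpos.ne'))).neg
          refine h1.congr_deriv ?_
          rw [hΦx]
          have : E x ^ (1 - σ) * E x ^ (σ - 1) = 1 := by
            rw [← Real.rpow_add hpos]; norm_num
          linear_combination (2 * σ * K) * this
        have hev : ∀ᶠ z in 𝓝[>] x, slope (fun z => -(Φ z ^ σ)) x z < r := by
          have := hasDerivWithinAt_iff_tendsto_slope.1 hder
          rw [Set.sdiff_singleton_eq_self (by simp)] at this
          exact this.eventually_lt_const hr
        have hΦpos : ∀ᶠ z in 𝓝[>] x, 0 < Φ z := by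
          have := hΦd.continuousWithinAt.eventually_const_lt (u := 0) (by rw [hΦx]; exact hpos)
          exact this
        filter_upwards [hev, hΦpos, self_mem_nhdsWithin] with z h1 h2 h3
        have hz' : x < z := h3
        refine lt_of_le_of_lt ?_ h1
        rw [slope_def_field, slope_def_field, hΦx]
        have : Φ z ≤ E z := by
          have := h x z hx0 hz'.le
          simp only [hΦ]; linarith
        have := Real.rpow_le_rpow h2.le this hσ.le
        apply div_le_div_of_nonneg_right _ (by linarith)
        linarith)
    (x := t) ⟨ht, le_rfl⟩
  linarith

/-- As `g` is merely integrable, `f` is absolutely continuous and no better. The product rule is the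
one for absolutely continuous functions. -/
lemma sq_sub_sq_eq_integral {f g : ℝ → ℝ} {f₀ : ℝ}
    (hg : ∀ t, 0 ≤ t → IntervalIntegrable g volume 0 t)
    (hf : ∀ t, 0 ≤ t → f t = f₀ - ∫ s in (0 : ℝ)..t, g s) {s t : ℝ} (hs : 0 ≤ s) (hst : s ≤ t) :
    f t ^ 2 - f s ^ 2 = ∫ r in s..t, -(2 * (f r * g r)) := by
  have ht : 0 ≤ t := hs.trans hst
  set F : ℝ → ℝ := fun x => f₀ - ∫ s in (0 : ℝ)..x, g s with hF
  have hac : AbsolutelyContinuousOnInterval F 0 t :=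
    (contDiff_const (n := 1)).contDiffOn.absolutelyContinuousOnInterval.sub
      ((hg t ht).absolutelyContinuousOnInterval_intervalIntegral (c := 0) (by simp))
  have hac' : AbsolutelyContinuousOnInterval F s t := by
    refine hac.mono ?_
    rw [uIcc_of_le hst, uIcc_of_le ht]
    exact Icc_subset_Icc_left hs
  have h1 := hac'.integral_deriv_mul_eq_sub hac'
  rw [hf t ht, hf s hs, sq, sq, ← h1]
  refine intervalIntegral.integral_congr_ae ?_
  filter_upwards [(hg t ht).ae_hasDerivAt_integral] with x hx hxs
  rw [uIoc_of_le hst] at hxs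
  have hx0 : 0 ≤ x := hs.trans hxs.1.le
  have hd := (hx (by rw [uIcc_of_le ht]; exact ⟨hx0, hxs.2⟩) 0 (by simp)).const_sub f₀
  have hFx : F x = f x := (hf x hx0).symm
  rw [hd.deriv, hFx]
  ring

/-- Derivative of the modulus squared of a complex function given by an integral. -/
lemma norm_sq_sub_norm_sq_eq_integral {f g : ℝ → ℂ} {f₀ : ℂ}
    (hg : ∀ t, 0 ≤ t → IntervalIntegrable g volume 0 t)
    (hf : ∀ t, 0 ≤ t → f t = f₀ - ∫ s in (0 : ℝ)..t, g s) {s t : ℝ} (hs : 0 ≤ s) (hst : s ≤ t) :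
    ‖f t‖ ^ 2 - ‖f s‖ ^ 2 = ∫ r in s..t, -(2 * (g r * conj (f r)).re) := by
  have ht : 0 ≤ t := hs.trans hst
  have hre : ∀ t, 0 ≤ t → IntervalIntegrable (fun s => (g s).re) volume 0 t := fun t ht =>
    ⟨(hg t ht).1.re, (hg t ht).2.re⟩
  have him : ∀ t, 0 ≤ t → IntervalIntegrable (fun s => (g s).im) volume 0 t := fun t ht =>
    ⟨(hg t ht).1.im, (hg t ht).2.im⟩
  have fre : ∀ t, 0 ≤ t → (f t).re = f₀.re - ∫ s in (0 : ℝ)..t, (g s).re := by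
    intro t ht
    rw [hf t ht, Complex.sub_re]
    congr 1
    exact (Complex.reCLM.intervalIntegral_comp_comm (hg t ht)).symm
  have fim : ∀ t, 0 ≤ t → (f t).im = f₀.im - ∫ s in (0 : ℝ)..t, (g s).im := by
    intro t ht
    rw [hf t ht, Complex.sub_im]
    congr 1
    exact (Complex.imCLM.intervalIntegral_comp_comm (hg t ht)).symm
  have h1 := sq_sub_sq_eq_integral hre fre hs hst
  have h2 := sq_sub_sq_eq_integral him fim hs hst
  have hcf : ∀ (F : ℝ → ℝ) (G : ℝ → ℝ) (F₀ : ℝ), (∀ t, 0 ≤ t → IntervalIntegrable G volume 0 t) →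
      (∀ t, 0 ≤ t → F t = F₀ - ∫ s in (0 : ℝ)..t, G s) →
      IntervalIntegrable (fun r => -(2 * (F r * G r))) volume s t := by
    intro F G F₀ hG hF
    have hGst : IntervalIntegrable G volume s t := (hG t ht).mono_set (by
      rw [uIcc_of_le hst, uIcc_of_le ht]; exact Icc_subset_Icc_left hs)
    refine ((hGst.continuousOn_mul ?_).const_mul 2).neg
    have : ContinuousOn (fun x => F₀ - ∫ s in (0 : ℝ)..x, G s) (uIcc s t) := by
      refine continuousOn_const.sub ?_
      refine (intervalIntegral.continuousOn_primitive_interval' (hG t ht) (by simp)).mono ?_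
      rw [uIcc_of_le hst, uIcc_of_le ht]; exact Icc_subset_Icc_left hs
    refine this.congr fun x hx => hF x ?_
    rw [uIcc_of_le hst] at hx
    exact hs.trans hx.1
  have e : ∀ z : ℂ, ‖z‖ ^ 2 = z.re ^ 2 + z.im ^ 2 := by
    intro z
    rw [← Complex.normSq_eq_norm_sq, Complex.normSq_apply]; ring
  rw [e, e]
  have h3 := intervalIntegral.integral_add (hcf _ _ _ hre fre) (hcf _ _ _ him fim)
  calc (f t).re ^ 2 + (f t).im ^ 2 - ((f s).re ^ 2 + (f s).im ^ 2)
      = ((f t).re ^ 2 - (f s).re ^ 2) + ((f t).im ^ 2 - (f s).im ^ 2) := by ring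
    _ = _ := by
      rw [h1, h2, ← h3]
      refine intervalIntegral.integral_congr fun r _ => ?_
      simp only [Complex.mul_re, Complex.conj_re, Complex.conj_im]
      ring

end RealAnalysis

end VectorMixing

end

noncomputable section

namespace VectorMixing

open scoped ComplexConjugate

/-! ### Integration by parts on the torus -/

section IntegrationByParts

variable {d : ℕ} {L : ℝ}

lemma isOpenQuotientMap_toTorus : IsOpenQuotientMap (toTorus L : (Fin d → ℝ) → Torus d L) :=
  IsOpenQuotientMap.piMap fun _ => QuotientAddGroup.isOpenQuotientMap_mk

lemma single_eq_toTorus (j : Fin d) (s : ℝ) :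
    (Pi.single j (s : AddCircle L) : Torus d L) = toTorus L (s • Pi.single j 1) := by
  ext i
  rcases eq_or_ne i j with rfl | h
  · simp [toTorus]
  · simp [toTorus, Pi.single_eq_of_ne h]

lemma IsSmooth.hasDerivAt {ψ : Torus d L → ℝ} (hψ : IsSmooth ψ) (j : Fin d) (y : Fin d → ℝ)
    (s : ℝ) :
    HasDerivAt (fun s : ℝ => ψ (toTorus L y + Pi.single j (s : AddCircle L)))
      (fderiv ℝ (fun y : Fin d → ℝ => ψ (toTorus L y)) (y + s • Pi.single j 1)
        (Pi.single j 1)) s := by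
  have h1 : DifferentiableAt ℝ (fun y : Fin d → ℝ => ψ (toTorus L y)) (y + s • Pi.single j 1) :=
    (ContDiff.differentiable hψ (by simp)).differentiableAt
  have h2 : HasDerivAt (fun s : ℝ => y + s • (Pi.single j 1 : Fin d → ℝ)) (Pi.single j 1) s := by
    simpa using ((hasDerivAt_id s).smul_const (Pi.single j 1 : Fin d → ℝ)).const_add y
  have h3 := h1.hasFDerivAt.comp_hasDerivAt s h2
  refine h3.congr_of_eventuallyEq (Eventually.of_forall fun r => ?_)
  simp only [Function.comp_apply, toTorus_add, single_eq_toTorus]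

lemma IsSmooth.partialDeriv_toTorus {ψ : Torus d L → ℝ} (hψ : IsSmooth ψ) (j : Fin d)
    (y : Fin d → ℝ) :
    partialDeriv j ψ (toTorus L y)
      = fderiv ℝ (fun y : Fin d → ℝ => ψ (toTorus L y)) y (Pi.single j 1) := by
  rw [partialDeriv, (hψ.hasDerivAt j y 0).deriv]
  simp

lemma IsSmooth.continuous {ψ : Torus d L → ℝ} (hψ : IsSmooth ψ) : Continuous ψ := by
  rw [isOpenQuotientMap_toTorus.isQuotientMap.continuous_iff]
  exact ContDiff.continuous hψ

lemma IsSmooth.continuous_partialDeriv {ψ : Torus d L → ℝ} (hψ : IsSmooth ψ) (j : Fin d) :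
    Continuous (partialDeriv j ψ) := by
  rw [isOpenQuotientMap_toTorus.isQuotientMap.continuous_iff]
  have : partialDeriv j ψ ∘ toTorus L = fun y : Fin d → ℝ =>
      fderiv ℝ (fun y : Fin d → ℝ => ψ (toTorus L y)) y (Pi.single j 1) :=
    funext fun y => hψ.partialDeriv_toTorus j y
  rw [this]
  exact (ContDiff.continuous_fderiv hψ (by simp)).clm_apply continuous_const

lemma IsSmooth.hasDerivAt_shift {ψ : Torus d L → ℝ} (hψ : IsSmooth ψ) (j : Fin d) (x : Torus d L)
    (s : ℝ) :
    HasDerivAt (fun s : ℝ => ψ (x + Pi.single j (s : AddCircle L)))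
      (partialDeriv j ψ (x + Pi.single j (s : AddCircle L))) s := by
  obtain ⟨y, rfl⟩ := isOpenQuotientMap_toTorus.surjective x
  have := hψ.hasDerivAt j y s
  rwa [← hψ.partialDeriv_toTorus, toTorus_add, ← single_eq_toTorus] at this

variable [hL : Fact (0 < L)]

lemma exists_bound_of_continuous {ψ : Torus d L → ℝ} (hψ : Continuous ψ) :
    ∃ B, ∀ x, ‖ψ x‖ ≤ B := by
  obtain ⟨C, hC⟩ := (isCompact_range hψ).isBounded.exists_norm_le
  exact ⟨C, fun x => hC _ ⟨x, rfl⟩⟩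

lemma integrable_of_continuous_real {f : Torus d L → ℝ} (hf : Continuous f) : Integrable f := by
  obtain ⟨B, hB⟩ := exists_bound_of_continuous hf
  exact Integrable.of_bound hf.aestronglyMeasurable B (ae_of_all _ hB)

lemma hasDerivAt_integral_of_bounded {X : Type*} [MeasurableSpace X] {μ : Measure X}
    (F F' : ℝ → X → ℝ) (b : X → ℝ) (s₀ : ℝ) (hF : ∀ s, AEStronglyMeasurable (F s) μ)
    (hF0 : Integrable (F s₀) μ) (hF' : AEStronglyMeasurable (F' s₀) μ)
    (hb : ∀ᵐ x ∂μ, ∀ s, ‖F' s x‖ ≤ b x) (hbi : Integrable b μ)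
    (hd : ∀ᵐ x ∂μ, ∀ s, HasDerivAt (fun s => F s x) (F' s x) s) :
    HasDerivAt (fun s => ∫ x, F s x ∂μ) (∫ x, F' s₀ x ∂μ) s₀ :=
  (hasDerivAt_integral_of_dominated_loc_of_deriv_le (bound := b) (s := univ) univ_mem
    (Eventually.of_forall hF) hF0 hF' (hb.mono fun _ hx s _ => hx s) hbi
    (hd.mono fun _ hx s _ => hx s)).2

/-- Differentiation under the integral sign, dominated through the sup of the continuous derivative
on the compact torus. -/
lemma IsSmooth.hasDerivAt_integral_shift {ψ : Torus d L → ℝ} (hψ : IsSmooth ψ)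
    {f : Torus d L → ℝ} (hf : Continuous f) (j : Fin d) :
    HasDerivAt (fun s : ℝ => ∫ x, ψ (x + Pi.single j (s : AddCircle L)) * f x)
      (∫ x, partialDeriv j ψ x * f x) 0 := by
  obtain ⟨B, hB⟩ := exists_bound_of_continuous (hψ.continuous_partialDeriv j)
  have hψc := hψ.continuous
  have hsh : ∀ s : ℝ, Continuous fun x : Torus d L => x + Pi.single j (s : AddCircle L) :=
    fun s => continuous_id.add continuous_const
  have hF : ∀ s : ℝ, Continuous fun x : Torus d L =>
      ψ (x + Pi.single j (s : AddCircle L)) * f x := fun s => (hψc.comp (hsh s)).mul hf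
  have hF' : Continuous fun x : Torus d L =>
      partialDeriv j ψ (x + Pi.single j ((0 : ℝ) : AddCircle L)) * f x :=
    ((hψ.continuous_partialDeriv j).comp (hsh 0)).mul hf
  have hbd : ∀ᵐ x : Torus d L, ∀ s : ℝ,
      ‖partialDeriv j ψ (x + Pi.single j (s : AddCircle L)) * f x‖ ≤ B * ‖f x‖ :=
    ae_of_all _ fun x s => by
      rw [norm_mul]; exact mul_le_mul_of_nonneg_right (hB _) (norm_nonneg _)
  have hbi : Integrable fun x : Torus d L => B * ‖f x‖ :=
    (integrable_of_continuous_real hf).norm.const_mul B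
  have hder : ∀ᵐ x : Torus d L, ∀ s : ℝ,
      HasDerivAt (fun s : ℝ => ψ (x + Pi.single j (s : AddCircle L)) * f x)
        (partialDeriv j ψ (x + Pi.single j (s : AddCircle L)) * f x) s :=
    ae_of_all _ fun x s => (hψ.hasDerivAt_shift j x s).mul_const _
  have h := hasDerivAt_integral_of_bounded _ _ _ _
    (fun s => (hF s).aestronglyMeasurable)
    (integrable_of_continuous_real (hF 0)) hF'.aestronglyMeasurable hbd hbi hder
  refine h.congr_deriv (integral_congr_ae (ae_of_all _ fun x => ?_))
  simp

/-- Integration by parts on the torus. -/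
lemma IsSmooth.integral_partialDeriv_mul {ψ φ : Torus d L → ℝ} (hψ : IsSmooth ψ) (hφ : IsSmooth φ)
    (j : Fin d) :
    ∫ x, partialDeriv j ψ x * φ x = -∫ x, ψ x * partialDeriv j φ x := by
  have h1 := hψ.hasDerivAt_integral_shift hφ.continuous j
  have h2 := hφ.hasDerivAt_integral_shift hψ.continuous j
  -- By translation invariance, shifting φ by -s against ψ gives the same integral as shifting ψ by
  -- s against φ. Comparing the two derivatives at s = 0 is the integration by parts.
  have h2' : HasDerivAt (fun s : ℝ => ∫ x, φ (x + Pi.single j ((-s : ℝ) : AddCircle L)) * ψ x)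
      (-∫ x, partialDeriv j φ x * ψ x) 0 := by
    rw [← neg_zero] at h2
    have := h2.scomp (0 : ℝ) (hasDerivAt_neg (0 : ℝ))
    simpa [Function.comp_def] using this
  have heq : (fun s : ℝ => ∫ x, φ (x + Pi.single j ((-s : ℝ) : AddCircle L)) * ψ x)
      = fun s : ℝ => ∫ x, ψ (x + Pi.single j (s : AddCircle L)) * φ x := by
    funext s
    refine (integral_add_right_eq_self (μ := volume)
      (fun x : Torus d L => φ (x + Pi.single j ((-s : ℝ) : AddCircle L)) * ψ x)
      (Pi.single j (s : AddCircle L))).symm.trans ?_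
    refine integral_congr_ae (ae_of_all _ fun x => ?_)
    have : x + Pi.single j (s : AddCircle L) + Pi.single j ((-s : ℝ) : AddCircle L) = x := by
      rw [add_assoc, ← Pi.single_add]; simp
    simp only [this]
    ring
  rw [heq] at h2'
  rw [h1.unique h2']
  simp only [mul_comm]

end IntegrationByParts

/-! ### Real trigonometric fields and the Leray projection -/

section TrigPolyFields

variable {d : ℕ} {L : ℝ}

/-- Coefficients of real-valued fields. -/
def IsHermitian (c : (Fin d → ℤ) → Fin d → ℂ) : Prop := ∀ k i, c (-k) i = conj (c k i)

lemma mem_freqBox {N : ℕ} {k : Fin d → ℤ} : k ∈ freqBox d N ↔ ∀ i, |k i| ≤ N := by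
  simp [freqBox, abs_le]

lemma neg_mem_freqBox {N : ℕ} {k : Fin d → ℤ} : -k ∈ freqBox d N ↔ k ∈ freqBox d N := by
  simp [mem_freqBox]

/-- The box is symmetric under k ↦ -k, so conjugation permutes the terms: the complex sum is real,
and taking its real part loses nothing. -/
lemma IsHermitian.trigPoly_apply {c : (Fin d → ℤ) → Fin d → ℂ} (hc : IsHermitian c) (N : ℕ)
    (x : Torus d L) (i : Fin d) :
    ((trigPoly N c x i : ℝ) : ℂ) = trigSum (freqBox d N) (fun k => c k i) x := by
  change (((∑ k ∈ freqBox d N, c k i * character k x).re : ℝ) : ℂ)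
    = ∑ k ∈ freqBox d N, c k i * character k x
  refine Complex.conj_eq_iff_re.1 ?_
  rw [map_sum]
  refine Finset.sum_nbij' (fun k => -k) (fun k => -k) (fun k hk => neg_mem_freqBox.2 hk)
    (fun k hk => neg_mem_freqBox.2 hk) (by simp) (by simp) fun k _ => ?_
  rw [map_mul, hc, character_freq_neg]

/-- The coefficients of the Leray projection. -/
def lerayCoeff (c : (Fin d → ℤ) → Fin d → ℂ) (k : Fin d → ℤ) (i : Fin d) : ℂ :=
  c k i - (∑ j, c k j * (k j : ℂ)) / ((freqNorm k : ℂ) ^ 2) * (k i : ℂ)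

lemma freqNorm_neg (k : Fin d → ℤ) : freqNorm (-k) = freqNorm k := by simp [freqNorm]

lemma IsHermitian.lerayCoeff {c : (Fin d → ℤ) → Fin d → ℂ} (hc : IsHermitian c) :
    IsHermitian (lerayCoeff c) := by
  intro k i
  simp only [VectorMixing.lerayCoeff, hc k, freqNorm_neg, map_sub, map_mul, map_div₀, map_sum,
    map_pow, Complex.conj_ofReal, Pi.neg_apply, Int.cast_neg, mul_neg, Finset.sum_neg_distrib,
    map_intCast]
  ring

lemma sum_lerayCoeff_mul (c : (Fin d → ℤ) → Fin d → ℂ) (k : Fin d → ℤ) :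
    ∑ i, lerayCoeff c k i * (k i : ℂ) = 0 := by
  rcases eq_or_ne k 0 with rfl | hk
  · simp
  have h1 : ((freqNorm k : ℂ) ^ 2) = ∑ i, (k i : ℂ) * (k i : ℂ) := by
    have := congrArg (fun r : ℝ => (r : ℂ)) (freqNorm_sq k)
    push_cast at this
    rw [this]
    exact Finset.sum_congr rfl fun i _ => sq _
  have h2 : ((freqNorm k : ℂ) ^ 2) ≠ 0 := by
    exact_mod_cast pow_ne_zero 2 (freqNorm_pos hk).ne'
  simp only [lerayCoeff, sub_mul, Finset.sum_sub_distrib, mul_assoc]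
  rw [← Finset.mul_sum, ← h1, div_mul_cancel₀ _ h2, sub_self]

lemma lerayCoeff_eq_self {c : (Fin d → ℤ) → Fin d → ℂ} {k : Fin d → ℤ}
    (h : ∑ j, c k j * (k j : ℂ) = 0) (i : Fin d) : lerayCoeff c k i = c k i := by
  simp [lerayCoeff, h]

variable [hL : Fact (0 < L)]

lemma isHermitian_coeff (f : Torus d L → Vec d) : IsHermitian (coeff f) := fun k i =>
  cCoeff_ofReal_neg (fun x => f x i) k

lemma lerayTruncate_eq (N : ℕ) (f : Torus d L → Vec d) :
    lerayTruncate N f = trigPoly N (lerayCoeff (coeff f)) := rfl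

lemma IsHermitian.coeff_trigPoly {c : (Fin d → ℤ) → Fin d → ℂ} (hc : IsHermitian c) (N : ℕ)
    (k : Fin d → ℤ) (i : Fin d) :
    coeff (trigPoly N c : Torus d L → Vec d) k i = if k ∈ freqBox d N then c k i else 0 := by
  rw [coeff_eq_cCoeff]
  simp only [hc.trigPoly_apply]
  exact cCoeff_trigSum _ _ _

lemma continuous_trigPoly (N : ℕ) (c : (Fin d → ℤ) → Fin d → ℂ) :
    Continuous (trigPoly N c : Torus d L → Vec d) := by
  unfold trigPoly
  exact (PiLp.continuous_toLp 2 _).comp (continuous_pi fun i => by fun_prop)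

lemma memLp_of_continuous_vec {f : Torus d L → Vec d} (hf : Continuous f) (p : ℝ≥0∞) :
    MemLp f p := by
  obtain ⟨C, hC⟩ := (isCompact_range hf).isBounded.exists_norm_le
  exact MemLp.of_bound hf.aestronglyMeasurable C (ae_of_all _ fun x => hC _ ⟨x, rfl⟩)

lemma isSmooth_trigPoly_component (N : ℕ) (c : (Fin d → ℤ) → Fin d → ℂ) (i : Fin d) :
    IsSmooth fun x : Torus d L => trigPoly N c x i := by
  refine Complex.reCLM.contDiff.comp (ContDiff.sum fun k _ => ?_)
  exact contDiff_const.mul (contDiff_character k)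

/-- The coefficients of the partial derivative `∂_j`. -/
def gradCoeff (L : ℝ) (c : (Fin d → ℤ) → Fin d → ℂ) (j : Fin d) (k : Fin d → ℤ) (i : Fin d) : ℂ :=
  Complex.I * wave L k j * c k i

lemma IsHermitian.gradCoeff {c : (Fin d → ℤ) → Fin d → ℂ} (hc : IsHermitian c) (j : Fin d) :
    IsHermitian (gradCoeff L c j) := by
  intro k i
  simp only [VectorMixing.gradCoeff, hc k, wave_neg, map_mul, Complex.conj_I, Complex.conj_ofReal]
  push_cast
  ring

lemma hasDerivAt_trigPoly_component (N : ℕ) (c : (Fin d → ℤ) → Fin d → ℂ) (i j : Fin d)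
    (x : Torus d L) :
    HasDerivAt (fun s : ℝ => trigPoly N c (x + Pi.single j (s : AddCircle L)) i)
      (trigPoly N (gradCoeff L c j) x i) 0 := by
  have h1 : HasDerivAt (fun s : ℝ => ∑ k ∈ freqBox d N,
      c k i * character k (x + Pi.single j (s : AddCircle L)))
      (∑ k ∈ freqBox d N, gradCoeff L c j k i * character k x) 0 := by
    refine (HasDerivAt.fun_sum fun k _ => (hasDerivAt_character k x j).const_mul (c k i)).congr_deriv
      (Finset.sum_congr rfl fun k _ => ?_)
    simp only [gradCoeff]; ring
  exact Complex.reCLM.hasFDerivAt.comp_hasDerivAt (0 : ℝ) h1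

lemma partialDeriv_trigPoly_component (N : ℕ) (c : (Fin d → ℤ) → Fin d → ℂ) (i j : Fin d)
    (x : Torus d L) :
    partialDeriv j (fun x => trigPoly N c x i) x = trigPoly N (gradCoeff L c j) x i :=
  (hasDerivAt_trigPoly_component N c i j x).deriv

lemma partialDeriv_trigPoly (N : ℕ) (c : (Fin d → ℤ) → Fin d → ℂ) (j : Fin d) (x : Torus d L) :
    partialDeriv j (trigPoly N c) x = trigPoly N (gradCoeff L c j) x := by
  refine HasDerivAt.deriv ?_
  have h := hasDerivAt_pi.2 fun i => hasDerivAt_trigPoly_component N c i j x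
  exact (PiLp.continuousLinearEquiv 2 ℝ fun _ : Fin d => ℝ).symm.hasFDerivAt.comp_hasDerivAt
    (0 : ℝ) h

lemma isWeakGradient_trigPoly (N : ℕ) (c : (Fin d → ℤ) → Fin d → ℂ) :
    IsWeakGradient (trigPoly N c : Torus d L → Vec d) fun j => trigPoly N (gradCoeff L c j) := by
  have hint : ∀ (c : (Fin d → ℤ) → Fin d → ℂ) (f : Torus d L → ℝ), Continuous f →
      Integrable fun x => f x • (trigPoly N c x : Vec d) := fun c f hf =>
    memLp_one_iff_integrable.1 (memLp_of_continuous_vec (hf.smul (continuous_trigPoly N c)) 1)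
  refine ⟨memLp_one_iff_integrable.1 (memLp_of_continuous_vec (continuous_trigPoly N c) 1),
    fun j => ⟨memLp_one_iff_integrable.1 (memLp_of_continuous_vec (continuous_trigPoly N _) 1),
    fun ψ hψ => ?_⟩⟩
  ext i
  rw [PiLp.neg_apply, integral_component (hint _ _ (hψ.continuous_partialDeriv j)),
    integral_component (hint _ _ hψ.continuous)]
  simp only [PiLp.smul_apply, smul_eq_mul, ← partialDeriv_trigPoly_component]
  exact hψ.integral_partialDeriv_mul (isSmooth_trigPoly_component N c i) j

lemma norm_trigPoly_le (N : ℕ) {c : (Fin d → ℤ) → Fin d → ℂ} {B : ℝ}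
    (hB : ∀ k ∈ freqBox d N, ∀ i, ‖c k i‖ ≤ B) (x : Torus d L) :
    ‖trigPoly N c x‖ ≤ d * ((freqBox d N).card * B) := by
  have h1 : ∀ i, ‖trigPoly N c x i‖ ≤ (freqBox d N).card * B := by
    intro i
    refine (Complex.abs_re_le_norm _).trans ((norm_sum_le _ _).trans ?_)
    rw [← nsmul_eq_mul]
    refine Finset.sum_le_card_nsmul _ _ _ fun k hk => ?_
    rw [norm_mul, norm_character, mul_one]
    exact hB k hk i
  have h2 : ‖trigPoly N c x‖ ≤ ∑ i, ‖trigPoly N c x i‖ := by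
    have h3 : trigPoly N c x = ∑ i, EuclideanSpace.single i (trigPoly N c x i) := by
      ext j
      simp
    conv_lhs => rw [h3]
    refine (norm_sum_le _ _).trans_eq ?_
    simp
  refine h2.trans ((Finset.sum_le_sum fun i _ => h1 i).trans_eq ?_)
  rw [Finset.sum_const, Finset.card_univ, Fintype.card_fin, nsmul_eq_mul]

lemma wave_abs_le_of_mem_freqBox {N : ℕ} {k : Fin d → ℤ} (hk : k ∈ freqBox d N) (j : Fin d) :
    |wave L k j| ≤ 2 * Real.pi / L * N := by
  rw [wave, abs_mul, abs_of_pos two_pi_div_pos]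
  refine mul_le_mul_of_nonneg_left ?_ two_pi_div_pos.le
  exact_mod_cast mem_freqBox.1 hk j

/-- A uniform bound for the Sobolev norm of trigonometric polynomials with bounded coefficients. -/
lemma exists_sobolevNorm_trigPoly_le (q : ℝ≥0∞) (N : ℕ) (B : ℝ) :
    ∃ D : ℝ≥0∞, D < ⊤ ∧ ∀ c : (Fin d → ℤ) → Fin d → ℂ, (∀ k i, ‖c k i‖ ≤ B) →
      sobolevNorm q (trigPoly N c : Torus d L → Vec d) ≤ D := by
  set v : ℝ≥0∞ := (volume : Measure (Torus d L)) univ ^ q.toReal⁻¹ with hv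
  have hvt : v ≠ ⊤ := ENNReal.rpow_ne_top_of_nonneg (by positivity) (measure_ne_top _ _)
  refine ⟨v * ENNReal.ofReal (d * ((freqBox d N).card * B)) +
    ∑ _j : Fin d, v * ENNReal.ofReal (d * ((freqBox d N).card * (2 * Real.pi / L * N * B))), ?_,
    fun c hc => ?_⟩
  · refine ENNReal.add_lt_top.2 ⟨ENNReal.mul_lt_top hvt.lt_top ENNReal.ofReal_lt_top, ?_⟩
    exact ENNReal.sum_lt_top.2 fun j _ => ENNReal.mul_lt_top hvt.lt_top ENNReal.ofReal_lt_top
  · refine (iInf₂_le _ (isWeakGradient_trigPoly N c)).trans ?_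
    refine add_le_add ?_ (Finset.sum_le_sum fun j _ => ?_)
    · exact eLpNorm_le_of_ae_bound (ae_of_all _ fun x => norm_trigPoly_le N (fun k _ i => hc k i) x)
    · refine eLpNorm_le_of_ae_bound (ae_of_all _ fun x => norm_trigPoly_le N (fun k hk i => ?_) x)
      rw [gradCoeff, norm_mul, norm_mul, Complex.norm_I, one_mul, Complex.norm_real]
      exact mul_le_mul (wave_abs_le_of_mem_freqBox hk j) (hc k i) (norm_nonneg _)
        (mul_nonneg two_pi_div_pos.le (Nat.cast_nonneg N))

lemma norm_coeff_le_of_eLpNorm_le {V : Torus d L → Vec d} {q : ℝ≥0∞} (hq : 1 ≤ q)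
    (hV : AEStronglyMeasurable V) {A : ℝ} (hA : 0 ≤ A) (h : eLpNorm V q ≤ ENNReal.ofReal A)
    (k : Fin d → ℤ) (i : Fin d) :
    ‖coeff V k i‖ ≤ (L ^ d)⁻¹ *
      (A * ((volume : Measure (Torus d L)) univ ^ (1 / (1 : ℝ≥0∞).toReal - 1 / q.toReal)).toReal) := by
  have hLd := side_pow_pos (d := d) (L := L)
  rw [coeff_eq_cCoeff]
  refine (norm_cCoeff_le _ k).trans ?_
  refine mul_le_mul_of_nonneg_left ?_ (inv_nonneg.2 hLd.le)
  have h1 := eLpNorm_le_eLpNorm_mul_rpow_measure_univ hq hV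
  have hexp : 0 ≤ 1 / (1 : ℝ≥0∞).toReal - 1 / q.toReal := by
    rcases eq_or_ne q ⊤ with rfl | hqt
    · simp
    · have : 1 ≤ q.toReal := by
        rw [← ENNReal.toReal_one]; exact (ENNReal.toReal_le_toReal ENNReal.one_ne_top hqt).2 hq
      simp only [ENNReal.toReal_one, sub_nonneg]
      gcongr
  have hvt : (volume : Measure (Torus d L)) univ ^ (1 / (1 : ℝ≥0∞).toReal - 1 / q.toReal) ≠ ⊤ :=
    ENNReal.rpow_ne_top_of_nonneg hexp (measure_ne_top _ _)
  have hm : AEStronglyMeasurable (fun x => ((V x i : ℝ) : ℂ)) :=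
    Complex.continuous_ofReal.comp_aestronglyMeasurable
      ((PiLp.continuous_apply 2 _ i).comp_aestronglyMeasurable hV)
  rw [integral_norm_eq_lintegral_enorm hm, ← eLpNorm_one_eq_lintegral_enorm]
  have h2 := ((eLpNorm_component_le V i 1).trans h1).trans (mul_le_mul_left h _)
  have h3 := ENNReal.toReal_mono (ENNReal.mul_ne_top ENNReal.ofReal_ne_top hvt) h2
  rwa [ENNReal.toReal_mul, ENNReal.toReal_ofReal hA] at h3

end TrigPolyFields

end VectorMixing

end

noncomputable section

namespace VectorMixing

open scoped ComplexConjugate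

/-! ### Recovering coefficients from values on a grid -/

section Grid

variable {d : ℕ} {L : ℝ}

/-- The points of the uniform grid with `M` points per direction. -/
def gridPoint (L : ℝ) (M : ℕ) (m : Fin d → Fin M) : Torus d L :=
  toTorus L fun i => ((m i : ℕ) : ℝ) * L / M

lemma character_gridPoint (hL : L ≠ 0) (M : ℕ) (k : Fin d → ℤ) (m : Fin d → Fin M) :
    character k (gridPoint L M m)
      = ∏ i, (Complex.exp (2 * Real.pi * Complex.I / M) ^ k i) ^ (m i : ℕ) := by
  have hL' : (L : ℂ) ≠ 0 := by exact_mod_cast hL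
  refine Finset.prod_congr rfl fun i _ => ?_
  change fourier (k i) (((((m i : ℕ) : ℝ) * L / M : ℝ)) : AddCircle L) = _
  rw [fourier_coe_apply, ← Complex.exp_int_mul, ← Complex.exp_nat_mul]
  congr 1
  push_cast
  field_simp

/-- Discrete orthogonality: the sum factors into geometric sums of M-th roots of unity, and a
nonzero k_i with |k_i| < M is not divisible by `M`, so that factor vanishes. -/
lemma sum_character_gridPoint (hL : L ≠ 0) {M : ℕ} {k : Fin d → ℤ} (hk : ∀ i, |k i| < M) :
    ∑ m, character k (gridPoint L M m) = if k = 0 then (M : ℂ) ^ d else 0 := by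
  simp only [character_gridPoint hL]
  have h := Finset.prod_univ_sum (fun _ : Fin d => (Finset.univ : Finset (Fin M)))
    (fun i a => (Complex.exp (2 * Real.pi * Complex.I / M) ^ k i) ^ (a : ℕ))
  rw [Fintype.piFinset_univ] at h
  rw [← h]
  split_ifs with h0
  · subst h0; simp
  obtain ⟨i, hi⟩ := Function.ne_iff.1 h0
  have hM : M ≠ 0 := by
    rintro rfl
    exact absurd (hk i) (by simp)
  refine Finset.prod_eq_zero (Finset.mem_univ i) ?_
  set ζ := Complex.exp (2 * Real.pi * Complex.I / M) with hζ
  have hp : IsPrimitiveRoot ζ M := Complex.isPrimitiveRoot_exp M hM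
  have h1 : ζ ^ k i ≠ 1 := by
    rw [Ne, hp.zpow_eq_one_iff_dvd]
    exact fun hdvd => hi (Int.eq_zero_of_abs_lt_dvd hdvd (hk i))
  have h2 : (ζ ^ k i) ^ M = 1 := by
    rw [← zpow_natCast, ← zpow_mul, mul_comm, zpow_mul, zpow_natCast, hp.pow_eq_one, one_zpow]
  rw [Fin.sum_univ_eq_sum_range (fun a => (ζ ^ k i) ^ a) M]
  have h3 := mul_geom_sum (ζ ^ k i) M
  rw [h2, sub_self] at h3
  exact (mul_eq_zero.1 h3).resolve_left (sub_ne_zero.2 h1)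

/-- Recovery of coefficients from the values on a grid. -/
lemma sum_trigSum_gridPoint (hL : L ≠ 0) {N : ℕ} (c : (Fin d → ℤ) → ℂ) {k : Fin d → ℤ}
    (hk : k ∈ freqBox d N) :
    ∑ m, trigSum (freqBox d N) c (gridPoint L (2 * N + 1) m)
      * character (-k) (gridPoint L (2 * N + 1) m) = ((2 * N + 1 : ℕ) : ℂ) ^ d * c k := by
  -- Differences of frequencies in the box have entries of size at most 2N, so 2N + 1 points per
  -- direction exclude aliasing.
  have h1 : ∀ l ∈ freqBox d N, ∑ m, character (l - k) (gridPoint L (2 * N + 1) m)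
      = if l = k then ((2 * N + 1 : ℕ) : ℂ) ^ d else 0 := by
    intro l hl
    rw [sum_character_gridPoint hL]
    · simp only [sub_eq_zero]
    · intro i
      have h2 := abs_le.1 (mem_freqBox.1 hk i)
      have h3 := abs_le.1 (mem_freqBox.1 hl i)
      rw [Pi.sub_apply, abs_lt]
      push_cast
      constructor <;> omega
  simp only [trigSum, Finset.sum_mul, mul_assoc, ← character_freq_add, ← sub_eq_add_neg]
  rw [Finset.sum_comm]
  simp only [← Finset.mul_sum]
  rw [Finset.sum_congr rfl fun l hl => by rw [h1 l hl]]
  simp [hk, mul_comm]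

end Grid

/-! ### The system of differential equations for the Fourier coefficients -/

section CoefficientODE

variable {d : ℕ} {L : ℝ} [hL : Fact (0 < L)]

/-- The evaluation of a Fourier coefficient from the values on the grid. -/
lemma IsHermitian.eq_sum_gridPoint {c : (Fin d → ℤ) → Fin d → ℂ} (hc : IsHermitian c) {N : ℕ}
    {k : Fin d → ℤ} (hk : k ∈ freqBox d N) (i : Fin d) :
    c k i = ∑ m, ((trigPoly N c (gridPoint L (2 * N + 1) m) i : ℝ) : ℂ)
      * ((((2 * N + 1 : ℕ) : ℂ) ^ d)⁻¹ * character (-k) (gridPoint L (2 * N + 1) m)) := by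
  have h1 := sum_trigSum_gridPoint hL.out.ne' (fun l => c l i) hk
  have h2 : (((2 * N + 1 : ℕ) : ℂ) ^ d) ≠ 0 := 
    pow_ne_zero _ (Nat.cast_ne_zero.2 (Nat.succ_ne_zero (2 * N)))
  simp only [hc.trigPoly_apply]
  rw [eq_comm, ← mul_right_inj' h2, ← h1, Finset.mul_sum]
  refine Finset.sum_congr rfl fun m _ => ?_
  field_simp

variable {N : ℕ} {U : ℝ → Torus d L → Vec d} {u₀ : Torus d L → Vec d} {w : ℝ → Torus d L → Vec d}

lemma IsSpectralSolution.eq_trigPoly (h : IsSpectralSolution N U u₀ w) {t : ℝ} (ht : 0 ≤ t) :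
    w t = trigPoly N (coeff (w t)) :=
  (h.bandLimited t ht).symm

lemma IsSpectralSolution.coeff_eq_zero (h : IsSpectralSolution N U u₀ w) {t : ℝ} (ht : 0 ≤ t)
    {k : Fin d → ℤ} (hk : k ∉ freqBox d N) (i : Fin d) : coeff (w t) k i = 0 := by
  rw [h.eq_trigPoly ht, (isHermitian_coeff _).coeff_trigPoly, if_neg hk]

lemma intervalIntegrable_component {f : ℝ → Vec d} {a b : ℝ} (hf : IntervalIntegrable f volume a b)
    (i : Fin d) : IntervalIntegrable (fun s => ((f s i : ℝ) : ℂ)) volume a b :=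
  have h : ∀ {μ : Measure ℝ}, Integrable f μ → Integrable (fun s => ((f s i : ℝ) : ℂ)) μ :=
    fun h => (Complex.ofRealCLM.comp (EuclideanSpace.proj (𝕜 := ℝ) i)).integrable_comp h
  ⟨h hf.1, h hf.2⟩

lemma intervalIntegral_component {f : ℝ → Vec d} {a b : ℝ} (hf : IntervalIntegrable f volume a b)
    (i : Fin d) : (((∫ s in a..b, f s) i : ℝ) : ℂ) = ∫ s in a..b, ((f s i : ℝ) : ℂ) :=
  ((Complex.ofRealCLM.comp (EuclideanSpace.proj (𝕜 := ℝ) i)).intervalIntegral_comp_comm hf).symm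

/-- The right-hand side of the system of ordinary differential equations for the coefficients. -/
def spectralRate (N : ℕ) (U w : ℝ → Torus d L → Vec d) (s : ℝ) : (Fin d → ℤ) → Fin d → ℂ :=
  coeff (transport (truncate N (U s)) (w s))

lemma IsSpectralSolution.intervalIntegrable_rate (h : IsSpectralSolution N U u₀ w)
    {k : Fin d → ℤ} (hk : k ∈ freqBox d N) (i : Fin d) {t : ℝ} (ht : 0 ≤ t) :
    IntervalIntegrable (fun s => lerayCoeff (spectralRate N U w s) k i) volume 0 t := by
  have h1 : (fun s => lerayCoeff (spectralRate N U w s) k i) = fun s =>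
      ∑ m, ((lerayTruncate N (transport (truncate N (U s)) (w s))
        (gridPoint L (2 * N + 1) m) i : ℝ) : ℂ)
        * ((((2 * N + 1 : ℕ) : ℂ) ^ d)⁻¹ * character (-k) (gridPoint L (2 * N + 1) m)) :=
    funext fun s => (isHermitian_coeff _).lerayCoeff.eq_sum_gridPoint hk i
  rw [h1]
  have := IntervalIntegrable.sum (μ := volume) (a := 0) (b := t) Finset.univ fun m _ =>
    (intervalIntegrable_component (h.integrable t ht (gridPoint L (2 * N + 1) m)) i).mul_const
      ((((2 * N + 1 : ℕ) : ℂ) ^ d)⁻¹ * character (-k) (gridPoint L (2 * N + 1) m))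
  exact this.congr fun s _ => by simp

/-- The scheme is posed at each point x. A coefficient is a finite linear combination of grid
values, so a finite sum of the pointwise equations gives its equation, with no interchange of
integrals in time and space. -/
lemma IsSpectralSolution.coeff_eq (h : IsSpectralSolution N U u₀ w)
    {k : Fin d → ℤ} (hk : k ∈ freqBox d N) (i : Fin d) {t : ℝ} (ht : 0 ≤ t) :
    coeff (w t) k i = lerayCoeff (coeff u₀) k i
      - ∫ s in (0 : ℝ)..t, lerayCoeff (spectralRate N U w s) k i := by
  have h1 : ∀ s, lerayCoeff (spectralRate N U w s) k i =
      ∑ m, ((lerayTruncate N (transport (truncate N (U s)) (w s))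
        (gridPoint L (2 * N + 1) m) i : ℝ) : ℂ)
        * ((((2 * N + 1 : ℕ) : ℂ) ^ d)⁻¹ * character (-k) (gridPoint L (2 * N + 1) m)) :=
    fun s => (isHermitian_coeff _).lerayCoeff.eq_sum_gridPoint hk i
  simp only [h1]
  rw [intervalIntegral.integral_finsetSum fun m _ =>
    (intervalIntegrable_component (h.integrable t ht (gridPoint L (2 * N + 1) m)) i).mul_const _,
    (isHermitian_coeff (w t)).eq_sum_gridPoint (L := L) hk i,
    (isHermitian_coeff u₀).lerayCoeff.eq_sum_gridPoint (L := L) hk i, ← Finset.sum_sub_distrib]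
  refine Finset.sum_congr rfl fun m _ => ?_
  rw [intervalIntegral.integral_mul_const, ← sub_mul,
    ← intervalIntegral_component (h.integrable t ht _) i, ← h.eq_trigPoly ht,
    ← lerayTruncate_eq]
  congr 1
  rw [h.equation t ht, PiLp.sub_apply]
  push_cast
  rfl

/-- The initial value and the rate are both Leray projections, so the divergence-free condition
persists. -/
lemma IsSpectralSolution.sum_coeff_mul (h : IsSpectralSolution N U u₀ w) {t : ℝ} (ht : 0 ≤ t)
    (k : Fin d → ℤ) : ∑ i, coeff (w t) k i * (k i : ℂ) = 0 := by
  by_cases hk : k ∈ freqBox d N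
  · simp only [h.coeff_eq hk _ ht, sub_mul, Finset.sum_sub_distrib, sum_lerayCoeff_mul, zero_sub,
      neg_eq_zero, ← intervalIntegral.integral_mul_const]
    rw [← intervalIntegral.integral_finsetSum fun i _ =>
      (h.intervalIntegrable_rate hk i ht).mul_const _]
    simp [sum_lerayCoeff_mul]
  · simp [h.coeff_eq_zero ht hk]

end CoefficientODE

/-! ### Norms in terms of Fourier coefficients -/

section Norms

variable {d : ℕ} {L : ℝ} [hL : Fact (0 < L)]

lemma negSobolevNorm_nonneg (α : ℝ) (f : Torus d L → Vec d) : 0 ≤ negSobolevNorm α f :=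
  mul_nonneg (Real.rpow_nonneg two_pi_div_pos.le _) (Real.sqrt_nonneg _)

/-- The prefactor (2π/L)^{-α} is absorbed by measuring frequencies with wave lengths 2π|k|/L. -/
lemma negSobolevNorm_sq (α : ℝ) (f : Torus d L → Vec d) :
    negSobolevNorm α f ^ 2
      = L ^ d * ∑' k : Fin d → ℤ, waveNorm L k ^ (-2 * α) * ∑ i, ‖coeff f k i‖ ^ 2 := by
  have h1 : ∀ k : Fin d → ℤ, waveNorm L k ^ (-2 * α) * ∑ i, ‖coeff f k i‖ ^ 2
      = ((2 * Real.pi / L) ^ (-α)) ^ 2 * (freqNorm k ^ (-2 * α) * ∑ i, ‖coeff f k i‖ ^ 2) := by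
    intro k
    rw [waveNorm, Real.mul_rpow two_pi_div_pos.le (freqNorm_nonneg k), ← Real.rpow_natCast,
      ← Real.rpow_mul two_pi_div_pos.le, mul_assoc]
    congr 2
    push_cast
    ring
  simp only [h1]
  rw [tsum_mul_left, negSobolevNorm, mul_pow, Real.sq_sqrt]
  · ring
  · refine mul_nonneg side_pow_pos.le (tsum_nonneg fun k => mul_nonneg
      (Real.rpow_nonneg (freqNorm_nonneg k) _) (Finset.sum_nonneg fun i _ => sq_nonneg _))

lemma l2Norm_nonneg (f : Torus d L → Vec d) : 0 ≤ l2Norm f := ENNReal.toReal_nonneg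

lemma memLp_component {f : Torus d L → Vec d} {p : ℝ≥0∞} (hf : MemLp f p) (i : Fin d) :
    MemLp (fun x => ((f x i : ℝ) : ℂ)) p :=
  ⟨Complex.continuous_ofReal.comp_aestronglyMeasurable
    ((PiLp.continuous_apply 2 _ i).comp_aestronglyMeasurable hf.1),
    (eLpNorm_component_le f i p).trans_lt hf.2⟩

lemma l2Norm_sq {f : Torus d L → Vec d} (hf : MemLp f 2) :
    l2Norm f ^ 2 = ∫ x, ‖f x‖ ^ 2 := by
  rw [l2Norm, ← Real.sqrt_sq (ENNReal.toReal_nonneg (a := eLpNorm f 2 volume))]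
  rw [Real.sqrt_sq ENNReal.toReal_nonneg, hf.eLpNorm_eq_integral_rpow_norm two_ne_zero (by simp)]
  have h0 : 0 ≤ ∫ x, ‖f x‖ ^ 2 := integral_nonneg fun x => sq_nonneg _
  simp only [ENNReal.toReal_ofNat, Real.rpow_ofNat]
  rw [ENNReal.toReal_ofReal (Real.rpow_nonneg h0 _), ← Real.rpow_natCast, ← Real.rpow_mul h0]
  norm_num

lemma hasSum_norm_sq_coeff {f : Torus d L → Vec d} (hf : MemLp f 2) :
    HasSum (fun k : Fin d → ℤ => L ^ d * ∑ i, ‖coeff f k i‖ ^ 2) (l2Norm f ^ 2) := by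
  have h1 : ∫ x, ‖f x‖ ^ 2 = ∑ i, ∫ x, ‖((f x i : ℝ) : ℂ)‖ ^ 2 := by
    rw [← integral_finsetSum _ fun i _ => (memLp_component hf i).integrable_norm_pow (by simp)]
    refine integral_congr_ae (ae_of_all _ fun x => ?_)
    simp only [EuclideanSpace.norm_sq_eq, Complex.norm_real]
  rw [l2Norm_sq hf, h1]
  simp only [Finset.mul_sum]
  exact hasSum_sum fun i _ => hasSum_norm_sq_cCoeff (memLp_component hf i)

end Norms

end VectorMixing

end

noncomputable section

namespace VectorMixing

open scoped ComplexConjugate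

/-! ### Energy identities with Fourier weights -/

section Energy

variable {d : ℕ} {L : ℝ} [hL : Fact (0 < L)]

lemma coeff_transport_trigPoly {V : Torus d L → Vec d} (hV : Integrable V) {N : ℕ}
    {c : (Fin d → ℤ) → Fin d → ℂ} (hc : IsHermitian c) (l : Fin d → ℤ) (i : Fin d) :
    (L : ℂ) ^ d * coeff (transport V (trigPoly N c)) l i
      = ∑ k ∈ freqBox d N, c k i * transportMatrix (fun j x => ((V x j : ℝ) : ℂ)) k l := by
  have hVi : ∀ j, Integrable fun x => ((V x j : ℝ) : ℂ) := fun j =>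
    (integrable_component hV j).ofReal
  have h1 : (fun x : Torus d L => ((transport V (trigPoly N c) x i : ℝ) : ℂ)) = fun x =>
      ∑ j, ∑ k ∈ freqBox d N,
        gradCoeff L c j k i * (((V x j : ℝ) : ℂ) * character k x) := by
    funext x
    simp only [transport, partialDeriv_trigPoly, WithLp.ofLp_sum, Finset.sum_apply, PiLp.smul_apply,
      smul_eq_mul, Complex.ofReal_sum, Complex.ofReal_mul, (hc.gradCoeff _).trigPoly_apply, trigSum,
      Finset.mul_sum]
    refine Finset.sum_congr rfl fun j _ => Finset.sum_congr rfl fun k _ => ?_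
    ring
  rw [coeff_eq_cCoeff, h1, cCoeff_sum _ fun j _ => integrable_finsetSum _ fun k _ =>
    (integrable_mul_character (hVi j) k).const_mul _]
  simp only [cCoeff_sum _ fun k _ => (integrable_mul_character (hVi _) k).const_mul _,
    cCoeff_const_mul, cCoeff_mul_character, transportMatrix, gradCoeff, Finset.mul_sum]
  rw [Finset.sum_comm]
  refine Finset.sum_congr rfl fun k _ => Finset.sum_congr rfl fun j _ => ?_
  ring

lemma continuousOn_of_eq_sub_integral {f g : ℝ → ℂ} {f₀ : ℂ}
    (hg : ∀ t, 0 ≤ t → IntervalIntegrable g volume 0 t)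
    (hf : ∀ t, 0 ≤ t → f t = f₀ - ∫ s in (0 : ℝ)..t, g s) : ContinuousOn f (Ici 0) := by
  intro t ht
  have ht' : (0 : ℝ) ≤ t + 1 := add_nonneg ht zero_le_one
  have h1 : ContinuousOn (fun x => f₀ - ∫ s in (0 : ℝ)..x, g s) (Icc 0 (t + 1)) := by
    have := intervalIntegral.continuousOn_primitive_interval' (hg (t + 1) ht') left_mem_uIcc
    rw [uIcc_of_le ht'] at this
    exact continuousOn_const.sub this
  have h2 : ContinuousWithinAt f (Icc 0 (t + 1)) t :=
    (h1 t ⟨ht, by linarith⟩).congr (fun x hx => hf x hx.1) (hf t ht)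
  refine h2.mono_of_mem_nhdsWithin ?_
  rw [← Ici_inter_Iic]
  exact inter_mem self_mem_nhdsWithin (mem_nhdsWithin_of_mem_nhds (Iic_mem_nhds (by linarith)))

/-- The pressure does no work: what the projection removes is parallel to `k`, and the coefficient
of a divergence-free field is orthogonal to `k`. This holds frequency by frequency, hence for every
scalar weight. -/
lemma sum_lerayCoeff_mul_conj {F c : (Fin d → ℤ) → Fin d → ℂ} {k : Fin d → ℤ}
    (hdiv : ∑ i, c k i * (k i : ℂ) = 0) :
    ∑ i, lerayCoeff F k i * conj (c k i) = ∑ i, F k i * conj (c k i) := by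
  have h1 : ∑ i, (k i : ℂ) * conj (c k i) = 0 := by
    have := congrArg conj hdiv
    simpa [map_sum, mul_comm] using this
  simp only [lerayCoeff, sub_mul, Finset.sum_sub_distrib, mul_assoc]
  rw [← Finset.mul_sum, h1, mul_zero, sub_zero]

variable {S : Finset (Fin d → ℤ)} {η : (Fin d → ℤ) → ℝ} {c F : ℝ → (Fin d → ℤ) → Fin d → ℂ}
  {c₀ : (Fin d → ℤ) → Fin d → ℂ}

lemma intervalIntegrable_energyRate
    (hg : ∀ k ∈ S, ∀ i t, 0 ≤ t → IntervalIntegrable (fun s => lerayCoeff (F s) k i) volume 0 t)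
    (hc : ∀ k ∈ S, ∀ i t, 0 ≤ t → c t k i = c₀ k i - ∫ s in (0 : ℝ)..t, lerayCoeff (F s) k i)
    {s t : ℝ} (hs : 0 ≤ s) (hst : s ≤ t) {k : Fin d → ℤ} (hk : k ∈ S) (i : Fin d) :
    IntervalIntegrable (fun r => -(2 * (lerayCoeff (F r) k i * conj (c r k i)).re)) volume s t := by
  have h1 : IntervalIntegrable (fun s => lerayCoeff (F s) k i) volume s t :=
    (hg k hk i s hs).symm.trans (hg k hk i t (hs.trans hst))
  have h2 : ContinuousOn (fun r => conj (c r k i)) (uIcc s t) := by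
    refine Complex.continuous_conj.comp_continuousOn ?_
    refine (continuousOn_of_eq_sub_integral (hg k hk i) (hc k hk i)).mono ?_
    rw [uIcc_of_le hst]
    exact fun x hx => hs.trans hx.1
  have h3 := h1.mul_continuousOn h2
  exact (IntervalIntegrable.const_mul ⟨h3.1.re, h3.2.re⟩ 2).neg

/-- The evolution of weighted sums of squares of coefficients. -/
lemma weightedEnergy_sub_eq
    (hg : ∀ k ∈ S, ∀ i t, 0 ≤ t → IntervalIntegrable (fun s => lerayCoeff (F s) k i) volume 0 t)
    (hc : ∀ k ∈ S, ∀ i t, 0 ≤ t → c t k i = c₀ k i - ∫ s in (0 : ℝ)..t, lerayCoeff (F s) k i)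
    (hdiv : ∀ k ∈ S, ∀ t, 0 ≤ t → ∑ i, c t k i * (k i : ℂ) = 0)
    {s t : ℝ} (hs : 0 ≤ s) (hst : s ≤ t) :
    ∑ k ∈ S, η k * ∑ i, ‖c t k i‖ ^ 2 - ∑ k ∈ S, η k * ∑ i, ‖c s k i‖ ^ 2
      = ∫ r in s..t, -(2 * (∑ k ∈ S, (η k : ℂ) * ∑ i, F r k i * conj (c r k i)).re) := by
  have h1 : ∀ k ∈ S, η k * ∑ i, ‖c t k i‖ ^ 2 - η k * ∑ i, ‖c s k i‖ ^ 2
      = ∫ r in s..t, η k * ∑ i, -(2 * (lerayCoeff (F r) k i * conj (c r k i)).re) := by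
    intro k hk
    rw [intervalIntegral.integral_const_mul, intervalIntegral.integral_finsetSum fun i _ =>
      intervalIntegrable_energyRate hg hc hs hst hk i, ← mul_sub, ← Finset.sum_sub_distrib]
    congr 1
    exact Finset.sum_congr rfl fun i _ =>
      norm_sq_sub_norm_sq_eq_integral (hg k hk i) (hc k hk i) hs hst
  have h2 : ∀ k ∈ S, IntervalIntegrable (fun r =>
      η k * ∑ i, -(2 * (lerayCoeff (F r) k i * conj (c r k i)).re)) volume s t := by
    intro k hk
    have := (IntervalIntegrable.sum Finset.univ fun i _ =>
      intervalIntegrable_energyRate hg hc hs hst hk i).const_mul (η k)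
    exact this.congr fun r _ => by simp
  rw [← Finset.sum_sub_distrib, Finset.sum_congr rfl h1, ← intervalIntegral.integral_finsetSum h2]
  refine intervalIntegral.integral_congr fun r hr => ?_
  rw [uIcc_of_le hst] at hr
  simp only [Complex.re_sum, Complex.re_ofReal_mul, Finset.mul_sum, ← Finset.sum_neg_distrib]
  refine Finset.sum_congr rfl fun k hk => ?_
  have h3 := congrArg Complex.re
    (sum_lerayCoeff_mul_conj (F := F r) (hdiv k hk r (hs.trans hr.1)))
  simp only [Complex.re_sum] at h3
  rw [← Finset.mul_sum, Finset.sum_neg_distrib, ← Finset.mul_sum, h3, Finset.mul_sum,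
    Finset.sum_neg_distrib, mul_neg, Finset.mul_sum]
  congr 1
  refine Finset.sum_congr rfl fun i _ => ?_
  ring

end Energy

/-! ### Bounds for the rate of change of the energy -/

section RateBounds

variable {d : ℕ} {L : ℝ} [hL : Fact (0 < L)] {U : Fin d → Torus d L → ℝ}

/-- The rate of change of the weighted energy of a trigonometric polynomial. -/
def transportForm (U : Fin d → Torus d L → ℝ) (S : Finset (Fin d → ℤ)) (η : (Fin d → ℤ) → ℝ)
    (c : (Fin d → ℤ) → Fin d → ℂ) : ℂ :=
  ∑ l ∈ S, (η l : ℂ) * ∑ i, (∑ k ∈ S, c k i * transportMatrix (fun j x => (U j x : ℂ)) k l)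
    * conj (c l i)

lemma transportForm_eq (U : Fin d → Torus d L → ℝ) (S : Finset (Fin d → ℤ))
    (η : (Fin d → ℤ) → ℝ) (c : (Fin d → ℤ) → Fin d → ℂ) :
    transportForm U S η c = ∑ i, ∑ k ∈ S, ∑ l ∈ S, (η l : ℂ) * (c k i * conj (c l i)
      * transportMatrix (fun j x => (U j x : ℂ)) k l) := by
  simp only [transportForm, Finset.mul_sum, Finset.sum_mul]
  rw [Finset.sum_comm]
  refine Finset.sum_congr rfl fun i _ => ?_
  rw [Finset.sum_comm]
  refine Finset.sum_congr rfl fun k _ => Finset.sum_congr rfl fun l _ => ?_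
  ring

/-- The source of the conservation of the `L²` norm. -/
lemma re_transportForm_one (hdiv : IsFourierDivFree fun j x => (U j x : ℂ))
    (S : Finset (Fin d → ℤ)) (c : (Fin d → ℤ) → Fin d → ℂ) :
    (transportForm U S (fun _ => 1) c).re = 0 := by
  rw [transportForm_eq, Complex.re_sum]
  refine Finset.sum_eq_zero fun i _ => ?_
  simpa using re_sum_transportMatrix_eq_zero hdiv S fun k => c k i

/-- By skew-adjointness, moving the weight to the differentiated factor only changes the sign. It
brings the energy rate into the form of `abs_re_sum_negative_le`. -/
lemma re_sum_transportMatrix_swap (hdiv : IsFourierDivFree fun j x => (U j x : ℂ))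
    (S : Finset (Fin d → ℤ)) (η : (Fin d → ℤ) → ℝ) (y : (Fin d → ℤ) → ℂ) :
    (∑ k ∈ S, ∑ l ∈ S, (η l : ℂ) * (y k * conj (y l)
      * transportMatrix (fun j x => (U j x : ℂ)) k l)).re
      = -(∑ k ∈ S, ∑ l ∈ S, (η k : ℂ) * (y k * conj (y l)
        * transportMatrix (fun j x => (U j x : ℂ)) k l)).re := by
  rw [← Complex.conj_re, ← Complex.neg_re]
  congr 1
  rw [map_sum, ← Finset.sum_neg_distrib]
  simp only [map_sum, ← Finset.sum_neg_distrib]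
  rw [Finset.sum_comm]
  refine Finset.sum_congr rfl fun k _ => Finset.sum_congr rfl fun l _ => ?_
  rw [hdiv.transportMatrix_symm l k]
  simp only [map_mul, Complex.conj_ofReal, Complex.conj_conj]
  ring

variable {α : ℝ}

/-- The commutator estimate for each component, followed by interpolation. The exponents σ and 1 - σ
add up to 1, so the factor L^d is distributed over the two norms and the constant is free of `L`. -/
lemma abs_re_transportForm_le (hd : 1 ≤ d) (hα : 1 / 2 ≤ α) (hα1 : α < 1)
    (hU : ∀ j, Integrable (U j)) (hdiv : IsFourierDivFree fun j x => (U j x : ℂ)) {M : ℝ}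
    (hM : 0 ≤ M) (hb : ∀ (h : Vec d) j, ∀ᵐ x, ‖increment U h j x‖ ≤ M * ‖h‖ ^ α)
    (S : Finset (Fin d → ℤ)) (c : (Fin d → ℤ) → Fin d → ℂ) :
    |(transportForm U S (fun k => waveNorm L k ^ (-2 * α)) c).re|
      ≤ commutatorConst hd α * M *
        ((L ^ d * ∑ k ∈ S, ∑ i, ‖c k i‖ ^ 2) ^ ((1 - α) / α / 2) *
        (L ^ d * ∑ k ∈ S, waveNorm L k ^ (-2 * α) * ∑ i, ‖c k i‖ ^ 2) ^
          (1 - (1 - α) / α / 2)) := by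
  have hLd : (0 : ℝ) < L ^ d := side_pow_pos
  have hC := commutatorConst_nonneg hd (by linarith) hα1
  have hσ : 0 ≤ (1 - α) / α / 2 :=
    div_nonneg (div_nonneg (by linarith) (by linarith)) zero_le_two
  have hσ1 : (1 - α) / α / 2 ≤ 1 / 2 := by
    have : (1 - α) / α ≤ 1 := (div_le_one (by linarith)).2 (by linarith)
    linarith
  set σ := (1 - α) / α / 2 with hσd
  have ha : ∀ k, 0 ≤ ∑ i, ‖c k i‖ ^ 2 := fun k => Finset.sum_nonneg fun i _ => sq_nonneg _
  have hw : ∀ k : Fin d → ℤ, 0 ≤ waveNorm L k ^ (-2 * α) := fun k =>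
    Real.rpow_nonneg (waveNorm_nonneg k) _
  calc |(transportForm U S (fun k => waveNorm L k ^ (-2 * α)) c).re|
      ≤ ∑ i, commutatorConst hd α * (M * L ^ d * ∑ k ∈ S.erase 0,
          waveNorm L k ^ (1 - 3 * α) * ‖c k i‖ ^ 2) := by
        rw [transportForm_eq, Complex.re_sum]
        refine (Finset.abs_sum_le_sum_abs _ _).trans (Finset.sum_le_sum fun i _ => ?_)
        rw [re_sum_transportMatrix_swap hdiv, abs_neg]
        exact abs_re_sum_negative_le hd (by linarith) hα1 hU hdiv hM hb S fun k => c k i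
    _ = commutatorConst hd α * M * (L ^ d * ∑ k ∈ S.erase 0,
          waveNorm L k ^ (1 - 3 * α) * ∑ i, ‖c k i‖ ^ 2) := by
        rw [← Finset.mul_sum, ← Finset.mul_sum, Finset.sum_comm]
        simp only [Finset.mul_sum]
        ring_nf
    _ ≤ commutatorConst hd α * M * (L ^ d * ((∑ k ∈ S.erase 0, ∑ i, ‖c k i‖ ^ 2) ^ σ *
          (∑ k ∈ S.erase 0, waveNorm L k ^ (-2 * α) * ∑ i, ‖c k i‖ ^ 2) ^ (1 - σ))) := by
        refine mul_le_mul_of_nonneg_left (mul_le_mul_of_nonneg_left ?_ hLd.le) (mul_nonneg hC hM)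
        exact sum_rpow_mul_le _ hα hα1 (fun k hk => waveNorm_pos (Finset.ne_of_mem_erase hk))
          fun k _ => ha k
    _ ≤ commutatorConst hd α * M * (L ^ d * ((∑ k ∈ S, ∑ i, ‖c k i‖ ^ 2) ^ σ *
          (∑ k ∈ S, waveNorm L k ^ (-2 * α) * ∑ i, ‖c k i‖ ^ 2) ^ (1 - σ))) := by
        refine mul_le_mul_of_nonneg_left (mul_le_mul_of_nonneg_left ?_ hLd.le) (mul_nonneg hC hM)
        have hsub := Finset.erase_subset 0 S
        refine mul_le_mul (Real.rpow_le_rpow (Finset.sum_nonneg fun k _ => ha k)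
          (Finset.sum_le_sum_of_subset_of_nonneg hsub fun k _ _ => ha k) hσ)
          (Real.rpow_le_rpow (Finset.sum_nonneg fun k _ => mul_nonneg (hw k) (ha k))
          (Finset.sum_le_sum_of_subset_of_nonneg hsub fun k _ _ => mul_nonneg (hw k) (ha k))
          (by linarith)) (Real.rpow_nonneg (Finset.sum_nonneg fun k _ => mul_nonneg (hw k) (ha k)) _)
          (Real.rpow_nonneg (Finset.sum_nonneg fun k _ => ha k) _)
    _ = _ := by
        rw [Real.mul_rpow hLd.le (Finset.sum_nonneg fun k _ => ha k),
          Real.mul_rpow hLd.le (Finset.sum_nonneg fun k _ => mul_nonneg (hw k) (ha k))]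
        have : (L ^ d : ℝ) = (L ^ d) ^ σ * (L ^ d) ^ (1 - σ) := by
          rw [← Real.rpow_add hLd]; simp
        conv_lhs => rw [this]
        ring

/-- The lower bound from the differential inequality for the squared norm. -/
lemma lowerBound_le_of_integral_le (hα : 1 / 2 ≤ α) (hα1 : α < 1) {C₀ C M b : ℝ} (hC₀ : 0 ≤ C₀)
    (hC : C₀ ≤ C) (hM : 0 ≤ M) (hb : 0 ≤ b) {n : ℝ → ℝ} (hn : ∀ t, 0 ≤ n t)
    (hcont : ContinuousOn (fun t => n t ^ 2) (Ici 0))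
    (h : ∀ s t, 0 ≤ s → s ≤ t → n s ^ 2 - n t ^ 2
      ≤ ∫ r in s..t, 2 * (C₀ * M * (b ^ 2) ^ ((1 - α) / α / 2)) * (n r ^ 2) ^ (1 - (1 - α) / α / 2))
    {t : ℝ} (ht : 0 ≤ t) : lowerBound α C (n 0) b M t ≤ n t := by
  have hα0 : 0 < α := by linarith
  have hp : 0 < (1 - α) / α := div_pos (by linarith) hα0
  have hp1 : (1 - α) / α ≤ 1 := (div_le_one hα0).2 (by linarith)
  -- The Gronwall inequality is applied to E = n² with σ = (1-α)/(2α), so E^σ = n^{(1-α)/α} and its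
  -- prefactor 2σ is (1-α)/α.
  have hpow : ∀ x : ℝ, 0 ≤ x → (x ^ 2) ^ ((1 - α) / α / 2) = x ^ ((1 - α) / α) := by
    intro x hx
    rw [← Real.rpow_natCast, ← Real.rpow_mul hx]
    congr 1
    push_cast
    ring
  have h1 := rpow_sub_mul_le_of_integral_le hcont (fun t _ => sq_nonneg _)
    (σ := (1 - α) / α / 2) (by linarith) (by linarith)
    (K := C₀ * M * (b ^ 2) ^ ((1 - α) / α / 2))
    (mul_nonneg (mul_nonneg hC₀ hM) (Real.rpow_nonneg (sq_nonneg _) _)) h ht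
  simp only [hpow _ (hn _), hpow _ hb] at h1
  have hbp := Real.rpow_nonneg hb ((1 - α) / α)
  have h2 : n 0 ^ ((1 - α) / α) - t * ((1 - α) / α) * C * b ^ ((1 - α) / α) * M
      ≤ n t ^ ((1 - α) / α) := by
    refine le_trans ?_ h1
    have : C₀ * (((1 - α) / α) * t * M * b ^ ((1 - α) / α))
        ≤ C * (((1 - α) / α) * t * M * b ^ ((1 - α) / α)) :=
      mul_le_mul_of_nonneg_right hC (by positivity)
    linarith
  have h3 : max (n 0 ^ ((1 - α) / α) - t * ((1 - α) / α) * C * b ^ ((1 - α) / α) * M) 0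
      ≤ n t ^ ((1 - α) / α) := max_le h2 (Real.rpow_nonneg (hn t) _)
  refine (Real.rpow_le_rpow (le_max_right _ _) h3 (div_nonneg hα0.le (by linarith))).trans_eq ?_
  rw [← Real.rpow_mul (hn t)]
  have : (1 - α) / α * (α / (1 - α)) = 1 := by
    have : 1 - α ≠ 0 := by linarith
    field_simp
  rw [this, Real.rpow_one]

end RateBounds

end VectorMixing

end

noncomputable section

namespace VectorMixing

open scoped ComplexConjugate

/-! ### The lower bound for the spectral approximations -/

section SpectralBound

variable {d : ℕ} {L : ℝ} [hL : Fact (0 < L)]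

lemma ae_sobolevNorm_le {q : ℝ≥0∞} {V : ℝ → Torus d L → Vec d} (hV : supSobolevNorm q V < ⊤) :
    ∀ᵐ t ∂(volume.restrict (Ioi (0 : ℝ))),
      sobolevNorm q (V t) ≤ ENNReal.ofReal (supSobolevNorm q V).toReal := by
  rw [ENNReal.ofReal_toReal hV.ne]
  exact ENNReal.ae_le_essSup _

/-- Mere finiteness, from the finitely many modes, with a bound that depends on `N`. It ensures that
`toReal` of the norm of U_N is the actual norm. -/
lemma supSobolevNorm_truncate_lt_top {q : ℝ≥0∞} (hq : 1 ≤ q) {U : ℝ → Torus d L → Vec d}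
    (hU : supSobolevNorm q U < ⊤) (N : ℕ) : supSobolevNorm q (fun s => truncate N (U s)) < ⊤ := by
  obtain ⟨D, hD, hle⟩ := exists_sobolevNorm_trigPoly_le (d := d) (L := L) q N
    ((L ^ d)⁻¹ * ((supSobolevNorm q U).toReal *
      ((volume : Measure (Torus d L)) univ ^ (1 / (1 : ℝ≥0∞).toReal - 1 / q.toReal)).toReal))
  refine lt_of_le_of_lt (essSup_le_of_ae_le D ?_) hD
  filter_upwards [ae_sobolevNorm_le hU] with t ht
  exact hle _ fun k i => norm_coeff_le_of_eLpNorm_le hq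
    (integrable_of_sobolevNorm_lt_top (ht.trans_lt ENNReal.ofReal_lt_top)).1
    ENNReal.toReal_nonneg ((eLpNorm_le_sobolevNorm _ _).trans ht) k i

lemma isFourierDivFree_truncate {V : Torus d L → Vec d}
    (h : IsFourierDivFree fun j x => ((V x j : ℝ) : ℂ)) (N : ℕ) :
    IsFourierDivFree fun j x => ((truncate N V x j : ℝ) : ℂ) := by
  intro k
  have h1 : ∀ j, cCoeff (fun x => ((truncate N V x j : ℝ) : ℂ)) k
      = if k ∈ freqBox d N then cCoeff (fun x => ((V x j : ℝ) : ℂ)) k else 0 := fun j =>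
    (isHermitian_coeff V).coeff_trigPoly N k j
  simp only [h1]
  split_ifs
  · exact h k
  · simp

lemma integrable_truncate (N : ℕ) (V : Torus d L → Vec d) : Integrable (truncate N V) :=
  memLp_one_iff_integrable.1 (memLp_of_continuous_vec (continuous_trigPoly N _) 1)

lemma ae_isFourierDivFree {q : ℝ≥0∞} {U : ℝ → Torus d L → Vec d} (hU : supSobolevNorm q U < ⊤)
    (hdiv : ∀ᵐ t ∂(volume.restrict (Ioi (0 : ℝ))), IsDivFree (U t)) :
    ∀ᵐ t ∂(volume.restrict (Ioi (0 : ℝ))), IsFourierDivFree fun j x => ((U t x j : ℝ) : ℂ) := by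
  filter_upwards [ae_sobolevNorm_le hU, hdiv] with t ht hd
  exact hd.isFourierDivFree (integrable_of_sobolevNorm_lt_top (ht.trans_lt ENNReal.ofReal_lt_top))

/-- A property of almost all positive times in an interval. -/
lemma ae_Ioc_of_ae_Ioi {P : ℝ → Prop} (h : ∀ᵐ t ∂(volume.restrict (Ioi (0 : ℝ))), P t) {s : ℝ}
    (hs : 0 ≤ s) (t : ℝ) : ∀ᵐ r, r ∈ Ioc s t → P r := by
  rw [ae_restrict_iff' measurableSet_Ioi] at h
  filter_upwards [h] with r hr hr'
  exact hr (hs.trans_lt hr'.1)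

variable {N : ℕ} {U : ℝ → Torus d L → Vec d} {u₀ : Torus d L → Vec d} {w : ℝ → Torus d L → Vec d}

lemma IsSpectralSolution.energy_sub_eq (h : IsSpectralSolution N U u₀ w) (η : (Fin d → ℤ) → ℝ)
    {s t : ℝ} (hs : 0 ≤ s) (hst : s ≤ t) :
    L ^ d * ∑ k ∈ freqBox d N, η k * ∑ i, ‖coeff (w t) k i‖ ^ 2
      - L ^ d * ∑ k ∈ freqBox d N, η k * ∑ i, ‖coeff (w s) k i‖ ^ 2
      = ∫ r in s..t, -(2 * (transportForm (fun j x => truncate N (U r) x j) (freqBox d N) η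
          (coeff (w r))).re) := by
  rw [← mul_sub, weightedEnergy_sub_eq (F := spectralRate N U w)
    (fun k hk i t ht => h.intervalIntegrable_rate hk i ht) (fun k hk i t ht => h.coeff_eq hk i ht)
    (fun k _ t ht => h.sum_coeff_mul ht k) hs hst, ← intervalIntegral.integral_const_mul]
  refine intervalIntegral.integral_congr fun r hr => ?_
  rw [uIcc_of_le hst] at hr
  have h1 : ∀ l i, (L : ℂ) ^ d * spectralRate N U w r l i = ∑ k ∈ freqBox d N, coeff (w r) k i *
      transportMatrix (fun j x => ((truncate N (U r) x j : ℝ) : ℂ)) k l := by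
    intro l i
    rw [← coeff_transport_trigPoly (integrable_truncate N (U r)) (isHermitian_coeff (w r)),
      ← h.eq_trigPoly (hs.trans hr.1), spectralRate]
  simp only [transportForm, ← h1]
  rw [mul_neg, mul_left_comm, ← Complex.re_ofReal_mul]
  push_cast
  simp only [Finset.mul_sum]
  congr 4
  funext k
  refine Finset.sum_congr rfl fun i _ => ?_
  ring

lemma IsSpectralSolution.memLp (h : IsSpectralSolution N U u₀ w) {t : ℝ} (ht : 0 ≤ t)
    (p : ℝ≥0∞) : MemLp (w t) p := by
  rw [h.eq_trigPoly ht]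
  exact memLp_of_continuous_vec (continuous_trigPoly N _) p

lemma IsSpectralSolution.l2Norm_sq_eq (h : IsSpectralSolution N U u₀ w) {t : ℝ} (ht : 0 ≤ t) :
    l2Norm (w t) ^ 2 = L ^ d * ∑ k ∈ freqBox d N, ∑ i, ‖coeff (w t) k i‖ ^ 2 := by
  rw [← (hasSum_norm_sq_coeff (h.memLp ht 2)).tsum_eq, tsum_mul_left, tsum_eq_sum]
  intro k hk
  simp [h.coeff_eq_zero ht hk]

lemma IsSpectralSolution.negSobolevNorm_sq_eq (h : IsSpectralSolution N U u₀ w) (α : ℝ) {t : ℝ}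
    (ht : 0 ≤ t) :
    negSobolevNorm α (w t) ^ 2
      = L ^ d * ∑ k ∈ freqBox d N, waveNorm L k ^ (-2 * α) * ∑ i, ‖coeff (w t) k i‖ ^ 2 := by
  rw [negSobolevNorm_sq, tsum_eq_sum]
  intro k hk
  simp [h.coeff_eq_zero ht hk]

/-- Conservation of the `L²` norm. -/
lemma IsSpectralSolution.l2Norm_eq (h : IsSpectralSolution N U u₀ w)
    (hdiv : ∀ᵐ t ∂(volume.restrict (Ioi (0 : ℝ))),
      IsFourierDivFree fun j x => ((U t x j : ℝ) : ℂ)) {t : ℝ} (ht : 0 ≤ t) :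
    l2Norm (w t) = l2Norm (w 0) := by
  have h1 := h.energy_sub_eq (fun _ => 1) le_rfl ht
  simp only [one_mul] at h1
  rw [← h.l2Norm_sq_eq ht, ← h.l2Norm_sq_eq le_rfl,
    intervalIntegral.integral_congr_ae (g := fun _ => (0 : ℝ)),
    intervalIntegral.integral_zero, sub_eq_zero] at h1
  · exact (sq_eq_sq₀ (l2Norm_nonneg _) (l2Norm_nonneg _)).1 h1
  · rw [uIoc_of_le ht]
    filter_upwards [ae_Ioc_of_ae_Ioi hdiv le_rfl t] with r hr hr'
    rw [re_transportForm_one (isFourierDivFree_truncate (hr hr') N), mul_zero, neg_zero]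

lemma IsSpectralSolution.continuousOn_coeff (h : IsSpectralSolution N U u₀ w) (k : Fin d → ℤ)
    (i : Fin d) : ContinuousOn (fun t => coeff (w t) k i) (Ici 0) := by
  by_cases hk : k ∈ freqBox d N
  · exact continuousOn_of_eq_sub_integral (fun t ht => h.intervalIntegrable_rate hk i ht)
      fun t ht => h.coeff_eq hk i ht
  · exact continuousOn_const.congr fun t ht => h.coeff_eq_zero ht hk i

/-- The energy identity with weight κ^{-2α}, κ being the wave length, is estimated by the commutator
bound for U_N, whose Hölder constant is (2/α + 2) times its Sobolev norm. Conservation of the `L²`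
norm freezes the other factor, and the Gronwall inequality concludes. -/
theorem IsSpectralSolution.lowerBound_le (h : IsSpectralSolution N U u₀ w) (hd : 1 ≤ d) {α : ℝ}
    (hα : 1 / 2 ≤ α) (hα1 : α < 1) {q : ℝ≥0∞} (hq2 : 2 ≤ q) (hq : d / q.toReal ≤ 1 - α)
    (hU : supSobolevNorm q U < ⊤)
    (hdiv : ∀ᵐ t ∂(volume.restrict (Ioi (0 : ℝ))), IsDivFree (U t))
    {C : ℝ} (hC : commutatorConst hd α * (2 / α + 2) ≤ C) {t : ℝ} (ht : 0 ≤ t) :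
    lowerBound α C (negSobolevNorm α (w 0)) (l2Norm (w 0))
      (supSobolevNorm q (fun s => truncate N (U s))).toReal t ≤ negSobolevNorm α (w t) := by
  have hα0 : 0 < α := by linarith
  have hdivF := ae_isFourierDivFree hU hdiv
  have hA := ae_sobolevNorm_le
    (supSobolevNorm_truncate_lt_top (le_trans (by norm_num) hq2) hU N)
  set A := (supSobolevNorm q (fun s => truncate N (U s))).toReal with hAd
  have hA0 : 0 ≤ A := ENNReal.toReal_nonneg
  have hcont : ContinuousOn (fun t => negSobolevNorm α (w t) ^ 2) (Ici 0) := by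
    refine ContinuousOn.congr (f := fun t => L ^ d * ∑ k ∈ freqBox d N,
      waveNorm L k ^ (-2 * α) * ∑ i, ‖coeff (w t) k i‖ ^ 2) ?_
      fun t ht => h.negSobolevNorm_sq_eq α ht
    refine continuousOn_const.mul (continuousOn_finsetSum _ fun k _ => continuousOn_const.mul
      (continuousOn_finsetSum _ fun i _ => ((h.continuousOn_coeff k i).norm.pow 2)))
  refine lowerBound_le_of_integral_le hα hα1
    (mul_nonneg (commutatorConst_nonneg hd hα0 hα1) (by positivity)) hC hA0 (l2Norm_nonneg _)
    (fun t => negSobolevNorm_nonneg α (w t)) hcont (fun s t hs hst => ?_) ht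
  have ht' := hs.trans hst
  have h1 := h.energy_sub_eq (fun k => waveNorm L k ^ (-2 * α)) hs hst
  rw [← h.negSobolevNorm_sq_eq α hs, ← h.negSobolevNorm_sq_eq α ht'] at h1
  rw [← neg_sub, h1, ← intervalIntegral.integral_neg]
  -- Integrability of the rate need not be proved: otherwise its integral is `0` by convention, and
  -- the bound is trivial because the right side is nonnegative.
  by_cases hi : IntervalIntegrable (fun r => -(2 * (transportForm
      (fun j x => truncate N (U r) x j) (freqBox d N) (fun k => waveNorm L k ^ (-2 * α))
          (coeff (w r))).re)) volume s t
  · refine intervalIntegral.integral_mono_ae_restrict hst hi.neg ?_ ?_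
    · refine ContinuousOn.intervalIntegrable ?_
      rw [uIcc_of_le hst]
      refine continuousOn_const.mul (ContinuousOn.rpow_const (hcont.mono fun x hx => hs.trans hx.1)
        fun x _ => Or.inr ?_)
      have : (1 - α) / α ≤ 1 := (div_le_one hα0).2 (by linarith)
      linarith
    · rw [EventuallyLE, ← restrict_Ioc_eq_restrict_Icc, ae_restrict_iff' measurableSet_Ioc]
      filter_upwards [ae_Ioc_of_ae_Ioi hdivF hs t, ae_Ioc_of_ae_Ioi hA hs t] with r hr1 hr2 hr
      have hr0 : 0 ≤ r := hs.trans hr.1.le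
      have h2 := abs_re_transportForm_le (U := fun j x => truncate N (U r) x j) hd hα hα1
        (fun j => integrable_component (integrable_truncate N (U r)) j)
        (isFourierDivFree_truncate (hr1 hr) N) (M := (2 / α + 2) * A) (by positivity)
        (fun h j => ae_norm_increment_le hq2 hα0 hq hA0 (hr2 hr) h j) (freqBox d N) (coeff (w r))
      rw [← h.l2Norm_sq_eq hr0, ← h.negSobolevNorm_sq_eq α hr0, h.l2Norm_eq hdivF hr0] at h2
      have h3 := (le_abs_self _).trans h2
      simp only [neg_neg]
      linarith
  · rw [intervalIntegral.integral_undef (fun hn => hi (hn.neg.congr fun r _ => neg_neg _))]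
    refine intervalIntegral.integral_nonneg hst fun r _ => ?_
    have := commutatorConst_nonneg hd hα0 hα1
    positivity

/-- q(1 - α) > d ≥ 1 forces 1 - α > 0, and 1 - α ≤ 1/2 then forces q ≥ 2, so Sobolev fields are in
`L²` and Parseval applies to them. For q = ∞ the last condition reads 0 ≤ 1 - α. -/
lemma exponent_conditions (hd : 1 ≤ d) {α : ℝ} (hα : 1 / 2 ≤ α) {q : ℝ≥0∞}
    (hq : (q ≠ ⊤ ∧ (d : ℝ) < q.toReal * (1 - α)) ∨ (q = ⊤ ∧ α < 1)) :
    α < 1 ∧ 2 ≤ q ∧ d / q.toReal ≤ 1 - α := by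
  rcases hq with ⟨hq, h⟩ | ⟨rfl, h⟩
  · have hd' : (1 : ℝ) ≤ d := by exact_mod_cast hd
    have h0 : 0 < 1 - α := by
      by_contra hn
      have := mul_nonpos_of_nonneg_of_nonpos (ENNReal.toReal_nonneg (a := q)) (not_lt.1 hn)
      linarith
    have h2 : 2 ≤ q.toReal := by
      by_contra hn
      have : q.toReal * (1 - α) ≤ 2 * (1 / 2) :=
        mul_le_mul (not_le.1 hn).le (by linarith) h0.le zero_le_two
      linarith
    refine ⟨by linarith, ?_, ?_⟩
    · rw [← ENNReal.ofReal_toReal hq, ← ENNReal.ofReal_ofNat]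
      exact ENNReal.ofReal_le_ofReal h2
    · rw [div_le_iff₀ (by linarith), mul_comm]
      exact h.le
  · refine ⟨h, le_top, ?_⟩
    simp only [ENNReal.toReal_top, div_zero]
    linarith

end SpectralBound

end VectorMixing

end

noncomputable section

namespace VectorMixing

open scoped ComplexConjugate

/-! ### Series with weights vanishing at infinity -/

section Weights

lemma tsum_mul_le_sum_add {ι : Type*} {η a : ι → ℝ} (hη : ∀ i, 0 ≤ η i)
    (ha : ∀ i, 0 ≤ a i) {B δ : ℝ} (hδ : 0 ≤ δ) (hB : ∀ S : Finset ι, ∑ i ∈ S, a i ≤ B)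
    (T : Finset ι) (hT : ∀ i ∉ T, η i ≤ δ) :
    ∑' i, η i * a i ≤ ∑ i ∈ T, η i * a i + δ * B := by
  classical
  have hB0 : 0 ≤ B := by simpa using hB ∅
  have hηa : ∀ i, 0 ≤ η i * a i := fun i => mul_nonneg (hη i) (ha i)
  refine Real.tsum_le_of_sum_le hηa fun S => ?_
  calc ∑ i ∈ S, η i * a i ≤ ∑ i ∈ S, ((if i ∈ T then η i * a i else 0) + δ * a i) := by
        refine Finset.sum_le_sum fun i _ => ?_
        split_ifs with h
        · exact le_add_of_nonneg_right (mul_nonneg hδ (ha i))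
        · rw [zero_add]
          exact mul_le_mul_of_nonneg_right (hT i h) (ha i)
    _ ≤ _ := by
        rw [Finset.sum_add_distrib, ← Finset.mul_sum, ← Finset.sum_filter]
        refine add_le_add ?_ (mul_le_mul_of_nonneg_left (hB S) hδ)
        exact Finset.sum_le_sum_of_subset_of_nonneg (fun i hi => (Finset.mem_filter.1 hi).2)
          fun i _ _ => hηa i

lemma summable_mul_of_sum_le {ι : Type*} {η a : ι → ℝ} {W B : ℝ} (hη : ∀ i, 0 ≤ η i)
    (hW : ∀ i, η i ≤ W) (ha : ∀ i, 0 ≤ a i) (hB : ∀ S : Finset ι, ∑ i ∈ S, a i ≤ B) :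
    Summable fun i => η i * a i :=
  Summable.of_nonneg_of_le (fun i => mul_nonneg (hη i) (ha i))
    (fun i => mul_le_mul_of_nonneg_right (hW i) (ha i))
    ((summable_of_sum_le ha hB).mul_left W)

/-- Sums with weights vanishing at infinity are continuous along bounded families. -/
lemma tendsto_tsum_mul_of_sum_le {ι β : Type*} {l : Filter β} {η : ι → ℝ} {W : ℝ}
    (hη : ∀ i, 0 ≤ η i) (hW : ∀ i, η i ≤ W) (hη0 : Tendsto η cofinite (𝓝 0))
    {a : β → ι → ℝ} {a₀ : ι → ℝ} {B : ℝ} (ha : ∀ᶠ b in l, ∀ i, 0 ≤ a b i)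
    (hB : ∀ᶠ b in l, ∀ S : Finset ι, ∑ i ∈ S, a b i ≤ B) (ha₀ : ∀ i, 0 ≤ a₀ i)
    (hB₀ : ∀ S : Finset ι, ∑ i ∈ S, a₀ i ≤ B) (hlim : ∀ i, Tendsto (fun b => a b i) l (𝓝 (a₀ i))) :
    Tendsto (fun b => ∑' i, η i * a b i) l (𝓝 (∑' i, η i * a₀ i)) := by
  have hB0 : 0 ≤ B := by simpa using hB₀ ∅
  rw [Metric.tendsto_nhds]
  intro ε hε
  -- Makes the contribution δB of the indices with small weight less than ε/2; the added 1 allows B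
  -- = 0.
  set δ := ε / (2 * (B + 1)) with hδ
  have hδ0 : 0 < δ := by positivity
  have hδB : δ * B < ε / 2 := by
    rw [hδ, div_mul_eq_mul_div, div_lt_div_iff₀ (by positivity) two_pos]
    nlinarith
  have hfin : {i | ¬ η i ≤ δ}.Finite := by
    have := hη0.eventually (Iic_mem_nhds hδ0)
    exact this
  set T := hfin.toFinset with hTd
  have hT : ∀ i ∉ T, η i ≤ δ := fun i hi => by simpa [hTd] using hi
  have hsum : Tendsto (fun b => ∑ i ∈ T, η i * a b i) l (𝓝 (∑ i ∈ T, η i * a₀ i)) :=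
    tendsto_finsetSum _ fun i _ => (hlim i).const_mul _
  filter_upwards [ha, hB, (Metric.tendsto_nhds.1 hsum) (ε / 2) (by linarith)] with b hb1 hb2 hb3
  have h1 := tsum_mul_le_sum_add hη hb1 hδ0.le hb2 T hT
  have h2 := tsum_mul_le_sum_add hη ha₀ hδ0.le hB₀ T hT
  have h3 := (summable_mul_of_sum_le hη hW hb1 hb2).sum_le_tsum T
    fun i _ => mul_nonneg (hη i) (hb1 i)
  have h4 := (summable_mul_of_sum_le hη hW ha₀ hB₀).sum_le_tsum T
    fun i _ => mul_nonneg (hη i) (ha₀ i)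
  rw [Real.dist_eq, abs_lt] at hb3 ⊢
  constructor <;> linarith [hb3.1, hb3.2]

variable {d : ℕ} {L : ℝ} [hL : Fact (0 < L)]

lemma tendsto_freqBox : Tendsto (freqBox d) atTop atTop := by
  refine tendsto_atTop_finset_of_monotone (fun m n hmn k hk => ?_) fun k => ?_
  · rw [mem_freqBox] at hk ⊢
    exact fun i => (hk i).trans (by exact_mod_cast hmn)
  · refine ⟨∑ i, (k i).natAbs, mem_freqBox.2 fun i => ?_⟩
    rw [Int.abs_eq_natAbs]
    exact_mod_cast Finset.single_le_sum (f := fun i => (k i).natAbs) (fun _ _ => Nat.zero_le _)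
      (Finset.mem_univ i)

lemma abs_le_freqNorm (k : Fin d → ℤ) (i : Fin d) : |(k i : ℝ)| ≤ freqNorm k := by
  rw [freqNorm, ← Real.sqrt_sq_eq_abs]
  exact Real.sqrt_le_sqrt (Finset.single_le_sum (f := fun i => (k i : ℝ) ^ 2)
    (fun _ _ => sq_nonneg _) (Finset.mem_univ i))

lemma one_le_freqNorm {k : Fin d → ℤ} (hk : k ≠ 0) : 1 ≤ freqNorm k := by
  obtain ⟨i, hi⟩ := Function.ne_iff.1 hk
  refine le_trans ?_ (abs_le_freqNorm k i)
  exact_mod_cast Int.one_le_abs hi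

lemma tendsto_freqNorm : Tendsto (freqNorm : (Fin d → ℤ) → ℝ) cofinite atTop := by
  rw [tendsto_atTop]
  intro b
  refine (freqBox d ⌈b⌉₊).finite_toSet.subset fun k hk => ?_
  have hk' : freqNorm k < b := not_le.1 hk
  refine Finset.mem_coe.2 (mem_freqBox.2 fun i => ?_)
  have h1 : |(k i : ℝ)| ≤ ⌈b⌉₊ := (abs_le_freqNorm k i).trans (hk'.le.trans (Nat.le_ceil b))
  exact_mod_cast h1

lemma tendsto_waveNorm_rpow {α : ℝ} (hα : 0 < α) :
    Tendsto (fun k : Fin d → ℤ => waveNorm L k ^ (-2 * α)) cofinite (𝓝 0) := by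
  have h1 : Tendsto (fun k : Fin d → ℤ => waveNorm L k) cofinite atTop :=
    tendsto_freqNorm.const_mul_atTop two_pi_div_pos
  have h2 := (tendsto_rpow_neg_atTop (y := 2 * α) (by linarith)).comp h1
  simpa only [neg_mul, Function.comp_def] using h2

lemma waveNorm_rpow_le {s : ℝ} (hs : s ≤ 0) {k : Fin d → ℤ} (hk : k ≠ 0) :
    waveNorm L k ^ s ≤ (2 * Real.pi / L) ^ s :=
  Real.rpow_le_rpow_of_nonpos two_pi_div_pos
    (le_mul_of_one_le_right two_pi_div_pos.le (one_le_freqNorm hk)) hs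

lemma waveNorm_rpow_le' {α : ℝ} (hα : 0 < α) (k : Fin d → ℤ) :
    waveNorm L k ^ (-2 * α) ≤ (2 * Real.pi / L) ^ (-2 * α) := by
  rcases eq_or_ne k 0 with rfl | hk
  · rw [waveNorm_zero, Real.zero_rpow (by linarith)]
    exact Real.rpow_nonneg two_pi_div_pos.le _
  · exact waveNorm_rpow_le (by linarith) hk

end Weights

/-! ### Fourier tails and `L²` fields with prescribed coefficients -/

section Tails

variable {d : ℕ} {L : ℝ} [hL : Fact (0 < L)]

lemma memLp_sub_trigSum {f : Torus d L → ℂ} (hf : MemLp f 2) (S : Finset (Fin d → ℤ))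
    (c : (Fin d → ℤ) → ℂ) : MemLp (fun x => f x - trigSum S c x) 2 :=
  hf.sub (memLp_of_continuous (continuous_trigSum S c) 2)

lemma integral_norm_sq_sub_trigSum {f : Torus d L → ℂ} (hf : MemLp f 2)
    (S : Finset (Fin d → ℤ)) :
    ∫ x, ‖f x - trigSum S (cCoeff f) x‖ ^ 2
      = (∫ x, ‖f x‖ ^ 2) - L ^ d * ∑ k ∈ S, ‖cCoeff f k‖ ^ 2 := by
  classical
  have h1 := hasSum_norm_sq_cCoeff (memLp_sub_trigSum hf S (cCoeff f))
  have h2 : HasSum (fun k => if k ∈ S then L ^ d * ‖cCoeff f k‖ ^ 2 else 0)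
      (L ^ d * ∑ k ∈ S, ‖cCoeff f k‖ ^ 2) := by
    rw [Finset.mul_sum, ← Finset.sum_congr rfl fun k hk => if_pos (c := k ∈ S)
      (t := L ^ d * ‖cCoeff f k‖ ^ 2) (e := 0) hk]
    exact hasSum_sum_of_ne_finset_zero fun k hk => if_neg hk
  refine h1.unique (((hasSum_norm_sq_cCoeff hf).sub h2).congr_fun fun k => ?_)
  rw [cCoeff_sub (hf.integrable one_le_two) (integrable_of_continuous (continuous_trigSum S _)),
    cCoeff_trigSum]
  split_ifs <;> simp

lemma tendsto_integral_norm_sq_sub_trigSum {f : Torus d L → ℂ} (hf : MemLp f 2) :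
    Tendsto (fun N => ∫ x, ‖f x - trigSum (freqBox d N) (cCoeff f) x‖ ^ 2) atTop (𝓝 0) := by
  simp only [integral_norm_sq_sub_trigSum hf]
  have h1 : Tendsto (fun N => ∑ k ∈ freqBox d N, L ^ d * ‖cCoeff f k‖ ^ 2) atTop
      (𝓝 (∫ x, ‖f x‖ ^ 2)) := (hasSum_norm_sq_cCoeff hf).comp tendsto_freqBox
  simp only [← Finset.mul_sum] at h1
  have h2 := h1.const_sub (∫ x, ‖f x‖ ^ 2)
  rwa [sub_self] at h2

lemma integral_norm_sq_component_le {f : Torus d L → Vec d} (hf : MemLp f 2) (i : Fin d) :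
    ∫ x, ‖((f x i : ℝ) : ℂ)‖ ^ 2 ≤ l2Norm f ^ 2 := by
  rw [l2Norm_sq hf]
  refine integral_mono ((memLp_component hf i).integrable_norm_pow (by simp))
    (hf.integrable_norm_pow (by simp)) fun x => ?_
  change ‖((f x i : ℝ) : ℂ)‖ ^ 2 ≤ ‖f x‖ ^ 2
  rw [Complex.norm_real]
  exact pow_le_pow_left₀ (norm_nonneg _) (PiLp.norm_apply_le (f x) i) 2

lemma sqrt_integral_norm_sq_component_le {f : Torus d L → Vec d} (hf : MemLp f 2) (i : Fin d) :
    √(∫ x, ‖((f x i : ℝ) : ℂ)‖ ^ 2) ≤ l2Norm f :=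
  Real.sqrt_le_iff.2 ⟨l2Norm_nonneg f, integral_norm_sq_component_le hf i⟩

lemma continuous_single_vec (i : Fin d) :
    Continuous fun r : ℝ => (EuclideanSpace.single i r : Vec d) :=
  (PiLp.continuous_toLp 2 _).comp (continuous_single (A := fun _ : Fin d => ℝ) i)

lemma memLp_of_memLp_component {f : Torus d L → Vec d} {p : ℝ≥0∞}
    (hf : ∀ i, MemLp (fun x => f x i) p) : MemLp f p := by
  have h1 : f = fun x => ∑ i, EuclideanSpace.single i (f x i) := by
    funext x
    ext j
    simp
  rw [h1]
  refine memLp_finsetSum _ fun i _ => ?_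
  refine MemLp.of_le (hf i) ?_ (ae_of_all _ fun x => by simp)
  exact (continuous_single_vec i).comp_aestronglyMeasurable (hf i).1

/-- Riesz–Fischer for real vector fields. -/
lemma IsHermitian.exists_memLp_coeff_eq {c : (Fin d → ℤ) → Fin d → ℂ} (hc : IsHermitian c)
    (hs : ∀ i, Summable fun k => ‖c k i‖ ^ 2) :
    ∃ f : Torus d L → Vec d, MemLp f 2 ∧ ∀ k i, coeff f k i = c k i := by
  choose g hg hgc using fun i => exists_memLp_cCoeff_eq (d := d) (L := L) (hs i)
  refine ⟨fun x => WithLp.toLp 2 fun i => (g i x).re,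
    memLp_of_memLp_component fun i => (hg i).re, fun k i => ?_⟩
  have hgi : Integrable (g i) := (hg i).integrable one_le_two
  have hgi' : Integrable fun x => conj (g i x) := by
    simpa using (Complex.conjCLE.toContinuousLinearMap.integrable_comp hgi)
  -- Taking real parts averages c_k with conj c_{-k}, which coincide for Hermitian coefficients.
  have h1 : (fun x => (((g i x).re : ℝ) : ℂ)) = fun x => (1 / 2 : ℂ) * (g i x + conj (g i x)) := by
    funext x
    rw [Complex.add_conj]
    push_cast
    ring
  rw [coeff_eq_cCoeff]
  change cCoeff (fun x => (((g i x).re : ℝ) : ℂ)) k = _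
  rw [h1, cCoeff_const_mul, cCoeff_add hgi hgi', cCoeff_conj, hgc, hgc, hc, Complex.conj_conj]
  ring

lemma ae_eq_of_coeff_eq {f g : Torus d L → Vec d} (hf : MemLp f 2) (hg : MemLp g 2)
    (h : ∀ k i, coeff f k i = coeff g k i) : f =ᵐ[volume] g := by
  have h1 : ∀ i, (fun x => ((f x i : ℝ) : ℂ)) =ᵐ[volume] fun x => ((g x i : ℝ) : ℂ) := fun i =>
    ae_eq_of_cCoeff_eq (memLp_component hf i) (memLp_component hg i) fun k => h k i
  filter_upwards [ae_all_iff.2 h1] with x hx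
  ext i
  exact_mod_cast hx i

lemma coeff_congr_ae {f g : Torus d L → Vec d} (h : f =ᵐ[volume] g) (k : Fin d → ℤ) (i : Fin d) :
    coeff f k i = coeff g k i := by
  rw [coeff_eq_cCoeff, coeff_eq_cCoeff]
  refine cCoeff_congr_ae ?_ k
  filter_upwards [h] with x hx
  rw [hx]

lemma coeff_sub {f g : Torus d L → Vec d} (hf : Integrable f) (hg : Integrable g)
    (k : Fin d → ℤ) (i : Fin d) : coeff (f - g) k i = coeff f k i - coeff g k i := by
  rw [coeff_eq_cCoeff, coeff_eq_cCoeff, coeff_eq_cCoeff,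
    ← cCoeff_sub (f := fun x => ((f x i : ℝ) : ℂ)) (g := fun x => ((g x i : ℝ) : ℂ))
      (integrable_component hf i).ofReal (integrable_component hg i).ofReal]
  congr 1
  funext x
  simp

end Tails

/-! ### The flux, a form of the transport term for merely square-integrable fields -/

section Flux

variable {d : ℕ} {L : ℝ} [hL : Fact (0 < L)]

/-- The Fourier coefficients of `div (f ⊗ V)`. -/
def fluxCoeff (V f : Torus d L → Vec d) (k : Fin d → ℤ) (i : Fin d) : ℂ :=
  ∑ j, Complex.I * wave L k j * cCoeff (fun x => ((V x j : ℝ) : ℂ) * ((f x i : ℝ) : ℂ)) k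

lemma fluxCoeff_congr_ae {V f g : Torus d L → Vec d} (h : f =ᵐ[volume] g) (k : Fin d → ℤ)
    (i : Fin d) : fluxCoeff V f k i = fluxCoeff V g k i := by
  refine Finset.sum_congr rfl fun j _ => ?_
  congr 1
  refine cCoeff_congr_ae ?_ k
  filter_upwards [h] with x hx
  rw [hx]

lemma cCoeff_mul_trigSum {w : Torus d L → ℂ} (hw : Integrable w) (S : Finset (Fin d → ℤ))
    (c : (Fin d → ℤ) → ℂ) (l : Fin d → ℤ) :
    cCoeff (fun x => w x * trigSum S c x) l = ∑ k ∈ S, c k * cCoeff w (l - k) := by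
  have h1 : (fun x => w x * trigSum S c x) = fun x => ∑ k ∈ S, c k * (w x * character k x) := by
    funext x
    rw [trigSum, Finset.mul_sum]
    exact Finset.sum_congr rfl fun k _ => by ring
  rw [h1, cCoeff_sum _ fun k _ => (integrable_mul_character hw k).const_mul _]
  simp only [cCoeff_const_mul, cCoeff_mul_character]

lemma side_mul_sum_cCoeff_mul_trigSum {W : Fin d → Torus d L → ℂ} (hW : ∀ j, Integrable (W j))
    (hdiv : IsFourierDivFree W) (S : Finset (Fin d → ℤ)) (c : (Fin d → ℤ) → ℂ) (l : Fin d → ℤ) :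
    (L : ℂ) ^ d * ∑ j, Complex.I * wave L l j * cCoeff (fun x => W j x * trigSum S c x) l
      = ∑ k ∈ S, c k * transportMatrix W k l := by
  simp only [cCoeff_mul_trigSum (hW _), hdiv.transportMatrix_eq, Finset.mul_sum]
  rw [Finset.sum_comm]
  refine Finset.sum_congr rfl fun k _ => Finset.sum_congr rfl fun j _ => ?_
  ring

/-- For a divergence-free field (V·∇)f = div(f ⊗ V). The right side needs no derivative of f and
survives in the weak limit. -/
lemma coeff_transport_eq_fluxCoeff {V : Torus d L → Vec d} (hV : Integrable V)
    (hdiv : IsFourierDivFree fun j x => ((V x j : ℝ) : ℂ)) {N : ℕ}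
    {c : (Fin d → ℤ) → Fin d → ℂ} (hc : IsHermitian c) (l : Fin d → ℤ) (i : Fin d) :
    coeff (transport V (trigPoly N c)) l i = fluxCoeff V (trigPoly N c) l i := by
  rw [← mul_right_inj' (side_pow_ne_zero (d := d) (L := L)), coeff_transport_trigPoly hV hc,
    fluxCoeff]
  simp only [hc.trigPoly_apply]
  exact (side_mul_sum_cCoeff_mul_trigSum (fun j => (integrable_component hV j).ofReal) hdiv _
    (fun k => c k i) l).symm

lemma norm_cCoeff_mul_le {f g : Torus d L → ℂ} (hf : MemLp f 2) (hg : MemLp g 2)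
    (k : Fin d → ℤ) :
    ‖cCoeff (fun x => f x * g x) k‖
      ≤ (L ^ d)⁻¹ * (√(∫ x, ‖f x‖ ^ 2) * √(∫ x, ‖g x‖ ^ 2)) := by
  have hLd := side_pow_pos (d := d) (L := L)
  have hg' : MemLp (fun x => conj (g x)) 2 :=
    ⟨Complex.continuous_conj.comp_aestronglyMeasurable hg.1,
      (eLpNorm_congr_norm_ae (ae_of_all _ fun x => RCLike.norm_conj (g x))).trans_lt hg.2⟩
  have h1 := norm_integral_mul_mul_conj_le (w := character (-k)) zero_le_one
    (ae_of_all _ fun x => (norm_character (-k) x).le) hf hg'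
  simp only [Complex.conj_conj, RCLike.norm_conj, one_mul] at h1
  have h2 : cCoeff (fun x => f x * g x) k
      = ((L : ℂ) ^ d)⁻¹ * ∫ x, character (-k) x * f x * g x := by
    rw [cCoeff]
    congr 2
    funext x
    ring
  rw [h2, norm_mul, norm_inv, norm_pow, Complex.norm_real, Real.norm_of_nonneg hL.out.le]
  exact mul_le_mul_of_nonneg_left h1 (inv_nonneg.2 hLd.le)

end Flux

end VectorMixing

end

noncomputable section

namespace VectorMixing

open scoped ComplexConjugate

/-! ### Weak-* convergence tested with bounded weights -/

section Pairing

variable {d : ℕ} {L : ℝ} [hL : Fact (0 < L)]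

lemma prod_restrict_Ioo_le (T : ℝ) :
    (volume.restrict (Ioo 0 T)).prod (volume : Measure (Torus d L))
      ≤ (volume.restrict (Ioi (0 : ℝ))).prod volume := by
  rw [← Measure.restrict_univ (μ := (volume : Measure (Torus d L))), Measure.prod_restrict,
    Measure.prod_restrict]
  exact Measure.restrict_mono (prod_mono Ioo_subset_Ioi_self subset_rfl) le_rfl

lemma aestronglyMeasurable_component {f : ℝ → Torus d L → Vec d} {μ : Measure (ℝ × Torus d L)}
    (hf : AEStronglyMeasurable (Function.uncurry f) μ) (i : Fin d) :
    AEStronglyMeasurable (fun p : ℝ × Torus d L => ((f p.1 p.2 i : ℝ) : ℂ)) μ :=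
  Complex.continuous_ofReal.comp_aestronglyMeasurable
    ((PiLp.continuous_apply 2 _ i).comp_aestronglyMeasurable hf)

variable {f : ℝ → Torus d L → Vec d} {G : ℝ → Torus d L → ℂ} {K b T : ℝ}

lemma aestronglyMeasurable_pairing {μ : Measure ℝ} [SFinite μ]
    (hf : AEStronglyMeasurable (Function.uncurry f) (μ.prod volume))
    (hG : AEStronglyMeasurable (Function.uncurry G) (μ.prod volume)) (i : Fin d) :
    AEStronglyMeasurable (fun s => ∫ x, ((f s x i : ℝ) : ℂ) * G s x) μ :=
  ((aestronglyMeasurable_component hf i).mul hG).integral_prod_right'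

lemma norm_pairing_le (hK : 0 ≤ K) {h : Torus d L → Vec d} {g : Torus d L → ℂ}
    (hh : MemLp h 2) (hg : ∀ᵐ x, ‖g x‖ ≤ K) (i : Fin d) :
    ‖∫ x, ((h x i : ℝ) : ℂ) * g x‖ ≤ K * (l2Norm h * √(L ^ d)) := by
  have h1 := norm_integral_mul_mul_conj_le hK hg (memLp_component hh i)
    (memLp_of_continuous (continuous_const (y := (1 : ℂ))) 2)
  have h2 : ∫ _x : Torus d L, ‖(1 : ℂ)‖ ^ 2 = L ^ d := by simp [volume_real_torus]
  rw [h2] at h1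
  simp only [map_one, mul_one] at h1
  simp only [mul_comm (Complex.ofReal _)]
  refine h1.trans (mul_le_mul_of_nonneg_left (mul_le_mul_of_nonneg_right ?_ (Real.sqrt_nonneg _)) hK)
  exact sqrt_integral_norm_sq_component_le hh i

lemma integrable_pairing (hK : 0 ≤ K)
    (hf : AEStronglyMeasurable (Function.uncurry f) ((volume.restrict (Ioo 0 T)).prod volume))
    (hG : AEStronglyMeasurable (Function.uncurry G) ((volume.restrict (Ioo 0 T)).prod volume))
    (hfb : ∀ᵐ s ∂(volume.restrict (Ioo 0 T)), MemLp (f s) 2 ∧ l2Norm (f s) ≤ b)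
    (hGb : ∀ᵐ s ∂(volume.restrict (Ioo 0 T)), ∀ᵐ x, ‖G s x‖ ≤ K) (i : Fin d) :
    IntegrableOn (fun s => ∫ x, ((f s x i : ℝ) : ℂ) * G s x) (Ioo 0 T) := by
  refine Integrable.of_bound (aestronglyMeasurable_pairing hf hG i) (K * (b * √(L ^ d))) ?_
  filter_upwards [hfb, hGb] with s h1 h2
  refine (norm_pairing_le hK h1.1 h2 i).trans ?_
  gcongr
  exact h1.2

lemma integral_inner_single_re (hK : 0 ≤ K)
    (hf : AEStronglyMeasurable (Function.uncurry f) ((volume.restrict (Ioo 0 T)).prod volume))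
    (hG : AEStronglyMeasurable (Function.uncurry G) ((volume.restrict (Ioo 0 T)).prod volume))
    (hfb : ∀ᵐ s ∂(volume.restrict (Ioo 0 T)), MemLp (f s) 2 ∧ l2Norm (f s) ≤ b)
    (hGb : ∀ᵐ s ∂(volume.restrict (Ioo 0 T)), ∀ᵐ x, ‖G s x‖ ≤ K) (i : Fin d) :
    ∫ s in Ioo 0 T, ∫ x, inner ℝ (f s x) (EuclideanSpace.single i (G s x).re)
      = (∫ s in Ioo 0 T, ∫ x, ((f s x i : ℝ) : ℂ) * G s x).re := by
  have h1 := Complex.reCLM.integral_comp_comm (integrable_pairing hK hf hG hfb hGb i)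
  simp only [Complex.reCLM_apply] at h1
  rw [← h1]
  refine integral_congr_ae ?_
  filter_upwards [hfb, hGb, hG.prodMk_left] with s hs1 hs2 hs3
  have hint : Integrable fun x => ((f s x i : ℝ) : ℂ) * G s x :=
    ((memLp_component hs1.1 i).integrable one_le_two).mul_bdd (c := K) hs3 hs2
  have h2 := Complex.reCLM.integral_comp_comm hint
  simp only [Complex.reCLM_apply] at h2
  rw [← h2]
  refine integral_congr_ae (ae_of_all _ fun x => ?_)
  simp [EuclideanSpace.inner_single_right, mul_comm]

lemma IsWeakStarLimit.ae_memLp {v : ℕ → ℝ → Torus d L → Vec d} {u : ℝ → Torus d L → Vec d}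
    (h : IsWeakStarLimit v u) (hT : 0 < T) :
    ∃ b, ∀ᵐ s ∂(volume.restrict (Ioo 0 T)), MemLp (u s) 2 ∧ l2Norm (u s) ≤ b := by
  have h1 := h.bounded T hT
  refine ⟨(essSup (fun t => eLpNorm (u t) 2 volume) (volume.restrict (Ioo 0 T))).toReal, ?_⟩
  filter_upwards [ENNReal.ae_le_essSup (μ := volume.restrict (Ioo 0 T))
    (fun t => eLpNorm (u t) 2 volume), (h.measurable.mono_measure (prod_restrict_Ioo_le T)).prodMk_left]
    with s hs1 hs2
  exact ⟨⟨hs2, hs1.trans_lt h1⟩, ENNReal.toReal_mono h1.ne hs1⟩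

/-- Weak-* convergence tested with bounded complex weights. -/
lemma IsWeakStarLimit.tendsto_pairing {v : ℕ → ℝ → Torus d L → Vec d} {u : ℝ → Torus d L → Vec d}
    (h : IsWeakStarLimit v u) (hT : 0 < T)
    (hv : ∀ j, AEStronglyMeasurable (Function.uncurry (v j))
      ((volume.restrict (Ioi (0 : ℝ))).prod volume))
    (hvb : ∀ j, ∀ᵐ s ∂(volume.restrict (Ioo 0 T)), MemLp (v j s) 2 ∧ l2Norm (v j s) ≤ b)
    (hK : 0 ≤ K)
    (hG : AEStronglyMeasurable (Function.uncurry G) ((volume.restrict (Ioo 0 T)).prod volume))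
    (hGb : ∀ᵐ s ∂(volume.restrict (Ioo 0 T)), ∀ᵐ x, ‖G s x‖ ≤ K) (i : Fin d) :
    Tendsto (fun j => ∫ s in Ioo 0 T, ∫ x, ((v j s x i : ℝ) : ℂ) * G s x) atTop
      (𝓝 (∫ s in Ioo 0 T, ∫ x, ((u s x i : ℝ) : ℂ) * G s x)) := by
  obtain ⟨b', hub⟩ := h.ae_memLp hT
  have hu' := h.measurable.mono_measure (prod_restrict_Ioo_le T)
  have hv' := fun j => (hv j).mono_measure (prod_restrict_Ioo_le T)
  have hre : ∀ G : ℝ → Torus d L → ℂ,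
      AEStronglyMeasurable (Function.uncurry G) ((volume.restrict (Ioo 0 T)).prod volume) →
      (∀ᵐ s ∂(volume.restrict (Ioo 0 T)), ∀ᵐ x, ‖G s x‖ ≤ K) →
      Tendsto (fun j => (∫ s in Ioo 0 T, ∫ x, ((v j s x i : ℝ) : ℂ) * G s x).re) atTop
        (𝓝 (∫ s in Ioo 0 T, ∫ x, ((u s x i : ℝ) : ℂ) * G s x).re) := by
    intro G hG hGb
    have h1 := h.tendsto T hT (fun s x => EuclideanSpace.single i (G s x).re)
      (((continuous_single_vec i).comp Complex.continuous_re).comp_aestronglyMeasurable hG) ?_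
    · rw [integral_inner_single_re hK hu' hG hub hGb i] at h1
      simpa only [integral_inner_single_re hK (hv' _) hG (hvb _) hGb i] using h1
    · refine lt_of_le_of_lt (lintegral_mono_ae (g := fun _ =>
        (volume : Measure (Torus d L)) univ ^ (2 : ℝ≥0∞).toReal⁻¹ * ENNReal.ofReal K) ?_) ?_
      · filter_upwards [hGb] with s hs
        refine eLpNorm_le_of_ae_bound ?_
        filter_upwards [hs] with x hx
        rw [PiLp.norm_single]
        exact (Complex.abs_re_le_norm _).trans hx
      · rw [lintegral_const]
        refine ENNReal.mul_lt_top (ENNReal.mul_lt_top ?_ ENNReal.ofReal_lt_top)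
          (measure_lt_top _ _)
        exact ENNReal.rpow_lt_top_of_nonneg (by positivity) (measure_ne_top _ _)
  have h1 := hre G hG hGb
  -- Real test fields only see real parts; the weight -iG produces the imaginary part.
  have h2 := hre (fun s x => -Complex.I * G s x) (hG.const_mul _) (by
    filter_upwards [hGb] with s hs
    filter_upwards [hs] with x hx
    simpa using hx)
  have h3 : ∀ f : ℝ → Torus d L → Vec d,
      (∫ s in Ioo 0 T, ∫ x, ((f s x i : ℝ) : ℂ) * (-Complex.I * G s x)).re
        = (∫ s in Ioo 0 T, ∫ x, ((f s x i : ℝ) : ℂ) * G s x).im := by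
    intro f
    simp only [mul_left_comm _ (-Complex.I), integral_const_mul]
    simp
  simp only [h3] at h2
  have h4 := ((Complex.continuous_ofReal.tendsto _).comp h1).add
    (((Complex.continuous_ofReal.tendsto _).comp h2).mul_const Complex.I)
  simpa only [Function.comp_def, Complex.re_add_im] using h4

end Pairing

/-! ### Measurability and initial energy of the approximations -/

section SpectralFields

variable {d : ℕ} {L : ℝ} [hL : Fact (0 < L)] {N : ℕ} {U : ℝ → Torus d L → Vec d}
  {u₀ : Torus d L → Vec d} {w : ℝ → Torus d L → Vec d}

lemma aestronglyMeasurable_trigPoly {μ : Measure ℝ} [SFinite μ]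
    {c : ℝ → (Fin d → ℤ) → Fin d → ℂ}
    (hc : ∀ k i, AEStronglyMeasurable (fun t => c t k i) μ) (N : ℕ) :
    AEStronglyMeasurable (fun p : ℝ × Torus d L => trigPoly N (c p.1) p.2) (μ.prod volume) := by
  unfold trigPoly
  refine (PiLp.continuous_toLp 2 _).comp_aestronglyMeasurable
    (aemeasurable_pi_iff.2 fun i => AEStronglyMeasurable.aemeasurable ?_).aestronglyMeasurable
  refine Complex.continuous_re.comp_aestronglyMeasurable ?_
  refine Finset.aestronglyMeasurable_fun_sum _ fun k _ => ?_
  exact (hc k i).comp_fst.mul ((continuous_character k).comp continuous_snd).aestronglyMeasurable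

lemma IsSpectralSolution.aestronglyMeasurable (h : IsSpectralSolution N U u₀ w) :
    AEStronglyMeasurable (Function.uncurry w) ((volume.restrict (Ioi (0 : ℝ))).prod volume) := by
  refine (aestronglyMeasurable_trigPoly (fun k i => ((h.continuousOn_coeff k i).mono
    Ioi_subset_Ici_self).aestronglyMeasurable measurableSet_Ioi) N).congr ?_
  have h2 : ∀ᵐ p ∂((volume.restrict (Ioi (0 : ℝ))).prod (volume : Measure (Torus d L))),
      p.1 ∈ Ioi (0 : ℝ) :=
    Measure.quasiMeasurePreserving_fst.ae (ae_restrict_mem measurableSet_Ioi)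
  filter_upwards [h2] with p hp
  exact (congrFun (h.eq_trigPoly (le_of_lt hp)) p.2).symm

lemma IsDivFree.sum_coeff_mul {f : Torus d L → Vec d} (h : IsDivFree f) (hf : Integrable f)
    (k : Fin d → ℤ) : ∑ i, coeff f k i * (k i : ℂ) = 0 := by
  have h1 := h.isFourierDivFree hf k
  simp only [wave, Complex.ofReal_mul, mul_assoc, ← Finset.mul_sum] at h1
  have h2 : ((2 * Real.pi / L : ℝ) : ℂ) ≠ 0 := by exact_mod_cast two_pi_div_pos.ne'
  have h3 := (mul_eq_zero.1 h1).resolve_left h2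
  rw [← h3]
  refine Finset.sum_congr rfl fun i _ => ?_
  rw [coeff_eq_cCoeff, mul_comm]
  simp

lemma IsSpectralSolution.l2Norm_zero_le (h : IsSpectralSolution N U u₀ w) (hu₀ : MemLp u₀ 2)
    (hdiv : IsDivFree u₀) : l2Norm (w 0) ≤ l2Norm u₀ := by
  rw [← sq_le_sq₀ (l2Norm_nonneg _) (l2Norm_nonneg _), h.l2Norm_sq_eq le_rfl, Finset.mul_sum]
  refine le_trans (Finset.sum_le_sum fun k hk => ?_)
    (sum_le_hasSum (freqBox d N) (fun k _ => ?_) (hasSum_norm_sq_coeff hu₀))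
  · refine mul_le_mul_of_nonneg_left (Finset.sum_le_sum fun i _ => le_of_eq ?_) side_pow_pos.le
    rw [h.coeff_eq hk i le_rfl, intervalIntegral.integral_same, sub_zero,
      lerayCoeff_eq_self (hdiv.sum_coeff_mul (hu₀.integrable one_le_two) k)]
  · exact mul_nonneg side_pow_pos.le (Finset.sum_nonneg fun i _ => sq_nonneg _)

end SpectralFields

end VectorMixing

end

noncomputable section

namespace VectorMixing

open scoped ComplexConjugate

/-! ### Measurability and bounds of the flux -/

section FluxIntegrals

variable {d : ℕ} {L : ℝ} [hL : Fact (0 < L)]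

lemma aestronglyMeasurable_cCoeff {μ : Measure ℝ} [SFinite μ] {g : ℝ → Torus d L → ℂ}
    (hg : AEStronglyMeasurable (Function.uncurry g) (μ.prod volume)) (k : Fin d → ℤ) :
    AEStronglyMeasurable (fun s => cCoeff (g s) k) μ := by
  have h1 : AEStronglyMeasurable (fun p : ℝ × Torus d L => g p.1 p.2 * character (-k) p.2)
      (μ.prod volume) :=
    hg.mul ((continuous_character (-k)).comp continuous_snd).aestronglyMeasurable
  exact h1.integral_prod_right'.const_mul _

lemma aestronglyMeasurable_fluxCoeff {μ : Measure ℝ} [SFinite μ] {V f : ℝ → Torus d L → Vec d}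
    (hV : AEStronglyMeasurable (Function.uncurry V) (μ.prod volume))
    (hf : AEStronglyMeasurable (Function.uncurry f) (μ.prod volume)) (k : Fin d → ℤ) (i : Fin d) :
    AEStronglyMeasurable (fun s => fluxCoeff (V s) (f s) k i) μ := by
  refine Finset.aestronglyMeasurable_fun_sum _ fun j _ => AEStronglyMeasurable.const_mul ?_ _
  exact aestronglyMeasurable_cCoeff
    (g := fun s x => ((V s x j : ℝ) : ℂ) * ((f s x i : ℝ) : ℂ))
    ((aestronglyMeasurable_component hV j).mul (aestronglyMeasurable_component hf i)) k

lemma integrable_component_mul {V f : Torus d L → Vec d} (hV : MemLp V 2) (hf : MemLp f 2)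
    (j i : Fin d) : Integrable fun x => ((V x j : ℝ) : ℂ) * ((f x i : ℝ) : ℂ) :=
  (memLp_component hV j).integrable_mul (memLp_component hf i)

lemma norm_fluxCoeff_le {V f : Torus d L → Vec d} (hV : MemLp V 2) (hf : MemLp f 2)
    (k : Fin d → ℤ) (i : Fin d) :
    ‖fluxCoeff V f k i‖ ≤ waveNorm L k * (L ^ d)⁻¹ * l2Norm f *
      ∑ j, √(∫ x, ‖((V x j : ℝ) : ℂ)‖ ^ 2) := by
  have hLd := side_pow_pos (d := d) (L := L)
  rw [Finset.mul_sum]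
  refine (norm_sum_le _ _).trans (Finset.sum_le_sum fun j _ => ?_)
  rw [norm_mul, norm_mul, Complex.norm_I, one_mul, Complex.norm_real]
  calc ‖wave L k j‖ * ‖cCoeff (fun x => ((V x j : ℝ) : ℂ) * ((f x i : ℝ) : ℂ)) k‖
      ≤ waveNorm L k * ((L ^ d)⁻¹ * (√(∫ x, ‖((V x j : ℝ) : ℂ)‖ ^ 2) * l2Norm f)) := by
        refine mul_le_mul (abs_wave_le k j) ?_ (norm_nonneg _) (waveNorm_nonneg k)
        refine (norm_cCoeff_mul_le (memLp_component hV j) (memLp_component hf i) k).trans ?_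
        have := sqrt_integral_norm_sq_component_le hf i
        gcongr
    _ = _ := by ring

lemma fluxCoeff_sub {V W f : Torus d L → Vec d} (hV : MemLp V 2) (hW : MemLp W 2)
    (hf : MemLp f 2) (k : Fin d → ℤ) (i : Fin d) :
    fluxCoeff (V - W) f k i = fluxCoeff V f k i - fluxCoeff W f k i := by
  rw [fluxCoeff, fluxCoeff, fluxCoeff, ← Finset.sum_sub_distrib]
  refine Finset.sum_congr rfl fun j _ => ?_
  rw [← mul_sub, ← cCoeff_sub (integrable_component_mul hV hf j i)
    (integrable_component_mul hW hf j i)]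
  congr 2
  funext x
  simp [sub_mul]

/-- The weight whose pairing with `f_i` is a coefficient of `div (f ⊗ V)`. -/
def fluxWeight (V : Torus d L → Vec d) (k : Fin d → ℤ) (x : Torus d L) : ℂ :=
  ∑ j, Complex.I * wave L k j * (((V x j : ℝ) : ℂ) * character (-k) x)

lemma norm_fluxWeight_le {V : Torus d L → Vec d} {B : ℝ}
    (hB : ∀ j, ∀ᵐ x, ‖((V x j : ℝ) : ℂ)‖ ≤ B) (k : Fin d → ℤ) :
    ∀ᵐ x, ‖fluxWeight V k x‖ ≤ d * (waveNorm L k * B) := by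
  filter_upwards [ae_all_iff.2 hB] with x hx
  refine (norm_sum_le _ _).trans ((Finset.sum_le_card_nsmul _ _ (waveNorm L k * B)
    fun j _ => ?_).trans_eq (by simp))
  rw [norm_mul, norm_mul, norm_mul, Complex.norm_I, one_mul, Complex.norm_real, norm_character,
    mul_one]
  exact mul_le_mul (abs_wave_le k j) (hx j) (norm_nonneg _) (waveNorm_nonneg k)

lemma fluxCoeff_eq_pairing {V f : Torus d L → Vec d} (hV : MemLp V 2) (hf : MemLp f 2)
    (k : Fin d → ℤ) (i : Fin d) :
    fluxCoeff V f k i = ((L : ℂ) ^ d)⁻¹ * ∫ x, ((f x i : ℝ) : ℂ) * fluxWeight V k x := by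
  have h1 : ∀ x, ((f x i : ℝ) : ℂ) * fluxWeight V k x = ∑ j, Complex.I * wave L k j *
      (((V x j : ℝ) : ℂ) * ((f x i : ℝ) : ℂ) * character (-k) x) := by
    intro x
    rw [fluxWeight, Finset.mul_sum]
    exact Finset.sum_congr rfl fun j _ => by ring
  simp_rw [h1]
  rw [integral_finsetSum _ fun j _ => (integrable_mul_character
    (integrable_component_mul hV hf j i) (-k)).const_mul _,
    fluxCoeff, Finset.mul_sum]
  refine Finset.sum_congr rfl fun j _ => ?_
  rw [integral_const_mul, cCoeff]
  ring

lemma aestronglyMeasurable_fluxWeight {μ : Measure (ℝ × Torus d L)} {V : ℝ → Torus d L → Vec d}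
    (hV : AEStronglyMeasurable (Function.uncurry V) μ) (k : Fin d → ℤ) :
    AEStronglyMeasurable (fun p : ℝ × Torus d L => fluxWeight (V p.1) k p.2) μ := by
  refine Finset.aestronglyMeasurable_fun_sum _ fun j _ => AEStronglyMeasurable.const_mul ?_ _
  exact (aestronglyMeasurable_component hV j).mul
    ((continuous_character (-k)).comp continuous_snd).aestronglyMeasurable

lemma sqrt_integral_norm_sq_le_of_bound {g : Torus d L → ℂ} (hg : AEStronglyMeasurable g) {B : ℝ}
    (hB0 : 0 ≤ B) (hB : ∀ᵐ x, ‖g x‖ ≤ B) : √(∫ x, ‖g x‖ ^ 2) ≤ B * √(L ^ d) := by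
  rw [Real.sqrt_le_left (by positivity), mul_pow, Real.sq_sqrt side_pow_pos.le]
  have h1 : ∫ _x : Torus d L, B ^ 2 = B ^ 2 * L ^ d := by
    rw [integral_const, smul_eq_mul, volume_real_torus, mul_comm]
  rw [← h1]
  refine integral_mono_ae ((MemLp.of_bound hg B hB).integrable_norm_pow (by simp))
    (integrable_const _) ?_
  filter_upwards [hB] with x hx
  exact pow_le_pow_left₀ (norm_nonneg _) hx 2

lemma memLp_of_bound_component {V : Torus d L → Vec d} (hV : AEStronglyMeasurable V) {B : ℝ}
    (hB : ∀ j, ∀ᵐ x, ‖((V x j : ℝ) : ℂ)‖ ≤ B) (p : ℝ≥0∞) : MemLp V p := by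
  refine memLp_of_memLp_component fun i => ?_
  refine MemLp.of_bound ((PiLp.continuous_apply 2 _ i).comp_aestronglyMeasurable hV) B ?_
  filter_upwards [hB i] with x hx
  rwa [Complex.norm_real] at hx

lemma memLp_truncate (N : ℕ) (V : Torus d L → Vec d) : MemLp (truncate N V) 2 :=
  memLp_of_continuous_vec (continuous_trigPoly N _) 2

lemma integral_norm_sq_truncate_sub (V : Torus d L → Vec d) (N : ℕ) (j : Fin d) :
    ∫ x, ‖(((truncate N V - V) x j : ℝ) : ℂ)‖ ^ 2
      = ∫ x, ‖((V x j : ℝ) : ℂ)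
        - trigSum (freqBox d N) (cCoeff fun x => ((V x j : ℝ) : ℂ)) x‖ ^ 2 := by
  refine integral_congr_ae (ae_of_all _ fun x => ?_)
  have h1 : ((truncate N V x j : ℝ) : ℂ)
      = trigSum (freqBox d N) (cCoeff fun x => ((V x j : ℝ) : ℂ)) x :=
    (isHermitian_coeff V).trigPoly_apply N x j
  simp only [Pi.sub_apply, PiLp.sub_apply, Complex.ofReal_sub, h1, norm_sub_rev]

lemma integral_lerayCoeff {μ : Measure ℝ} {F : ℝ → (Fin d → ℤ) → Fin d → ℂ} {k : Fin d → ℤ}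
    (hF : ∀ i, Integrable (fun s => F s k i) μ) (i : Fin d) :
    ∫ s, lerayCoeff (F s) k i ∂μ = lerayCoeff (fun k i => ∫ s, F s k i ∂μ) k i := by
  have h1 : Integrable (fun s => ∑ j, F s k j * (k j : ℂ)) μ :=
    integrable_finsetSum _ fun j _ => (hF j).mul_const _
  simp only [lerayCoeff]
  rw [integral_sub (hF i) ((h1.div_const _).mul_const _), integral_mul_const, integral_div,
    integral_finsetSum _ fun j _ => (hF j).mul_const _]
  simp only [integral_mul_const]

lemma integrable_lerayCoeff {μ : Measure ℝ} {F : ℝ → (Fin d → ℤ) → Fin d → ℂ} {k : Fin d → ℤ}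
    (hF : ∀ i, Integrable (fun s => F s k i) μ) (i : Fin d) :
    Integrable (fun s => lerayCoeff (F s) k i) μ :=
  (hF i).sub (((integrable_finsetSum _ fun j _ => (hF j).mul_const _).div_const _).mul_const _)

lemma tendsto_lerayCoeff {ι : Type*} {l : Filter ι} {c : ι → (Fin d → ℤ) → Fin d → ℂ}
    {c₀ : (Fin d → ℤ) → Fin d → ℂ} {k : Fin d → ℤ}
    (h : ∀ i, Tendsto (fun a => c a k i) l (𝓝 (c₀ k i))) (i : Fin d) :
    Tendsto (fun a => lerayCoeff (c a) k i) l (𝓝 (lerayCoeff c₀ k i)) :=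
  (h i).sub (((tendsto_finsetSum _ fun j _ => (h j).mul_const _).div_const _).mul_const _)

end FluxIntegrals

/-! ### Convergence of the Fourier coefficients at every time -/

section Limit

variable {d : ℕ} {L : ℝ} [hL : Fact (0 < L)]

/-- `u` is a weak-* limit of a subsequence of spectral approximations for the bounded,
divergence-free field `U`. -/
structure IsSpectralLimit (B : ℝ) (U : ℝ → Torus d L → Vec d) (u₀ : Torus d L → Vec d)
    (uN : ℕ → ℝ → Torus d L → Vec d) (n : ℕ → ℕ) (u : ℝ → Torus d L → Vec d) : Prop where
  nonneg : 0 ≤ B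
  measurable : AEStronglyMeasurable (Function.uncurry U)
    ((volume.restrict (Ioi (0 : ℝ))).prod volume)
  divFree : ∀ᵐ t ∂(volume.restrict (Ioi (0 : ℝ))), IsFourierDivFree fun j x => ((U t x j : ℝ) : ℂ)
  bound : ∀ᵐ t ∂(volume.restrict (Ioi (0 : ℝ))), ∀ j, ∀ᵐ x, ‖((U t x j : ℝ) : ℂ)‖ ≤ B
  memLp_init : MemLp u₀ 2
  divFree_init : IsDivFree u₀
  solution : ∀ N, IsSpectralSolution N U u₀ (uN N)
  strictMono : StrictMono n
  limit : IsWeakStarLimit (fun j => uN (n j)) u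

variable {B T : ℝ} {U : ℝ → Torus d L → Vec d} {u₀ : Torus d L → Vec d}
  {uN : ℕ → ℝ → Torus d L → Vec d} {n : ℕ → ℕ} {u : ℝ → Torus d L → Vec d}

lemma ae_Ioo_of_ae_Ioi {P : ℝ → Prop} (h : ∀ᵐ t ∂(volume.restrict (Ioi (0 : ℝ))), P t) (T : ℝ) :
    ∀ᵐ t ∂(volume.restrict (Ioo 0 T)), P t :=
  ae_restrict_of_ae_restrict_of_subset Ioo_subset_Ioi_self h

namespace IsSpectralLimit

variable (H : IsSpectralLimit B U u₀ uN n u)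

include H

lemma ae_memLp : ∀ᵐ t ∂(volume.restrict (Ioi (0 : ℝ))), MemLp (U t) 2 := by
  filter_upwards [H.bound, H.measurable.prodMk_left] with t h1 h2
  exact memLp_of_bound_component h2 h1 2

lemma l2Norm_le (N : ℕ) {t : ℝ} (ht : 0 ≤ t) : l2Norm (uN N t) ≤ l2Norm u₀ :=
  ((H.solution N).l2Norm_eq H.divFree ht).trans_le
    ((H.solution N).l2Norm_zero_le H.memLp_init H.divFree_init)

lemma ae_memLp_approx (N : ℕ) (T : ℝ) :
    ∀ᵐ s ∂(volume.restrict (Ioo 0 T)), MemLp (uN N s) 2 ∧ l2Norm (uN N s) ≤ l2Norm u₀ := by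
  filter_upwards [ae_restrict_mem measurableSet_Ioo] with s hs
  exact ⟨(H.solution N).memLp hs.1.le 2, H.l2Norm_le N hs.1.le⟩

lemma ae_sum_sqrt_le : ∀ᵐ t ∂(volume.restrict (Ioi (0 : ℝ))),
    ∑ j, √(∫ x, ‖((U t x j : ℝ) : ℂ)‖ ^ 2) ≤ d * (B * √(L ^ d)) := by
  filter_upwards [H.bound, H.ae_memLp] with t h1 h2
  refine (Finset.sum_le_card_nsmul _ _ (B * √(L ^ d)) fun j _ => ?_).trans_eq (by simp)
  exact sqrt_integral_norm_sq_le_of_bound (memLp_component h2 j).1 H.nonneg (h1 j)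

lemma integrableOn_flux {f : ℝ → Torus d L → Vec d}
    (hf : AEStronglyMeasurable (Function.uncurry f) ((volume.restrict (Ioi (0 : ℝ))).prod volume))
    {b : ℝ} (hfb : ∀ᵐ s ∂(volume.restrict (Ioo 0 T)), MemLp (f s) 2 ∧ l2Norm (f s) ≤ b)
    (k : Fin d → ℤ) (i : Fin d) :
    IntegrableOn (fun s => fluxCoeff (U s) (f s) k i) (Ioo 0 T) := by
  have hLd := side_pow_pos (d := d) (L := L)
  have hκ := waveNorm_nonneg (L := L) k
  refine Integrable.of_bound (aestronglyMeasurable_fluxCoeff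
    (H.measurable.mono_measure (prod_restrict_Ioo_le T)) (hf.mono_measure (prod_restrict_Ioo_le T))
    k i) (waveNorm L k * (L ^ d)⁻¹ * b * (d * (B * √(L ^ d)))) ?_
  filter_upwards [hfb, ae_Ioo_of_ae_Ioi H.ae_sum_sqrt_le T, ae_Ioo_of_ae_Ioi H.ae_memLp T]
    with s h1 h2 h3
  refine (norm_fluxCoeff_le h3 h1.1 k i).trans ?_
  have hb : 0 ≤ b := (l2Norm_nonneg _).trans h1.2
  refine mul_le_mul (mul_le_mul_of_nonneg_left h1.2 (by positivity)) h2
    (Finset.sum_nonneg fun j _ => Real.sqrt_nonneg _) (by positivity)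

/-- With the field `U` fixed, the time integral of a flux coefficient is a linear pairing of the
approximation with a bounded space-time weight, so weak-* convergence suffices. -/
lemma tendsto_integral_flux (hT : 0 < T) (k : Fin d → ℤ) (i : Fin d) :
    Tendsto (fun j => ∫ s in Ioo 0 T, fluxCoeff (U s) (uN (n j) s) k i) atTop
      (𝓝 (∫ s in Ioo 0 T, fluxCoeff (U s) (u s) k i)) := by
  obtain ⟨b, hb⟩ := H.limit.ae_memLp hT
  have hU := ae_Ioo_of_ae_Ioi H.ae_memLp T
  have e1 : ∀ f : ℝ → Torus d L → Vec d, (∀ᵐ s ∂(volume.restrict (Ioo 0 T)), MemLp (f s) 2) →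
      ∫ s in Ioo 0 T, fluxCoeff (U s) (f s) k i
        = ((L : ℂ) ^ d)⁻¹ * ∫ s in Ioo 0 T, ∫ x, ((f s x i : ℝ) : ℂ) * fluxWeight (U s) k x := by
    intro f hf
    rw [← integral_const_mul]
    refine integral_congr_ae ?_
    filter_upwards [hf, hU] with s h1 h2
    exact fluxCoeff_eq_pairing h2 h1 k i
  rw [e1 u (hb.mono fun s hs => hs.1)]
  simp only [e1 _ ((H.ae_memLp_approx _ T).mono fun s hs => hs.1)]
  refine Tendsto.const_mul _ (H.limit.tendsto_pairing hT (G := fun s x => fluxWeight (U s) k x)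
    (fun j => (H.solution (n j)).aestronglyMeasurable)
    (fun j => H.ae_memLp_approx (n j) T) (K := d * (waveNorm L k * B)) ?_ ?_ ?_ i)
  · have := waveNorm_nonneg (L := L) k
    have := H.nonneg
    positivity
  · exact aestronglyMeasurable_fluxWeight (H.measurable.mono_measure (prod_restrict_Ioo_le T)) k
  · filter_upwards [ae_Ioo_of_ae_Ioi H.bound T] with s hs
    exact norm_fluxWeight_le hs k

lemma aestronglyMeasurable_truncate (N : ℕ) :
    AEStronglyMeasurable (Function.uncurry fun s => truncate N (U s))
      ((volume.restrict (Ioi (0 : ℝ))).prod volume) :=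
  aestronglyMeasurable_trigPoly (c := fun s => coeff (U s)) (fun k i => aestronglyMeasurable_cCoeff
    (g := fun s x => ((U s x i : ℝ) : ℂ)) (aestronglyMeasurable_component H.measurable i) k) N

lemma norm_fluxCoeff_truncate_sub_le {s : ℝ} (hs : 0 ≤ s) (hU : MemLp (U s) 2) (N : ℕ)
    (k : Fin d → ℤ) (i : Fin d) :
    ‖fluxCoeff (truncate N (U s)) (uN N s) k i - fluxCoeff (U s) (uN N s) k i‖
      ≤ waveNorm L k * (L ^ d)⁻¹ * l2Norm u₀ * ∑ j, √(∫ x, ‖((U s x j : ℝ) : ℂ)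
        - trigSum (freqBox d N) (cCoeff fun x => ((U s x j : ℝ) : ℂ)) x‖ ^ 2) := by
  have hLd := side_pow_pos (d := d) (L := L)
  have hκ := waveNorm_nonneg (L := L) k
  rw [← fluxCoeff_sub (memLp_truncate N _) hU ((H.solution N).memLp hs 2)]
  refine (norm_fluxCoeff_le ((memLp_truncate N _).sub hU) ((H.solution N).memLp hs 2) k i).trans ?_
  simp only [integral_norm_sq_truncate_sub]
  exact mul_le_mul_of_nonneg_right (mul_le_mul_of_nonneg_left (H.l2Norm_le N hs) (by positivity))
    (Finset.sum_nonneg fun j _ => Real.sqrt_nonneg _)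

lemma ae_norm_fluxCoeff_truncate_sub_le (N : ℕ) (k : Fin d → ℤ) (i : Fin d) :
    ∀ᵐ s ∂(volume.restrict (Ioo 0 T)),
      ‖fluxCoeff (truncate N (U s)) (uN N s) k i - fluxCoeff (U s) (uN N s) k i‖
        ≤ waveNorm L k * (L ^ d)⁻¹ * l2Norm u₀ * (d * (B * √(L ^ d))) := by
  have hLd := side_pow_pos (d := d) (L := L)
  have hκ := waveNorm_nonneg (L := L) k
  have hb := l2Norm_nonneg u₀
  filter_upwards [ae_Ioo_of_ae_Ioi H.ae_sum_sqrt_le T, ae_Ioo_of_ae_Ioi H.ae_memLp T,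
    ae_restrict_mem measurableSet_Ioo] with s h1 h2 h3
  refine (H.norm_fluxCoeff_truncate_sub_le h3.1.le h2 N k i).trans
    (mul_le_mul_of_nonneg_left (le_trans (Finset.sum_le_sum fun j _ => ?_) h1) (by positivity))
  refine Real.sqrt_le_sqrt ?_
  rw [integral_norm_sq_sub_trigSum (memLp_component h2 j)]
  exact sub_le_self _ (mul_nonneg hLd.le (Finset.sum_nonneg fun k _ => sq_nonneg _))

lemma aestronglyMeasurable_flux_truncate_sub (N : ℕ) (k : Fin d → ℤ) (i : Fin d) :
    AEStronglyMeasurable (fun s => fluxCoeff (truncate N (U s)) (uN N s) k i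
      - fluxCoeff (U s) (uN N s) k i) (volume.restrict (Ioo 0 T)) := by
  have h := (H.solution N).aestronglyMeasurable.mono_measure (prod_restrict_Ioo_le (d := d) (L := L) T)
  exact (aestronglyMeasurable_fluxCoeff
    ((H.aestronglyMeasurable_truncate N).mono_measure (prod_restrict_Ioo_le T)) h k i).sub
    (aestronglyMeasurable_fluxCoeff (H.measurable.mono_measure (prod_restrict_Ioo_le T)) h k i)

/-- At almost every time U_N → U strongly in `L²` while the approximations stay bounded in `L²`.
Bessel's inequality supplies the dominating constant. -/
lemma tendsto_integral_flux_truncate_sub (k : Fin d → ℤ) (i : Fin d) :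
    Tendsto (fun N => ∫ s in Ioo 0 T, (fluxCoeff (truncate N (U s)) (uN N s) k i
      - fluxCoeff (U s) (uN N s) k i)) atTop (𝓝 0) := by
  have h1 := tendsto_integral_of_dominated_convergence (μ := volume.restrict (Ioo 0 T))
    (F := fun N s => fluxCoeff (truncate N (U s)) (uN N s) k i - fluxCoeff (U s) (uN N s) k i)
    (f := fun _ => (0 : ℂ)) (fun _ => waveNorm L k * (L ^ d)⁻¹ * l2Norm u₀ * (d * (B * √(L ^ d))))
    (fun N => H.aestronglyMeasurable_flux_truncate_sub N k i) (integrable_const _)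
    (fun N => H.ae_norm_fluxCoeff_truncate_sub_le N k i) ?_
  · simpa using h1
  · filter_upwards [ae_Ioo_of_ae_Ioi H.ae_memLp T, ae_restrict_mem measurableSet_Ioo] with s h2 h3
    refine squeeze_zero_norm (fun N => H.norm_fluxCoeff_truncate_sub_le h3.1.le h2 N k i) ?_
    have h4 : ∀ j : Fin d, Tendsto (fun N => √(∫ x, ‖((U s x j : ℝ) : ℂ)
        - trigSum (freqBox d N) (cCoeff fun x => ((U s x j : ℝ) : ℂ)) x‖ ^ 2)) atTop (𝓝 0) := by
      intro j
      simpa using (tendsto_integral_norm_sq_sub_trigSum (memLp_component h2 j)).sqrt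
    simpa using (tendsto_finsetSum Finset.univ fun j _ => h4 j).const_mul
      (waveNorm L k * (L ^ d)⁻¹ * l2Norm u₀)

lemma integrableOn_flux_approx (N : ℕ) (k : Fin d → ℤ) (i : Fin d) :
    IntegrableOn (fun s => fluxCoeff (U s) (uN N s) k i) (Ioo 0 T) :=
  H.integrableOn_flux (H.solution N).aestronglyMeasurable (H.ae_memLp_approx N T) k i

lemma integrableOn_flux_truncate (N : ℕ) (k : Fin d → ℤ) (i : Fin d) :
    IntegrableOn (fun s => fluxCoeff (truncate N (U s)) (uN N s) k i) (Ioo 0 T) := by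
  have h1 : IntegrableOn (fun s => fluxCoeff (truncate N (U s)) (uN N s) k i
      - fluxCoeff (U s) (uN N s) k i) (Ioo 0 T) :=
    Integrable.of_bound (H.aestronglyMeasurable_flux_truncate_sub N k i) _
      (H.ae_norm_fluxCoeff_truncate_sub_le N k i)
  exact (h1.add (H.integrableOn_flux_approx N k i)).congr (ae_of_all _ fun s => by simp)

lemma integrableOn_flux_limit (hT : 0 < T) (k : Fin d → ℤ) (i : Fin d) :
    IntegrableOn (fun s => fluxCoeff (U s) (u s) k i) (Ioo 0 T) := by
  obtain ⟨b, hb⟩ := H.limit.ae_memLp hT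
  exact H.integrableOn_flux H.limit.measurable hb k i

lemma tendsto_integral_flux_truncate (hT : 0 < T) (k : Fin d → ℤ) (i : Fin d) :
    Tendsto (fun j => ∫ s in Ioo 0 T, fluxCoeff (truncate (n j) (U s)) (uN (n j) s) k i) atTop
      (𝓝 (∫ s in Ioo 0 T, fluxCoeff (U s) (u s) k i)) := by
  have h1 := ((H.tendsto_integral_flux_truncate_sub (T := T) k i).comp
    H.strictMono.tendsto_atTop).add (H.tendsto_integral_flux hT k i)
  rw [zero_add] at h1
  refine h1.congr fun j => ?_
  simp only [Function.comp_apply]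
  rw [integral_sub (H.integrableOn_flux_truncate _ k i) (H.integrableOn_flux_approx _ k i)]
  ring

end IsSpectralLimit

/-- The Fourier coefficients of the limit at time `t`. -/
def limitCoeff (U : ℝ → Torus d L → Vec d) (u₀ : Torus d L → Vec d) (u : ℝ → Torus d L → Vec d)
    (t : ℝ) (k : Fin d → ℤ) (i : Fin d) : ℂ :=
  coeff u₀ k i - ∫ s in (0 : ℝ)..t, lerayCoeff (fluxCoeff (U s) (u s)) k i

namespace IsSpectralLimit

variable (H : IsSpectralLimit B U u₀ uN n u)

include H

lemma coeff_eq {N : ℕ} {k : Fin d → ℤ} (hk : k ∈ freqBox d N) (i : Fin d) {t : ℝ} (ht : 0 ≤ t) :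
    coeff (uN N t) k i = coeff u₀ k i - lerayCoeff (fun k i => ∫ s in Ioo 0 t,
      fluxCoeff (truncate N (U s)) (uN N s) k i) k i := by
  rw [(H.solution N).coeff_eq hk i ht, lerayCoeff_eq_self
    (H.divFree_init.sum_coeff_mul (H.memLp_init.integrable one_le_two) k),
    ← integral_lerayCoeff (fun i => H.integrableOn_flux_truncate N k i),
    intervalIntegral.integral_of_le ht, integral_Ioc_eq_integral_Ioo]
  congr 1
  refine integral_congr_ae ?_
  filter_upwards [ae_Ioo_of_ae_Ioi H.divFree t, ae_restrict_mem measurableSet_Ioo] with s h1 h2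
  have h3 : spectralRate N U (uN N) s = fluxCoeff (truncate N (U s)) (uN N s) := by
    funext l i
    rw [spectralRate]
    conv_lhs => rw [(H.solution N).eq_trigPoly h2.1.le]
    rw [coeff_transport_eq_fluxCoeff (integrable_truncate N _) (isFourierDivFree_truncate h1 N)
      (isHermitian_coeff _), ← (H.solution N).eq_trigPoly h2.1.le]
  rw [h3]

lemma intervalIntegrable_rate (k : Fin d → ℤ) (i : Fin d) {t : ℝ} (ht : 0 ≤ t) :
    IntervalIntegrable (fun s => lerayCoeff (fluxCoeff (U s) (u s)) k i) volume 0 t := by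
  rcases ht.eq_or_lt with rfl | ht
  · exact IntervalIntegrable.refl
  · rw [intervalIntegrable_iff_integrableOn_Ioo_of_le ht.le]
    exact integrable_lerayCoeff (fun i => H.integrableOn_flux_limit ht k i) i

/-- The coefficients of the approximations converge at all times. -/
lemma tendsto_coeff {t : ℝ} (ht : 0 ≤ t) (k : Fin d → ℤ) (i : Fin d) :
    Tendsto (fun j => coeff (uN (n j) t) k i) atTop (𝓝 (limitCoeff U u₀ u t k i)) := by
  have hk : ∀ᶠ j in atTop, k ∈ freqBox d (n j) := by
    have := (tendsto_freqBox (d := d)).comp H.strictMono.tendsto_atTop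
    filter_upwards [this.eventually (eventually_ge_atTop {k})] with j hj
    exact hj (Finset.mem_singleton_self k)
  have h1 : Tendsto (fun j => coeff u₀ k i - lerayCoeff (fun k i => ∫ s in Ioo 0 t,
      fluxCoeff (truncate (n j) (U s)) (uN (n j) s) k i) k i) atTop
      (𝓝 (coeff u₀ k i - lerayCoeff (fun k i => ∫ s in Ioo 0 t,
        fluxCoeff (U s) (u s) k i) k i)) := by
    refine tendsto_const_nhds.sub (tendsto_lerayCoeff (fun i => ?_) i)
    rcases ht.eq_or_lt with rfl | ht
    · simp
    · exact H.tendsto_integral_flux_truncate ht k i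
  have h2 : limitCoeff U u₀ u t k i = coeff u₀ k i - lerayCoeff (fun k i => ∫ s in Ioo 0 t,
        fluxCoeff (U s) (u s) k i) k i := by
    rcases ht.eq_or_lt with rfl | ht
    · simp [limitCoeff, lerayCoeff]
    · rw [limitCoeff, intervalIntegral.integral_of_le ht.le, integral_Ioc_eq_integral_Ioo,
        integral_lerayCoeff fun i => H.integrableOn_flux_limit ht k i]
  rw [h2]
  refine h1.congr' ?_
  filter_upwards [hk] with j hj
  exact (H.coeff_eq hj i ht).symm

end IsSpectralLimit

end Limit

end VectorMixing

end

noncomputable section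

namespace VectorMixing

open scoped ComplexConjugate

/-! ### The continuous representative of the limit -/

section Representative

variable {d : ℕ} {L : ℝ} [hL : Fact (0 < L)]

lemma ae_Ioi_of_forall_ae_Ioo {P : ℝ → Prop}
    (h : ∀ T : ℝ, 0 < T → ∀ᵐ t ∂(volume.restrict (Ioo 0 T)), P t) :
    ∀ᵐ t ∂(volume.restrict (Ioi (0 : ℝ))), P t := by
  have h1 : Ioi (0 : ℝ) = ⋃ m : ℕ, Ioo 0 ((m : ℝ) + 1) := by
    ext t
    simp only [mem_Ioi, mem_iUnion, mem_Ioo]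
    refine ⟨fun ht => ⟨⌈t⌉₊, ht, (Nat.le_ceil t).trans_lt (lt_add_one _)⟩, fun ⟨_, ht, _⟩ => ht⟩
  rw [h1, ae_restrict_iUnion_iff]
  exact fun m => h _ (by positivity)

lemma integral_component_mul_character (f : Torus d L → Vec d) (k : Fin d → ℤ) (i : Fin d) :
    ∫ x, ((f x i : ℝ) : ℂ) * character (-k) x = (L : ℂ) ^ d * coeff f k i := by
  rw [coeff, mul_inv_cancel_left₀ side_pow_ne_zero]

lemma norm_side_mul_coeff_le {f : Torus d L → Vec d} (hf : MemLp f 2) (k : Fin d → ℤ)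
    (i : Fin d) : ‖(L : ℂ) ^ d * coeff f k i‖ ≤ l2Norm f * √(L ^ d) := by
  rw [← integral_component_mul_character]
  simpa using norm_pairing_le zero_le_one hf (ae_of_all _ fun x => (norm_character (-k) x).le) i

variable {B T : ℝ} {U : ℝ → Torus d L → Vec d} {u₀ : Torus d L → Vec d}
  {uN : ℕ → ℝ → Torus d L → Vec d} {n : ℕ → ℕ} {u v : ℝ → Torus d L → Vec d} {α : ℝ}

namespace IsSpectralLimit

variable (H : IsSpectralLimit B U u₀ uN n u)

include H

lemma isHermitian_limitCoeff {t : ℝ} (ht : 0 ≤ t) : IsHermitian (limitCoeff U u₀ u t) := by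
  intro k i
  refine tendsto_nhds_unique (H.tendsto_coeff ht (-k) i) ?_
  have h1 := (Complex.continuous_conj.tendsto _).comp (H.tendsto_coeff ht k i)
  refine h1.congr fun j => ?_
  exact (isHermitian_coeff (uN (n j) t) k i).symm

lemma sum_limitCoeff_mul {t : ℝ} (ht : 0 ≤ t) (k : Fin d → ℤ) :
    ∑ i, limitCoeff U u₀ u t k i * (k i : ℂ) = 0 := by
  refine tendsto_nhds_unique (tendsto_finsetSum Finset.univ fun i _ =>
    (H.tendsto_coeff ht k i).mul_const (k i : ℂ)) ?_
  simp only [(H.solution _).sum_coeff_mul ht k]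
  exact tendsto_const_nhds

/-- The uniform `L²` bound on the approximations passes to finite partial sums of the limit
coefficients. -/
lemma sum_norm_sq_limitCoeff_le {t : ℝ} (ht : 0 ≤ t) (S : Finset (Fin d → ℤ)) :
    ∑ k ∈ S, ∑ i, ‖limitCoeff U u₀ u t k i‖ ^ 2 ≤ (L ^ d)⁻¹ * l2Norm u₀ ^ 2 := by
  have hLd := side_pow_pos (d := d) (L := L)
  have h1 : Tendsto (fun j => ∑ k ∈ S, ∑ i, ‖coeff (uN (n j) t) k i‖ ^ 2) atTop
      (𝓝 (∑ k ∈ S, ∑ i, ‖limitCoeff U u₀ u t k i‖ ^ 2)) :=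
    tendsto_finsetSum _ fun k _ => tendsto_finsetSum _ fun i _ =>
      ((H.tendsto_coeff ht k i).norm.pow 2)
  refine le_of_tendsto' h1 fun j => ?_
  rw [inv_mul_eq_div, le_div_iff₀' hLd, Finset.mul_sum]
  refine (sum_le_hasSum S (fun k _ => ?_)
    (hasSum_norm_sq_coeff ((H.solution (n j)).memLp ht 2))).trans ?_
  · exact mul_nonneg hLd.le (Finset.sum_nonneg fun i _ => sq_nonneg _)
  · exact pow_le_pow_left₀ (l2Norm_nonneg _) (H.l2Norm_le (n j) ht) 2

lemma exists_coeff_eq_limitCoeff : ∃ v : ℝ → Torus d L → Vec d, ∀ t, 0 ≤ t →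
    MemLp (v t) 2 ∧ ∀ k i, coeff (v t) k i = limitCoeff U u₀ u t k i := by
  have h1 : ∀ t : ℝ, ∃ f : Torus d L → Vec d, 0 ≤ t →
      MemLp f 2 ∧ ∀ k i, coeff f k i = limitCoeff U u₀ u t k i := by
    intro t
    by_cases ht : 0 ≤ t
    · obtain ⟨f, hf⟩ := (H.isHermitian_limitCoeff ht).exists_memLp_coeff_eq (L := L) fun i =>
        summable_of_sum_le (fun k => sq_nonneg _) fun S => le_trans (Finset.sum_le_sum fun k _ =>
          Finset.single_le_sum (f := fun i => ‖limitCoeff U u₀ u t k i‖ ^ 2)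
            (fun _ _ => sq_nonneg _) (Finset.mem_univ i)) (H.sum_norm_sq_limitCoeff_le ht S)
      exact ⟨f, fun _ => hf⟩
    · exact ⟨0, fun h => absurd h ht⟩
  choose v hv using h1
  exact ⟨v, hv⟩

lemma continuousOn_limitCoeff (k : Fin d → ℤ) (i : Fin d) :
    ContinuousOn (fun t => limitCoeff U u₀ u t k i) (Ici 0) :=
  continuousOn_of_eq_sub_integral (fun _ ht => H.intervalIntegrable_rate k i ht) fun _ _ => rfl

/-- Both sides are limits of the same integrals for the approximations: one by weak-* convergence
against the indicator of `S` in time times a character, the other by dominated convergence from the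
convergence at every time. -/
lemma setIntegral_coeff_eq (hT : 0 < T) (k : Fin d → ℤ) (i : Fin d) {S : Set ℝ}
    (hS : MeasurableSet S) :
    ∫ s in Ioo 0 T, S.indicator (fun s => (L : ℂ) ^ d * coeff (u s) k i) s
      = ∫ s in Ioo 0 T, S.indicator (fun s => (L : ℂ) ^ d * limitCoeff U u₀ u s k i) s := by
  have e1 : ∀ (f : ℝ → Torus d L → Vec d) (s : ℝ),
      ∫ x, ((f s x i : ℝ) : ℂ) * S.indicator (fun _ => character (-k) x) s
        = S.indicator (fun s => (L : ℂ) ^ d * coeff (f s) k i) s := by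
    intro f s
    by_cases hs : s ∈ S
    · simp only [indicator_of_mem hs, integral_component_mul_character]
    · simp [indicator_of_notMem hs]
  have hGm : AEStronglyMeasurable (Function.uncurry fun (s : ℝ) (x : Torus d L) =>
      S.indicator (fun _ => character (-k) x) s) ((volume.restrict (Ioo 0 T)).prod volume) := by
    have h1 : (Function.uncurry fun (s : ℝ) (x : Torus d L) =>
        S.indicator (fun _ => character (-k) x) s)
        = (S ×ˢ univ).indicator fun p : ℝ × Torus d L => character (-k) p.2 := by
      funext p
      by_cases hp : p.1 ∈ S <;> simp [Function.uncurry, indicator, hp]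
    rw [h1]
    exact (((continuous_character (-k)).comp continuous_snd).aestronglyMeasurable).indicator
      (hS.prod MeasurableSet.univ)
  have h1 := H.limit.tendsto_pairing hT (b := l2Norm u₀) (K := 1)
    (G := fun s x => S.indicator (fun _ => character (-k) x) s)
    (fun j => (H.solution (n j)).aestronglyMeasurable)
    (fun j => H.ae_memLp_approx (n j) T) zero_le_one hGm
    (ae_of_all _ fun s => ae_of_all _ fun x => by
      by_cases hs : s ∈ S
      · simp [indicator_of_mem hs, norm_character]
      · simp [indicator_of_notMem hs]) i
  simp only [e1] at h1
  refine tendsto_nhds_unique h1 ?_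
  refine tendsto_integral_of_dominated_convergence (fun _ => l2Norm u₀ * √(L ^ d)) (fun j => ?_)
    (integrable_const _) (fun j => ?_) ?_
  · refine AEStronglyMeasurable.indicator (AEStronglyMeasurable.const_mul ?_ _) hS
    exact (((H.solution (n j)).continuousOn_coeff k i).mono fun s hs =>
      le_of_lt hs.1).aestronglyMeasurable measurableSet_Ioo
  · filter_upwards [H.ae_memLp_approx (n j) T] with s hs
    refine (norm_indicator_le_norm_self _ _).trans ((norm_side_mul_coeff_le hs.1 k i).trans ?_)
    exact mul_le_mul_of_nonneg_right hs.2 (Real.sqrt_nonneg _)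
  · filter_upwards [ae_restrict_mem measurableSet_Ioo] with s hs
    by_cases hs' : s ∈ S
    · simp only [indicator_of_mem hs']
      exact (H.tendsto_coeff hs.1.le k i).const_mul _
    · simp only [indicator_of_notMem hs']
      exact tendsto_const_nhds

lemma ae_coeff_eq_limitCoeff (hT : 0 < T) (k : Fin d → ℤ) (i : Fin d) :
    ∀ᵐ t ∂(volume.restrict (Ioo 0 T)), coeff (u t) k i = limitCoeff U u₀ u t k i := by
  obtain ⟨b, hb⟩ := H.limit.ae_memLp hT
  have hu : IntegrableOn (fun s => (L : ℂ) ^ d * coeff (u s) k i) (Ioo 0 T) := by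
    refine Integrable.of_bound ?_ (b * √(L ^ d)) ?_
    · exact (aestronglyMeasurable_cCoeff (g := fun s x => ((u s x i : ℝ) : ℂ))
        (aestronglyMeasurable_component
          (H.limit.measurable.mono_measure (prod_restrict_Ioo_le T)) i) k).const_mul _
    · filter_upwards [hb] with s hs
      exact (norm_side_mul_coeff_le hs.1 k i).trans
        (mul_le_mul_of_nonneg_right hs.2 (Real.sqrt_nonneg _))
  have hc : IntegrableOn (fun s => (L : ℂ) ^ d * limitCoeff U u₀ u s k i) (Ioo 0 T) := by
    refine IntegrableOn.mono_set (ContinuousOn.integrableOn_Icc (continuousOn_const.mul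
      ((H.continuousOn_limitCoeff k i).mono Icc_subset_Ici_self))) Ioo_subset_Icc_self
  have h1 := Integrable.ae_eq_of_forall_setIntegral_eq _ _ hu hc fun S hS _ => by
    rw [← integral_indicator hS, ← integral_indicator hS]
    exact H.setIntegral_coeff_eq hT k i hS
  filter_upwards [h1] with t ht
  exact mul_left_cancel₀ side_pow_ne_zero ht

lemma ae_eq_of_coeff_eq_limitCoeff
    (hv : ∀ t, 0 ≤ t → MemLp (v t) 2 ∧ ∀ k i, coeff (v t) k i = limitCoeff U u₀ u t k i) :
    ∀ᵐ t ∂(volume.restrict (Ioi (0 : ℝ))), v t =ᵐ[volume] u t := by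
  refine ae_Ioi_of_forall_ae_Ioo fun T hT => ?_
  obtain ⟨b, hb⟩ := H.limit.ae_memLp hT
  filter_upwards [hb, ae_restrict_mem measurableSet_Ioo,
    ae_all_iff.2 fun k => ae_all_iff.2 fun i => H.ae_coeff_eq_limitCoeff hT k i] with t h1 h2 h3
  have h4 := hv t h2.1.le
  exact ae_eq_of_coeff_eq h4.1 h1.1 fun k i => (h4.2 k i).trans (h3 k i).symm

/-- Each coefficient is continuous in time, the `L²` norms are uniformly bounded, and the weights
κ^{-2α} vanish at infinity, so high frequencies contribute uniformly little. -/
lemma tendsto_negSobolevNorm_sq_sub (hα : 0 < α)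
    (hv : ∀ t, 0 ≤ t → MemLp (v t) 2 ∧ ∀ k i, coeff (v t) k i = limitCoeff U u₀ u t k i)
    {t : ℝ} (ht : 0 ≤ t) :
    Tendsto (fun s => negSobolevNorm α (v s - v t) ^ 2) (𝓝[Ici 0] t) (𝓝 0) := by
  have h1 : Tendsto (fun s => ∑' k : Fin d → ℤ, waveNorm L k ^ (-2 * α) *
      ∑ i, ‖limitCoeff U u₀ u s k i - limitCoeff U u₀ u t k i‖ ^ 2) (𝓝[Ici 0] t)
      (𝓝 (∑' k : Fin d → ℤ, waveNorm L k ^ (-2 * α) * 0)) := by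
    refine tendsto_tsum_mul_of_sum_le (fun k => Real.rpow_nonneg (waveNorm_nonneg k) _)
      (waveNorm_rpow_le' hα) (tendsto_waveNorm_rpow hα)
      (B := 4 * ((L ^ d)⁻¹ * l2Norm u₀ ^ 2))
      (Eventually.of_forall fun s k => Finset.sum_nonneg fun i _ => sq_nonneg _) ?_ (fun _ => le_rfl)
      (fun S => ?_) fun k => ?_
    · filter_upwards [self_mem_nhdsWithin] with s hs S
      have h2 := H.sum_norm_sq_limitCoeff_le hs S
      have h3 := H.sum_norm_sq_limitCoeff_le ht S
      calc ∑ k ∈ S, ∑ i, ‖limitCoeff U u₀ u s k i - limitCoeff U u₀ u t k i‖ ^ 2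
          ≤ ∑ k ∈ S, ∑ i, (2 * ‖limitCoeff U u₀ u s k i‖ ^ 2
            + 2 * ‖limitCoeff U u₀ u t k i‖ ^ 2) := by
            refine Finset.sum_le_sum fun k _ => Finset.sum_le_sum fun i _ => ?_
            have h4 := norm_sub_le (limitCoeff U u₀ u s k i) (limitCoeff U u₀ u t k i)
            have h5 := pow_le_pow_left₀ (norm_nonneg _) h4 2
            nlinarith [sq_nonneg (‖limitCoeff U u₀ u s k i‖ - ‖limitCoeff U u₀ u t k i‖)]
        _ ≤ _ := by
            simp only [Finset.sum_add_distrib, ← Finset.mul_sum]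
            linarith
    · simp only [Finset.sum_const_zero]
      have := side_pow_pos (d := d) (L := L)
      positivity
    · have h2 : Tendsto (fun s => ∑ i, ‖limitCoeff U u₀ u s k i - limitCoeff U u₀ u t k i‖ ^ 2)
          (𝓝[Ici 0] t) (𝓝 (∑ i : Fin d, ‖limitCoeff U u₀ u t k i
            - limitCoeff U u₀ u t k i‖ ^ 2)) :=
        tendsto_finsetSum _ fun i _ =>
          (((H.continuousOn_limitCoeff k i t ht).tendsto.sub_const _).norm.pow 2)
      simpa using h2
  have h2 := h1.const_mul (L ^ d)
  simp only [mul_zero, tsum_zero] at h2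
  refine h2.congr' ?_
  filter_upwards [self_mem_nhdsWithin] with s hs
  rw [negSobolevNorm_sq]
  simp only [coeff_sub ((hv s hs).1.integrable one_le_two) ((hv t ht).1.integrable one_le_two),
    (hv s hs).2, (hv t ht).2]

lemma isContinuousRepresentative (hα : 0 < α)
    (hv : ∀ t, 0 ≤ t → MemLp (v t) 2 ∧ ∀ k i, coeff (v t) k i = limitCoeff U u₀ u t k i) :
    IsContinuousRepresentative α u v where
  ae_eq := H.ae_eq_of_coeff_eq_limitCoeff hv
  memLp t ht := (hv t ht).1
  continuous t ht := by
    have h1 := (H.tendsto_negSobolevNorm_sq_sub hα hv ht).sqrt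
    simpa only [Real.sqrt_sq (negSobolevNorm_nonneg _ _), Real.sqrt_zero] using h1

lemma zero_ae_eq
    (hv : ∀ t, 0 ≤ t → MemLp (v t) 2 ∧ ∀ k i, coeff (v t) k i = limitCoeff U u₀ u t k i) :
    v 0 =ᵐ[volume] u₀ :=
  ae_eq_of_coeff_eq (hv 0 le_rfl).1 H.memLp_init fun k i => by
    rw [(hv 0 le_rfl).2, limitCoeff, intervalIntegral.integral_same, sub_zero]

lemma negSobolevNorm_sq_eq
    (hv : ∀ t, 0 ≤ t → MemLp (v t) 2 ∧ ∀ k i, coeff (v t) k i = limitCoeff U u₀ u t k i)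
    {t : ℝ} (ht : 0 ≤ t) : negSobolevNorm α (v t) ^ 2 = L ^ d * ∑' k : Fin d → ℤ,
      waveNorm L k ^ (-2 * α) * ∑ i, ‖limitCoeff U u₀ u t k i‖ ^ 2 := by
  simp only [negSobolevNorm_sq, (hv t ht).2]

lemma continuousOn_negSobolevNorm_sq (hα : 0 < α)
    (hv : ∀ t, 0 ≤ t → MemLp (v t) 2 ∧ ∀ k i, coeff (v t) k i = limitCoeff U u₀ u t k i) :
    ContinuousOn (fun t => negSobolevNorm α (v t) ^ 2) (Ici 0) := by
  refine ContinuousOn.congr (f := fun t => L ^ d * ∑' k : Fin d → ℤ,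
      waveNorm L k ^ (-2 * α) * ∑ i, ‖limitCoeff U u₀ u t k i‖ ^ 2) (fun t ht => ?_)
    fun t ht => H.negSobolevNorm_sq_eq hv ht
  refine Tendsto.const_mul _ (tendsto_tsum_mul_of_sum_le
    (fun k => Real.rpow_nonneg (waveNorm_nonneg k) _)
    (waveNorm_rpow_le' hα) (tendsto_waveNorm_rpow hα)
    (Eventually.of_forall fun s k => Finset.sum_nonneg fun i _ => sq_nonneg _) ?_
    (fun _ => Finset.sum_nonneg fun i _ => sq_nonneg _)
    (fun S => H.sum_norm_sq_limitCoeff_le ht S) fun k => ?_)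
  · filter_upwards [self_mem_nhdsWithin] with s hs S
    exact H.sum_norm_sq_limitCoeff_le hs S
  · exact tendsto_finsetSum _ fun i _ => ((H.continuousOn_limitCoeff k i t ht).tendsto.norm.pow 2)

lemma l2Norm_sq_le
    (hv : ∀ t, 0 ≤ t → MemLp (v t) 2 ∧ ∀ k i, coeff (v t) k i = limitCoeff U u₀ u t k i)
    {t : ℝ} (ht : 0 ≤ t) : l2Norm (v t) ^ 2 ≤ l2Norm u₀ ^ 2 := by
  have hLd := side_pow_pos (d := d) (L := L)
  refine hasSum_le_of_sum_le (hasSum_norm_sq_coeff (hv t ht).1) fun S => ?_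
  have := H.sum_norm_sq_limitCoeff_le ht S
  rw [inv_mul_eq_div, le_div_iff₀' hLd] at this
  simpa only [(hv t ht).2, ← Finset.mul_sum] using this

end IsSpectralLimit

end Representative

end VectorMixing

end

noncomputable section

namespace VectorMixing

open scoped ComplexConjugate

/-! ### The flux of the high frequencies -/

section FluxSplitting

variable {d : ℕ} {L : ℝ} [hL : Fact (0 < L)] {α B : ℝ}

/-- One derivative is compensated by Λ^{-2α} because 1 - 2α ≤ 0 and nonzero wave lengths are at
least 2π/L. The resulting constant depends on `L`, but it only enters an error that tends to 0. -/
lemma abs_wave_mul_waveNorm_rpow_le (hα : 1 / 2 ≤ α) (k : Fin d → ℤ) (j : Fin d) :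
    |wave L k j| * waveNorm L k ^ (-2 * α) ≤ (2 * Real.pi / L) ^ (1 - 2 * α) := by
  have h0 : 0 ≤ (2 * Real.pi / L) ^ (1 - 2 * α) := Real.rpow_nonneg two_pi_div_pos.le _
  rcases eq_or_ne k 0 with rfl | hk
  · simpa [wave_zero] using h0
  · calc |wave L k j| * waveNorm L k ^ (-2 * α) ≤ waveNorm L k * waveNorm L k ^ (-2 * α) :=
        mul_le_mul_of_nonneg_right (abs_wave_le k j) (Real.rpow_nonneg (waveNorm_nonneg k) _)
      _ = waveNorm L k ^ (1 - 2 * α) := by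
        rw [sub_eq_add_neg, Real.rpow_add (waveNorm_pos hk), Real.rpow_one, neg_mul]
      _ ≤ _ := waveNorm_rpow_le (by linarith) hk

/-- The derivative in the flux is moved onto Λ^{-2α} of the trigonometric polynomial with
coefficients `c`. What is left is Cauchy–Schwarz with a bounded weight. -/
lemma norm_weighted_flux_le (hα : 1 / 2 ≤ α) {W : Fin d → Torus d L → ℂ} (hB0 : 0 ≤ B)
    (hB : ∀ j, ∀ᵐ x, ‖W j x‖ ≤ B) (hW : ∀ j, AEStronglyMeasurable (W j)) {g : Torus d L → ℂ}
    (hg : MemLp g 2) (S : Finset (Fin d → ℤ)) (c : (Fin d → ℤ) → ℂ) {b : ℝ} (hb : 0 ≤ b)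
    (hc : L ^ d * ∑ l ∈ S, ‖c l‖ ^ 2 ≤ b ^ 2) :
    ‖(L : ℂ) ^ d * ∑ l ∈ S, ((waveNorm L l ^ (-2 * α) : ℝ) : ℂ) *
      ((∑ j, Complex.I * wave L l j * cCoeff (fun x => W j x * g x) l) * conj (c l))‖
      ≤ d * (B * (√(∫ x, ‖g x‖ ^ 2) * ((2 * Real.pi / L) ^ (1 - 2 * α) * b))) := by
  set D := (2 * Real.pi / L) ^ (1 - 2 * α) with hD
  have hD0 : 0 ≤ D := Real.rpow_nonneg two_pi_div_pos.le _
  set z : Fin d → (Fin d → ℤ) → ℂ := fun j l =>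
    -Complex.I * wave L l j * ((waveNorm L l ^ (-2 * α) : ℝ) : ℂ) * c l with hz
  have hint : ∀ j, Integrable fun x => W j x * g x := fun j =>
    (hg.integrable one_le_two).bdd_mul (c := B) (hW j) (hB j)
  have h1 : (L : ℂ) ^ d * ∑ l ∈ S, ((waveNorm L l ^ (-2 * α) : ℝ) : ℂ) *
      ((∑ j, Complex.I * wave L l j * cCoeff (fun x => W j x * g x) l) * conj (c l))
      = ∑ j, ∫ x, W j x * g x * conj (trigSum S (z j) x) := by
    have h2 : ∀ j, ∫ x, W j x * g x * conj (trigSum S (z j) x)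
        = ∑ l ∈ S, conj (z j l) * ((L : ℂ) ^ d * cCoeff (fun x => W j x * g x) l) := by
      intro j
      have h3 : ∀ x, W j x * g x * conj (trigSum S (z j) x)
          = ∑ l ∈ S, conj (z j l) * (W j x * g x * character (-l) x) := by
        intro x
        rw [trigSum, map_sum, Finset.mul_sum]
        refine Finset.sum_congr rfl fun l _ => ?_
        rw [map_mul, character_freq_neg]
        ring
      simp_rw [h3]
      rw [integral_finsetSum _ fun l _ => (integrable_mul_character (hint j) (-l)).const_mul _]
      refine Finset.sum_congr rfl fun l _ => ?_
      rw [integral_const_mul, cCoeff, mul_inv_cancel_left₀ side_pow_ne_zero]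
    simp only [h2]
    rw [Finset.sum_comm, Finset.mul_sum]
    refine Finset.sum_congr rfl fun l _ => ?_
    rw [Finset.sum_mul, Finset.mul_sum, Finset.mul_sum]
    refine Finset.sum_congr rfl fun j _ => ?_
    simp only [hz, map_mul, map_neg, Complex.conj_I, Complex.conj_ofReal]
    ring
  rw [h1]
  refine (norm_sum_le _ _).trans ((Finset.sum_le_card_nsmul _ _ _ fun j _ => ?_).trans_eq
    (by rw [Finset.card_univ, Fintype.card_fin, nsmul_eq_mul]))
  refine (norm_integral_mul_mul_conj_le hB0 (hB j) hg
    (memLp_of_continuous (continuous_trigSum S (z j)) 2)).trans ?_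
  refine mul_le_mul_of_nonneg_left (mul_le_mul_of_nonneg_left ?_ (Real.sqrt_nonneg _)) hB0
  rw [integral_norm_sq_trigSum, Real.sqrt_le_left (by positivity), mul_pow]
  calc L ^ d * ∑ l ∈ S, ‖z j l‖ ^ 2 ≤ L ^ d * ∑ l ∈ S, D ^ 2 * ‖c l‖ ^ 2 := by
        refine mul_le_mul_of_nonneg_left (Finset.sum_le_sum fun l _ => ?_) side_pow_pos.le
        rw [← mul_pow]
        refine pow_le_pow_left₀ (norm_nonneg _) ?_ 2
        simp only [hz, norm_mul, norm_neg, Complex.norm_I, one_mul, Complex.norm_real]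
        rw [Real.norm_of_nonneg (Real.rpow_nonneg (waveNorm_nonneg l) _)]
        exact mul_le_mul_of_nonneg_right (abs_wave_mul_waveNorm_rpow_le hα l j) (norm_nonneg _)
    _ = D ^ 2 * (L ^ d * ∑ l ∈ S, ‖c l‖ ^ 2) := by
        rw [← Finset.mul_sum]; ring
    _ ≤ _ := mul_le_mul_of_nonneg_left hc (sq_nonneg D)

lemma sum_integral_norm_sq_sub_trigSum {f : Torus d L → Vec d} (hf : MemLp f 2)
    (S : Finset (Fin d → ℤ)) :
    ∑ i, ∫ x, ‖((f x i : ℝ) : ℂ) - trigSum S (fun k => coeff f k i) x‖ ^ 2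
      = l2Norm f ^ 2 - L ^ d * ∑ k ∈ S, ∑ i, ‖coeff f k i‖ ^ 2 := by
  have h1 : ∀ i, ∫ x, ‖((f x i : ℝ) : ℂ) - trigSum S (fun k => coeff f k i) x‖ ^ 2
      = (∫ x, ‖((f x i : ℝ) : ℂ)‖ ^ 2) - L ^ d * ∑ k ∈ S, ‖coeff f k i‖ ^ 2 := fun i =>
    integral_norm_sq_sub_trigSum (memLp_component hf i) S
  have h2 : l2Norm f ^ 2 = ∑ i, ∫ x, ‖((f x i : ℝ) : ℂ)‖ ^ 2 := by
    refine (hasSum_norm_sq_coeff hf).unique ?_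
    simp only [Finset.mul_sum]
    exact hasSum_sum fun i _ => hasSum_norm_sq_cCoeff (memLp_component hf i)
  simp only [h1, h2, Finset.sum_sub_distrib]
  rw [← Finset.mul_sum, Finset.sum_comm]

/-- Up to an error controlled by the tail of `f`, the flux of `f` acts like that of its
truncation. -/
lemma norm_flux_sub_transportForm_le (hα : 1 / 2 ≤ α) {V f : Torus d L → Vec d} (hV : MemLp V 2)
    (hdiv : IsFourierDivFree fun j x => ((V x j : ℝ) : ℂ)) (hB0 : 0 ≤ B)
    (hB : ∀ j, ∀ᵐ x, ‖((V x j : ℝ) : ℂ)‖ ≤ B) (hf : MemLp f 2) (S : Finset (Fin d → ℤ)) :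
    ‖(L : ℂ) ^ d * ∑ l ∈ S, ((waveNorm L l ^ (-2 * α) : ℝ) : ℂ) *
        ∑ i, fluxCoeff V f l i * conj (coeff f l i)
      - transportForm (fun j x => V x j) S (fun k => waveNorm L k ^ (-2 * α)) (coeff f)‖
      ≤ d * (d * (B * (√(l2Norm f ^ 2 - L ^ d * ∑ k ∈ S, ∑ i, ‖coeff f k i‖ ^ 2) *
        ((2 * Real.pi / L) ^ (1 - 2 * α) * l2Norm f)))) := by
  have hLd := side_pow_pos (d := d) (L := L)
  have hD0 : 0 ≤ (2 * Real.pi / L) ^ (1 - 2 * α) := Real.rpow_nonneg two_pi_div_pos.le _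
  set g : Fin d → Torus d L → ℂ := fun i x =>
    ((f x i : ℝ) : ℂ) - trigSum S (fun k => coeff f k i) x with hg
  have hgm : ∀ i, MemLp (g i) 2 := fun i => memLp_sub_trigSum (memLp_component hf i) S _
  have hVi : ∀ j, Integrable fun x => ((V x j : ℝ) : ℂ) := fun j =>
    (memLp_component hV j).integrable one_le_two
  -- The flux is linear in `f`. The truncation of `f` to `S` yields exactly the transport matrix,
  -- and the remainder `g` is the error.
  have h1 : ∀ l i, (L : ℂ) ^ d * fluxCoeff V f l i
      = ∑ k ∈ S, coeff f k i * transportMatrix (fun j x => ((V x j : ℝ) : ℂ)) k l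
        + (L : ℂ) ^ d * ∑ j, Complex.I * wave L l j *
          cCoeff (fun x => ((V x j : ℝ) : ℂ) * g i x) l := by
    intro l i
    rw [← side_mul_sum_cCoeff_mul_trigSum hVi hdiv S (fun k => coeff f k i) l, ← mul_add,
      ← Finset.sum_add_distrib, fluxCoeff]
    congr 1
    refine Finset.sum_congr rfl fun j _ => ?_
    rw [← mul_add, ← cCoeff_add (f := fun x => ((V x j : ℝ) : ℂ) * trigSum S (fun k => coeff f k i) x)
      (g := fun x => ((V x j : ℝ) : ℂ) * g i x)
      ((memLp_component hV j).integrable_mul (memLp_of_continuous (continuous_trigSum S _) 2))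
      ((memLp_component hV j).integrable_mul (hgm i))]
    congr 2
    funext x
    simp only [hg]
    ring
  have h2 : (L : ℂ) ^ d * ∑ l ∈ S, ((waveNorm L l ^ (-2 * α) : ℝ) : ℂ) *
        ∑ i, fluxCoeff V f l i * conj (coeff f l i)
      - transportForm (fun j x => V x j) S (fun k => waveNorm L k ^ (-2 * α)) (coeff f)
      = ∑ i, (L : ℂ) ^ d * ∑ l ∈ S, ((waveNorm L l ^ (-2 * α) : ℝ) : ℂ) *
        ((∑ j, Complex.I * wave L l j * cCoeff (fun x => ((V x j : ℝ) : ℂ) * g i x) l)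
          * conj (coeff f l i)) := by
    have h3 : ∀ l i, (L : ℂ) ^ d * (((waveNorm L l ^ (-2 * α) : ℝ) : ℂ) *
        (fluxCoeff V f l i * conj (coeff f l i)))
        = ((waveNorm L l ^ (-2 * α) : ℝ) : ℂ) * ((∑ k ∈ S, coeff f k i *
          transportMatrix (fun j x => ((V x j : ℝ) : ℂ)) k l) * conj (coeff f l i))
        + (L : ℂ) ^ d * (((waveNorm L l ^ (-2 * α) : ℝ) : ℂ) *
        ((∑ j, Complex.I * wave L l j * cCoeff (fun x => ((V x j : ℝ) : ℂ) * g i x) l)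
          * conj (coeff f l i))) := by
      intro l i
      rw [mul_left_comm, ← mul_assoc ((L : ℂ) ^ d), h1]
      ring
    rw [transportForm, sub_eq_iff_eq_add, Finset.mul_sum]
    simp only [Finset.mul_sum (s := S)]
    rw [Finset.sum_comm (s := Finset.univ), ← Finset.sum_add_distrib]
    refine Finset.sum_congr rfl fun l _ => ?_
    rw [Finset.mul_sum, Finset.mul_sum, Finset.mul_sum, ← Finset.sum_add_distrib]
    refine Finset.sum_congr rfl fun i _ => ?_
    rw [h3, add_comm]
  rw [h2]
  refine (norm_sum_le _ _).trans ((Finset.sum_le_card_nsmul _ _ _ fun i _ => ?_).trans_eq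
    (by rw [Finset.card_univ, Fintype.card_fin, nsmul_eq_mul]))
  refine (norm_weighted_flux_le hα hB0 hB (fun j => (hVi j).1) (hgm i) S (fun l => coeff f l i)
    (l2Norm_nonneg f) ?_).trans ?_
  · rw [Finset.mul_sum]
    refine le_trans (Finset.sum_le_sum fun l _ => ?_) (sum_le_hasSum S (fun k _ => ?_)
      (hasSum_norm_sq_coeff hf))
    · exact mul_le_mul_of_nonneg_left (Finset.single_le_sum (f := fun i => ‖coeff f l i‖ ^ 2)
        (fun _ _ => sq_nonneg _) (Finset.mem_univ i)) hLd.le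
    · exact mul_nonneg hLd.le (Finset.sum_nonneg fun i _ => sq_nonneg _)
  · have h4 : √(∫ x, ‖g i x‖ ^ 2)
        ≤ √(l2Norm f ^ 2 - L ^ d * ∑ k ∈ S, ∑ i, ‖coeff f k i‖ ^ 2) := by
      rw [← sum_integral_norm_sq_sub_trigSum hf S]
      exact Real.sqrt_le_sqrt (Finset.single_le_sum (f := fun i => ∫ x, ‖g i x‖ ^ 2)
        (fun _ _ => integral_nonneg fun x => sq_nonneg _) (Finset.mem_univ i))
    have := l2Norm_nonneg f
    gcongr

end FluxSplitting

end VectorMixing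

end

noncomputable section

namespace VectorMixing

open scoped ComplexConjugate

/-! ### The energy inequality and the lower bound for the limit -/

section LimitEnergy

variable {d : ℕ} {L : ℝ} [hL : Fact (0 < L)] {B : ℝ} {U : ℝ → Torus d L → Vec d}
  {u₀ : Torus d L → Vec d} {uN : ℕ → ℝ → Torus d L → Vec d} {n : ℕ → ℕ}
  {u v : ℝ → Torus d L → Vec d} {α : ℝ}

/-- The squared `L²` norm of the part of `f` with frequencies outside the box. -/
def tailEnergy (f : Torus d L → Vec d) (R : ℕ) : ℝ :=
  l2Norm f ^ 2 - L ^ d * ∑ k ∈ freqBox d R, ∑ i, ‖coeff f k i‖ ^ 2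

/-- The part of the squared negative Sobolev norm from frequencies in the box. -/
def boxEnergy (α : ℝ) (f : Torus d L → Vec d) (R : ℕ) : ℝ :=
  L ^ d * ∑ k ∈ freqBox d R, waveNorm L k ^ (-2 * α) * ∑ i, ‖coeff f k i‖ ^ 2

lemma tendsto_tailEnergy {f : Torus d L → Vec d} (hf : MemLp f 2) :
    Tendsto (tailEnergy f) atTop (𝓝 0) := by
  have h1 : Tendsto (fun R => ∑ k ∈ freqBox d R, L ^ d * ∑ i, ‖coeff f k i‖ ^ 2) atTop
      (𝓝 (l2Norm f ^ 2)) := (hasSum_norm_sq_coeff hf).comp tendsto_freqBox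
  simp only [← Finset.mul_sum] at h1
  have h2 := h1.const_sub (l2Norm f ^ 2)
  rwa [sub_self] at h2

lemma tailEnergy_le (f : Torus d L → Vec d) (R : ℕ) : tailEnergy f R ≤ l2Norm f ^ 2 :=
  sub_le_self _ (mul_nonneg side_pow_pos.le (Finset.sum_nonneg fun _ _ =>
    Finset.sum_nonneg fun _ _ => sq_nonneg _))

lemma summable_waveNorm_rpow_mul (hα : 0 < α) {f : Torus d L → Vec d} (hf : MemLp f 2) :
    Summable fun k : Fin d → ℤ => waveNorm L k ^ (-2 * α) * ∑ i, ‖coeff f k i‖ ^ 2 := by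
  have hLd := side_pow_pos (d := d) (L := L)
  refine summable_mul_of_sum_le (fun k => Real.rpow_nonneg (waveNorm_nonneg k) _)
    (waveNorm_rpow_le' hα) (fun k => Finset.sum_nonneg fun i _ => sq_nonneg _)
    (B := (L ^ d)⁻¹ * l2Norm f ^ 2) fun S => ?_
  rw [inv_mul_eq_div, le_div_iff₀' hLd, Finset.mul_sum]
  exact sum_le_hasSum S (fun k _ => mul_nonneg hLd.le (Finset.sum_nonneg fun i _ => sq_nonneg _))
    (hasSum_norm_sq_coeff hf)

lemma tendsto_boxEnergy (hα : 0 < α) {f : Torus d L → Vec d} (hf : MemLp f 2) :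
    Tendsto (boxEnergy α f) atTop (𝓝 (negSobolevNorm α f ^ 2)) := by
  rw [negSobolevNorm_sq]
  exact ((summable_waveNorm_rpow_mul hα hf).hasSum.comp tendsto_freqBox).const_mul _

lemma boxEnergy_nonneg (α : ℝ) (f : Torus d L → Vec d) (R : ℕ) : 0 ≤ boxEnergy α f R :=
  mul_nonneg side_pow_pos.le (Finset.sum_nonneg fun k _ => mul_nonneg
    (Real.rpow_nonneg (waveNorm_nonneg k) _) (Finset.sum_nonneg fun _ _ => sq_nonneg _))

lemma boxEnergy_le (hα : 0 < α) {f : Torus d L → Vec d} (hf : MemLp f 2) (R : ℕ) :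
    boxEnergy α f R ≤ negSobolevNorm α f ^ 2 := by
  rw [negSobolevNorm_sq]
  refine mul_le_mul_of_nonneg_left ((summable_waveNorm_rpow_mul hα hf).sum_le_tsum _ fun k _ =>
    mul_nonneg (Real.rpow_nonneg (waveNorm_nonneg k) _) (Finset.sum_nonneg fun _ _ => sq_nonneg _))
    side_pow_pos.le

namespace IsSpectralLimit

variable (H : IsSpectralLimit B U u₀ uN n u)

include H

/-- The limit coefficients solve their integrated equation by construction. Its flux contains `u`,
which may be replaced by `v` since they agree at almost every time. -/
lemma boxEnergy_sub_eq
    (hv : ∀ t, 0 ≤ t → MemLp (v t) 2 ∧ ∀ k i, coeff (v t) k i = limitCoeff U u₀ u t k i)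
    (R : ℕ) {s t : ℝ} (hs : 0 ≤ s) (hst : s ≤ t) :
    boxEnergy α (v s) R - boxEnergy α (v t) R
      = ∫ r in s..t, 2 * ((L : ℂ) ^ d * ∑ l ∈ freqBox d R, ((waveNorm L l ^ (-2 * α) : ℝ) : ℂ) *
        ∑ i, fluxCoeff (U r) (v r) l i * conj (coeff (v r) l i)).re := by
  have h1 := weightedEnergy_sub_eq (S := freqBox d R) (η := fun k => waveNorm L k ^ (-2 * α))
    (c := limitCoeff U u₀ u) (F := fun s => fluxCoeff (U s) (u s)) (c₀ := coeff u₀)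
    (fun k _ i t ht => H.intervalIntegrable_rate k i ht) (fun k _ i t _ => rfl)
    (fun k _ t ht => H.sum_limitCoeff_mul ht k) hs hst
  have h2 : ∀ t, 0 ≤ t → boxEnergy α (v t) R = L ^ d * ∑ k ∈ freqBox d R,
      waveNorm L k ^ (-2 * α) * ∑ i, ‖limitCoeff U u₀ u t k i‖ ^ 2 := fun t ht => by
    simp only [boxEnergy, (hv t ht).2]
  rw [h2 s hs, h2 t (hs.trans hst), ← mul_sub, ← neg_sub, h1, ← intervalIntegral.integral_neg,
    ← intervalIntegral.integral_const_mul]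
  refine intervalIntegral.integral_congr_ae ?_
  rw [uIoc_of_le hst]
  filter_upwards [ae_Ioc_of_ae_Ioi (H.ae_eq_of_coeff_eq_limitCoeff hv) hs t] with r hr hr'
  have h3 := hr hr'
  simp only [(hv r (hs.trans hr'.1.le)).2, fluxCoeff_congr_ae h3, neg_neg]
  rw [← Complex.ofReal_pow, Complex.re_ofReal_mul]
  ring

/-- The error in the energy inequality on a box. -/
lemma ae_re_flux_le (hd : 1 ≤ d) (hα : 1 / 2 ≤ α) (hα1 : α < 1) {q : ℝ≥0∞} (hq2 : 2 ≤ q)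
    (hq : d / q.toReal ≤ 1 - α) (hU : supSobolevNorm q U < ⊤)
    (hv : ∀ t, 0 ≤ t → MemLp (v t) 2 ∧ ∀ k i, coeff (v t) k i = limitCoeff U u₀ u t k i)
    (R : ℕ) : ∀ᵐ r ∂(volume.restrict (Ioi (0 : ℝ))),
      ((L : ℂ) ^ d * ∑ l ∈ freqBox d R, ((waveNorm L l ^ (-2 * α) : ℝ) : ℂ) *
        ∑ i, fluxCoeff (U r) (v r) l i * conj (coeff (v r) l i)).re
      ≤ commutatorConst hd α * (2 / α + 2) * (supSobolevNorm q U).toReal *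
          (l2Norm u₀ ^ 2) ^ ((1 - α) / α / 2) *
          (negSobolevNorm α (v r) ^ 2) ^ (1 - (1 - α) / α / 2)
        + d * (d * (B * (√(tailEnergy (v r) R) *
          ((2 * Real.pi / L) ^ (1 - 2 * α) * l2Norm u₀)))) := by
  have hα0 : 0 < α := by linarith
  have hC := commutatorConst_nonneg hd hα0 hα1
  have hA0 : 0 ≤ (supSobolevNorm q U).toReal := ENNReal.toReal_nonneg
  have hσ0 : 0 ≤ (1 - α) / α / 2 :=
    div_nonneg (div_nonneg (by linarith) hα0.le) zero_le_two
  have hσ1 : 0 ≤ 1 - (1 - α) / α / 2 := by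
    have : (1 - α) / α ≤ 1 := (div_le_one hα0).2 (by linarith)
    linarith
  filter_upwards [ae_restrict_mem measurableSet_Ioi, H.ae_memLp, H.divFree, H.bound,
    ae_sobolevNorm_le hU] with r hr0 hr1 hr2 hr3 hr4
  have hr0' : 0 ≤ r := le_of_lt hr0
  have hvr := (hv r hr0').1
  have hl2 := H.l2Norm_sq_le hv hr0'
  have hl2' : l2Norm (v r) ≤ l2Norm u₀ := (sq_le_sq₀ (l2Norm_nonneg _) (l2Norm_nonneg _)).1 hl2
  have h1 := norm_flux_sub_transportForm_le hα hr1 hr2 H.nonneg hr3 hvr (freqBox d R)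
  have h2 := (Complex.abs_re_le_norm _).trans h1
  rw [Complex.sub_re] at h2
  have h3 := abs_re_transportForm_le (U := fun j x => U r x j) hd hα hα1
    (fun j => integrable_component (hr1.integrable one_le_two) j) hr2
    (M := (2 / α + 2) * (supSobolevNorm q U).toReal) (by positivity)
    (fun h j => ae_norm_increment_le hq2 hα0 hq hA0 hr4 h j) (freqBox d R) (coeff (v r))
  have hbox0 : 0 ≤ L ^ d * ∑ k ∈ freqBox d R, ∑ i, ‖coeff (v r) k i‖ ^ 2 :=
    mul_nonneg side_pow_pos.le (Finset.sum_nonneg fun _ _ => Finset.sum_nonneg fun _ _ =>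
      sq_nonneg _)
  have hbox : L ^ d * ∑ k ∈ freqBox d R, ∑ i, ‖coeff (v r) k i‖ ^ 2 ≤ l2Norm u₀ ^ 2 := by
    refine le_trans ?_ hl2
    rw [Finset.mul_sum]
    exact sum_le_hasSum _ (fun k _ => mul_nonneg side_pow_pos.le
      (Finset.sum_nonneg fun i _ => sq_nonneg _)) (hasSum_norm_sq_coeff hvr)
  have h4 : (L ^ d * ∑ k ∈ freqBox d R, ∑ i, ‖coeff (v r) k i‖ ^ 2) ^ ((1 - α) / α / 2) *
      (L ^ d * ∑ k ∈ freqBox d R, waveNorm L k ^ (-2 * α) * ∑ i, ‖coeff (v r) k i‖ ^ 2) ^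
        (1 - (1 - α) / α / 2)
      ≤ (l2Norm u₀ ^ 2) ^ ((1 - α) / α / 2) *
        (negSobolevNorm α (v r) ^ 2) ^ (1 - (1 - α) / α / 2) :=
    mul_le_mul (Real.rpow_le_rpow hbox0 hbox hσ0)
      (Real.rpow_le_rpow (boxEnergy_nonneg α (v r) R) (boxEnergy_le hα0 hvr R) hσ1)
      (Real.rpow_nonneg (boxEnergy_nonneg α (v r) R) _) (Real.rpow_nonneg (sq_nonneg _) _)
  have h5 := mul_le_mul_of_nonneg_left h4
    (mul_nonneg hC (mul_nonneg (by positivity : (0 : ℝ) ≤ 2 / α + 2) hA0))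
  have h6 : (d : ℝ) * (d * (B * (√(tailEnergy (v r) R) *
      ((2 * Real.pi / L) ^ (1 - 2 * α) * l2Norm (v r)))))
      ≤ d * (d * (B * (√(tailEnergy (v r) R) *
      ((2 * Real.pi / L) ^ (1 - 2 * α) * l2Norm u₀)))) := by
    have := H.nonneg
    have := Real.rpow_nonneg (two_pi_div_pos (L := L)).le (1 - 2 * α)
    gcongr
  have h7 := le_of_abs_le h2
  have h8 := le_of_abs_le h3
  unfold tailEnergy at h6 ⊢
  linarith

/-- The `L²` norm of `v r` is a limit of finite sums that are continuous in r, so joint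
measurability of `v` is not needed. -/
lemma aemeasurable_tailEnergy
    (hv : ∀ t, 0 ≤ t → MemLp (v t) 2 ∧ ∀ k i, coeff (v t) k i = limitCoeff U u₀ u t k i) (R : ℕ) :
    AEMeasurable (fun r => tailEnergy (v r) R) (volume.restrict (Ioi (0 : ℝ))) := by
  have h1 : ∀ R : ℕ, AEMeasurable (fun r => L ^ d * ∑ k ∈ freqBox d R, ∑ i, ‖coeff (v r) k i‖ ^ 2)
      (volume.restrict (Ioi (0 : ℝ))) := by
    intro R
    refine (ContinuousOn.aestronglyMeasurable ?_ measurableSet_Ioi).aemeasurable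
    refine continuousOn_const.mul (continuousOn_finsetSum _ fun k _ =>
      continuousOn_finsetSum _ fun i _ => ContinuousOn.pow (ContinuousOn.norm ?_) 2)
    exact ((H.continuousOn_limitCoeff k i).mono Ioi_subset_Ici_self).congr
      fun r hr => (hv r (le_of_lt hr)).2 k i
  refine AEMeasurable.sub ?_ (h1 R)
  refine aemeasurable_of_tendsto_metrizable_ae atTop h1 ?_
  filter_upwards [ae_restrict_mem measurableSet_Ioi] with r hr
  have h2 : Tendsto (fun R => ∑ k ∈ freqBox d R, L ^ d * ∑ i, ‖coeff (v r) k i‖ ^ 2) atTop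
      (𝓝 (l2Norm (v r) ^ 2)) :=
    (hasSum_norm_sq_coeff (hv r (le_of_lt hr)).1).comp tendsto_freqBox
  simpa only [← Finset.mul_sum] using h2

lemma integrableOn_sqrt_tailEnergy
    (hv : ∀ t, 0 ≤ t → MemLp (v t) 2 ∧ ∀ k i, coeff (v t) k i = limitCoeff U u₀ u t k i) (R : ℕ)
    {s : ℝ} (hs : 0 ≤ s) (t : ℝ) : IntegrableOn (fun r => √(tailEnergy (v r) R)) (Ioc s t) ∧
      ∀ᵐ r ∂(volume.restrict (Ioc s t)), ‖√(tailEnergy (v r) R)‖ ≤ l2Norm u₀ := by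
  have hsub : Ioc s t ⊆ Ioi 0 := fun r hr => hs.trans_lt hr.1
  have hb : ∀ᵐ r ∂(volume.restrict (Ioc s t)), ‖√(tailEnergy (v r) R)‖ ≤ l2Norm u₀ := by
    filter_upwards [ae_restrict_mem measurableSet_Ioc] with r hr
    rw [Real.norm_of_nonneg (Real.sqrt_nonneg _), Real.sqrt_le_left (l2Norm_nonneg _)]
    exact (tailEnergy_le _ R).trans (H.l2Norm_sq_le hv (le_of_lt (hsub hr)))
  refine ⟨Integrable.of_bound ?_ _ hb, hb⟩
  exact ((H.aemeasurable_tailEnergy hv R).mono_measure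
    (Measure.restrict_mono hsub le_rfl)).sqrt.aestronglyMeasurable

/-- The integral inequality for the negative Sobolev norm of the limit. -/
lemma negSobolevNorm_sq_sub_le (hd : 1 ≤ d) (hα : 1 / 2 ≤ α) (hα1 : α < 1) {q : ℝ≥0∞}
    (hq2 : 2 ≤ q) (hq : d / q.toReal ≤ 1 - α) (hU : supSobolevNorm q U < ⊤)
    (hv : ∀ t, 0 ≤ t → MemLp (v t) 2 ∧ ∀ k i, coeff (v t) k i = limitCoeff U u₀ u t k i)
    {s t : ℝ} (hs : 0 ≤ s) (hst : s ≤ t) :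
    negSobolevNorm α (v s) ^ 2 - negSobolevNorm α (v t) ^ 2
      ≤ ∫ r in s..t, 2 * (commutatorConst hd α * (2 / α + 2) * (supSobolevNorm q U).toReal *
          (l2Norm u₀ ^ 2) ^ ((1 - α) / α / 2)) *
          (negSobolevNorm α (v r) ^ 2) ^ (1 - (1 - α) / α / 2) := by
  have hα0 : 0 < α := by linarith
  have hC := commutatorConst_nonneg hd hα0 hα1
  have hσ1 : 0 ≤ 1 - (1 - α) / α / 2 := by
    have : (1 - α) / α ≤ 1 := (div_le_one hα0).2 (by linarith)
    linarith
  set K := commutatorConst hd α * (2 / α + 2) * (supSobolevNorm q U).toReal *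
    (l2Norm u₀ ^ 2) ^ ((1 - α) / α / 2) with hK
  have hK0 : 0 ≤ K := by
    have : 0 ≤ (supSobolevNorm q U).toReal := ENNReal.toReal_nonneg
    positivity
  set Q := (d : ℝ) * (d * (B * ((2 * Real.pi / L) ^ (1 - 2 * α) * l2Norm u₀))) with hQ
  have hQ0 : 0 ≤ Q := by
    have := H.nonneg
    have := l2Norm_nonneg u₀
    have := Real.rpow_nonneg (two_pi_div_pos (L := L)).le (1 - 2 * α)
    positivity
  have hmain : IntervalIntegrable (fun r => 2 * K *
      (negSobolevNorm α (v r) ^ 2) ^ (1 - (1 - α) / α / 2)) volume s t := by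
    refine ContinuousOn.intervalIntegrable ?_
    rw [uIcc_of_le hst]
    exact continuousOn_const.mul (ContinuousOn.rpow_const
      ((H.continuousOn_negSobolevNorm_sq hα0 hv).mono fun x hx => hs.trans hx.1)
      fun x _ => Or.inr hσ1)
  have herr : ∀ R, IntervalIntegrable (fun r => 2 * Q * √(tailEnergy (v r) R)) volume s t :=
    fun R => ((intervalIntegrable_iff_integrableOn_Ioc_of_le hst).2
      (H.integrableOn_sqrt_tailEnergy hv R hs t).1).const_mul _
  -- On a finite box the energy identity is available. The price is an error proportional to the
  -- square root of the tail energy.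
  have hbox : ∀ R, boxEnergy α (v s) R - boxEnergy α (v t) R
      ≤ (∫ r in s..t, 2 * K * (negSobolevNorm α (v r) ^ 2) ^ (1 - (1 - α) / α / 2))
        + ∫ r in s..t, 2 * Q * √(tailEnergy (v r) R) := by
    intro R
    rw [H.boxEnergy_sub_eq hv R hs hst, ← intervalIntegral.integral_add hmain (herr R)]
    by_cases hi : IntervalIntegrable (fun r => 2 * ((L : ℂ) ^ d * ∑ l ∈ freqBox d R,
        ((waveNorm L l ^ (-2 * α) : ℝ) : ℂ) *
        ∑ i, fluxCoeff (U r) (v r) l i * conj (coeff (v r) l i)).re) volume s t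
    · refine intervalIntegral.integral_mono_ae_restrict hst hi (hmain.add (herr R)) ?_
      rw [EventuallyLE, ← restrict_Ioc_eq_restrict_Icc, ae_restrict_iff' measurableSet_Ioc]
      filter_upwards [ae_Ioc_of_ae_Ioi (H.ae_re_flux_le hd hα hα1 hq2 hq hU hv R) hs t]
        with r hr hr'
      have h1 := hr hr'
      rw [← hK] at h1
      have h2 : (d : ℝ) * (d * (B * (√(tailEnergy (v r) R) *
          ((2 * Real.pi / L) ^ (1 - 2 * α) * l2Norm u₀)))) = Q * √(tailEnergy (v r) R) := by
        rw [hQ]; ring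
      rw [h2] at h1
      linarith
    · rw [intervalIntegral.integral_undef hi]
      refine intervalIntegral.integral_nonneg hst fun r _ => ?_
      positivity
  -- The tail vanishes at each time and is dominated by the initial `L²` norm.
  have hlim : Tendsto (fun R => ∫ r in s..t, 2 * Q * √(tailEnergy (v r) R)) atTop (𝓝 0) := by
    simp only [intervalIntegral.integral_of_le hst, integral_const_mul]
    have h1 := tendsto_integral_of_dominated_convergence (μ := volume.restrict (Ioc s t))
      (F := fun R r => √(tailEnergy (v r) R)) (f := fun _ => (0 : ℝ)) (fun _ => l2Norm u₀)
      (fun R => (H.integrableOn_sqrt_tailEnergy hv R hs t).1.1) (integrable_const _)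
      (fun R => (H.integrableOn_sqrt_tailEnergy hv R hs t).2) ?_
    · simpa using h1.const_mul (2 * Q)
    · filter_upwards [ae_restrict_mem measurableSet_Ioc] with r hr
      simpa using (tendsto_tailEnergy (hv r (hs.trans hr.1.le)).1).sqrt
  have hlim2 := hlim.const_add
    (∫ r in s..t, 2 * K * (negSobolevNorm α (v r) ^ 2) ^ (1 - (1 - α) / α / 2))
  rw [add_zero] at hlim2
  exact le_of_tendsto_of_tendsto' ((tendsto_boxEnergy hα0 (hv s hs).1).sub
    (tendsto_boxEnergy hα0 (hv t (hs.trans hst)).1)) hlim2 hbox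

/-- The same Gronwall argument as for the approximations, now with the Hölder constant of `U`
itself. The `L²` norm of the limit is only known not to exceed its initial value, which is the
direction needed. -/
theorem lowerBound_le (hd : 1 ≤ d) (hα : 1 / 2 ≤ α) (hα1 : α < 1) {q : ℝ≥0∞}
    (hq2 : 2 ≤ q) (hq : d / q.toReal ≤ 1 - α) (hU : supSobolevNorm q U < ⊤)
    (hv : ∀ t, 0 ≤ t → MemLp (v t) 2 ∧ ∀ k i, coeff (v t) k i = limitCoeff U u₀ u t k i)
    {C : ℝ} (hC : commutatorConst hd α * (2 / α + 2) ≤ C) {t : ℝ} (ht : 0 ≤ t) :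
    lowerBound α C (negSobolevNorm α u₀) (l2Norm u₀) (supSobolevNorm q U).toReal t
      ≤ negSobolevNorm α (v t) := by
  have hα0 : 0 < α := by linarith
  have h0 : negSobolevNorm α u₀ = negSobolevNorm α (v 0) := by
    simp only [negSobolevNorm, coeff_congr_ae (H.zero_ae_eq hv)]
  rw [h0]
  exact lowerBound_le_of_integral_le (n := fun t => negSobolevNorm α (v t)) hα hα1
    (mul_nonneg (commutatorConst_nonneg hd hα0 hα1) (by positivity)) hC ENNReal.toReal_nonneg
    (l2Norm_nonneg _) (fun t => negSobolevNorm_nonneg α (v t))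
    (H.continuousOn_negSobolevNorm_sq hα0 hv)
    (fun s t hs hst => H.negSobolevNorm_sq_sub_le hd hα hα1 hq2 hq hU hv hs hst) ht

end IsSpectralLimit

/-- A positive lower bound for the norm excludes perfect mixing. -/
lemma minMixingTime_le_mixingTime (hα : 0 < α) (hα1 : α < 1) {C a b M : ℝ}
    (hv : ∀ t, 0 ≤ t → lowerBound α C a b M t ≤ negSobolevNorm α (v t)) :
    minMixingTime α C a b M ≤ mixingTime α v := by
  refine le_iInf fun t => le_iInf fun ht => le_iInf fun h0 => ?_
  have h1 := hv t ht
  rw [h0, lowerBound] at h1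
  have hexp : 0 < α / (1 - α) := div_pos hα (by linarith)
  have h2 : max (a ^ ((1 - α) / α) - t * ((1 - α) / α) * C * b ^ ((1 - α) / α) * M) 0 ≤ 0 := by
    by_contra hn
    exact absurd h1 (not_le.2 (Real.rpow_pos_of_pos (not_le.1 hn) _))
  have h3 := (le_max_left _ _).trans h2
  have h4 : α * a ^ ((1 - α) / α) ≤ t * ((1 - α) * C * b ^ ((1 - α) / α) * M) := by
    have h5 := mul_le_mul_of_nonneg_left (sub_nonpos.1 h3) hα.le
    refine h5.trans_eq ?_
    field_simp
  -- This includes a vanishing denominator: the numerator then vanishes too, and `0 / 0 = 0` in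
  -- `ℝ≥0∞`.
  refine ENNReal.div_le_of_le_mul ?_
  rw [← ENNReal.ofReal_mul ht]
  exact ENNReal.ofReal_le_ofReal h4

lemma isSpectralLimit_of_sobolev (hα : 0 < α) {q : ℝ≥0∞} (hq2 : 2 ≤ q)
    (hq : d / q.toReal ≤ 1 - α)
    (hUm : AEStronglyMeasurable (Function.uncurry U) ((volume.restrict (Ioi (0 : ℝ))).prod volume))
    (hU : supSobolevNorm q U < ⊤)
    (hdiv : ∀ᵐ t ∂(volume.restrict (Ioi (0 : ℝ))), IsDivFree (U t)) (hu₀ : MemLp u₀ 2)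
    (hdiv₀ : IsDivFree u₀) (hsol : ∀ N, IsSpectralSolution N U u₀ (uN N)) (hn : StrictMono n)
    (hlim : IsWeakStarLimit (fun j => uN (n j)) u) :
    IsSpectralLimit ((min 1 L ^ α / α + min 1 L ^ (α - 1)) * ((supSobolevNorm q U).toReal + 1))
      U u₀ uN n u where
  nonneg := by
    have : 0 ≤ min 1 L := le_min zero_le_one hL.out.le
    have : 0 ≤ (supSobolevNorm q U).toReal := ENNReal.toReal_nonneg
    positivity
  measurable := hUm
  divFree := ae_isFourierDivFree hU hdiv
  bound := by
    filter_upwards [ae_sobolevNorm_le hU] with t ht j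
    exact ae_norm_component_le hq2 hα hq ENNReal.toReal_nonneg ht j
  memLp_init := hu₀
  divFree_init := hdiv₀
  solution := hsol
  strictMono := hn
  limit := hlim

end LimitEnergy

end VectorMixing

end

/-! ### The theorem -/

open VectorMixing in
theorem lemma3p2 (d : ℕ) (hd : 1 ≤ d) (α : ℝ) (hα : 1 / 2 ≤ α) (q : ℝ≥0∞)
    (hq : (q ≠ ⊤ ∧ (d : ℝ) < q.toReal * (1 - α)) ∨ (q = ⊤ ∧ α < 1)) :
    ∃ C : ℝ, 0 < C ∧
      ∀ (L : ℝ) [Fact (0 < L)]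
        (U : ℝ → Torus d L → Vec d) (u₀ : Torus d L → Vec d) (uN : ℕ → ℝ → Torus d L → Vec d),
        -- `U` is a divergence-free field in `L^∞(ℝ⁺; W^{1,q})`
        AEStronglyMeasurable (Function.uncurry U)
          ((volume.restrict (Ioi (0 : ℝ))).prod volume) →
        supSobolevNorm q U < ⊤ →
        (∀ᵐ t ∂(volume.restrict (Ioi (0 : ℝ))), IsDivFree (U t)) →
        -- `u₀` is a mean-zero divergence-free field in `L²`
        MemLp u₀ 2 volume → IsDivFree u₀ → ∫ x, u₀ x = 0 →
        -- `uN N` is the approximation by the spectral scheme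
        (∀ N, IsSpectralSolution N U u₀ (uN N)) →
        (∀ (N : ℕ) (t : ℝ), 0 ≤ t →
          lowerBound α C (negSobolevNorm α (uN N 0)) (l2Norm (uN N 0))
            (supSobolevNorm q (fun s => truncate N (U s))).toReal t
            ≤ negSobolevNorm α (uN N t)) ∧
        (∀ (n : ℕ → ℕ) (u : ℝ → Torus d L → Vec d), StrictMono n →
          IsWeakStarLimit (fun j => uN (n j)) u →
          ∃ v : ℝ → Torus d L → Vec d,
            IsContinuousRepresentative α u v ∧ v 0 =ᵐ[volume] u₀ ∧
            (∀ t : ℝ, 0 ≤ t →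
              lowerBound α C (negSobolevNorm α u₀) (l2Norm u₀) (supSobolevNorm q U).toReal t
                ≤ negSobolevNorm α (v t)) ∧
            minMixingTime α C (negSobolevNorm α u₀) (l2Norm u₀) (supSobolevNorm q U).toReal
              ≤ mixingTime α v) := by
  obtain ⟨hα1, hq2, hqd⟩ := exponent_conditions hd hα hq
  have hα0 : 0 < α := by linarith
  have hC₀ : 0 ≤ commutatorConst hd α * (2 / α + 2) :=
    mul_nonneg (commutatorConst_nonneg hd hα0 hα1) (by positivity)
  -- The commutator constant times Morrey's constant; adding 1 makes it positive.
  refine ⟨commutatorConst hd α * (2 / α + 2) + 1, by linarith, ?_⟩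
  intro L _ U u₀ uN hUm hU hdiv hu₀ hdiv₀ _ hsol
  have hC : commutatorConst hd α * (2 / α + 2) ≤ commutatorConst hd α * (2 / α + 2) + 1 :=
    le_add_of_nonneg_right zero_le_one
  refine ⟨fun N t ht => (hsol N).lowerBound_le hd hα hα1 hq2 hqd hU hdiv hC ht,
    fun n u hn hlim => ?_⟩
  have H := isSpectralLimit_of_sobolev hα0 hq2 hqd hUm hU hdiv hu₀ hdiv₀ hsol hn hlim
  obtain ⟨v, hv⟩ := H.exists_coeff_eq_limitCoeff
  have hbound : ∀ t : ℝ, 0 ≤ t →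
      lowerBound α (commutatorConst hd α * (2 / α + 2) + 1) (negSobolevNorm α u₀) (l2Norm u₀)
        (supSobolevNorm q U).toReal t ≤ negSobolevNorm α (v t) := fun t ht =>
    H.lowerBound_le hd hα hα1 hq2 hqd hU hv hC ht
  exact ⟨v, H.isContinuousRepresentative hα0 hv, H.zero_ae_eq hv, hbound,
    minMixingTime_le_mixingTime hα0 hα1 hbound⟩
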